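/- Let $k$ be an algebraically closed field. A \emph{thread quiver} $Q$ consists of a (small) quiver with vertex set $Q_0$ and arrow set $Q_1$, a decomposition $Q_1 = Q_s \coprod Q_t$ into standard arrows and thread arrows, and for every thread arrow $t$ a (small, possibly empty) linearly ordered set $\mathcal T_t$. Write $Q_r$ for the underlying quiver, in which standard and thread arrows are not distinguished. It is \emph{strongly locally finite} if every vertex is incident to only finitely many arrows and there are no infinite paths $\bullet\to\bullet\to\cdots$ or $\cdots\to\bullet\to\bullet$. For a small category $\mathcal C$ let $k\mathcal C$ be the free $k$-linear additive category on $\mathcal C$ (linearize the Hom-sets, then formally add finite direct sums), and let $kQ_r$ be the free $k$-linear additive category on the path category of $Q_r$. For a thread arrow $t : x_t \to y_t$ put $\mathcal L_t = \mathbb N\cdot(\mathcal T_t \stackrel{\to}{\times} \mathbb Z)\cdot -\mathbb N$, where $\stackrel{\to}{\times}$ is the lexicographic product, $-\mathbb N$ is $\mathbb N$ with the opposite order, and $A\cdot B$ means ``first $A$, then $B$''. Let $f : \bigoplus_{t\in Q_t} k(\cdot\to\cdot) \to kQ_r$ be the functor which sends $\cdot\to\cdot$ to the arrow $t$, and let $g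 : \bigoplus_{t\in Q_t} k(\cdot\to\cdot) \to \bigoplus_{t\in Q_t} k\mathcal L_t$ be the functor which sends $\cdot\to\cdot$ to the unique morphism from the minimal to the maximal element of $\mathcal L_t$. The category $kQ$ is a 2-pushout of $f$ and $g$ in the 2-category of small $k$-linear additive categories, $k$-linear functors and natural transformations; thus for every small $k$-linear additive category $\mathcal E$, composition with the structure functors $i : kQ_r \to kQ$, $j : \bigoplus_t k\mathcal L_t \to kQ$ and the structure isomorphism $i\circ f\cong j\circ g$ is an equivalence from the category of $k$-linear functors $kQ\to\mathcal E$ to the category of triples $(F,G,\alpha)$ with $F: kQ_r\to\mathcal E$, $G:\bigoplus_t k\mathcal L_t\to\mathcal E$ $k$-linear functors and $\alpha: F\circ f\cong G\circ g$ a natural isomorphism (morphisms being the pairs of natural transformations $F \to F'$, $G \to G'$ compatible with $\alpha$ and $\alpha'$). For a $k$-linear additive category $\mathfrak a$ let $\operatorname{mod}\mathfrak a$ be the category of contravariant functors $M$ from $\mathfrak a$ to $k$-vector spaces that have a presentation $\mathfrak a(-,A)\to\mathfrak a(-,B)\to M\to 0$, let $\mathfrak a^\circ$ be the opposite category, and let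 $D$ be the contravariant functor given by $(DM)(X)=\operatorname{Hom}_k(M(X),k)$. \textbf{Proposition.} Let $Q$ be a thread quiver for which $Q_r$ is strongly locally finite. Then the 2-pushout $kQ$ exists, and $kQ$ (which is determined up to equivalence) is a semi-hereditary dualizing $k$-variety. That is: \begin{enumerate} \item $kQ$ is a finite $k$-variety: it is additive, all its Hom-spaces are finite-dimensional over $k$, and all idempotents split; \item $kQ$ is semi-hereditary: $\operatorname{mod} kQ$ is abelian and hereditary, i.e. $\operatorname{Ext}^i$ vanishes on $\operatorname{mod} kQ$ for all $i\ge 2$; \item $kQ$ is dualizing: $D$ restricts to a duality (a contravariant equivalence) $\operatorname{mod} kQ\to\operatorname{mod} kQ^\circ$. \end{enumerate} -/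

import Mathlib

universe u

open CategoryTheory Limits Opposite

namespace ThreadQuivers

noncomputable section

/-! ## `k`-linear structures that are not in Mathlib -/

section LinearInstances

variable (k : Type u) [Field k]

/-- The `k`-linear structure on the opposite category. -/
instance linearOpposite (A : Type u) [Category.{u} A] [Preadditive A] [Linear k A] :
    Linear k Aᵒᵖ where
  homModule _ _ :=
    { smul := fun r f => (r • f.unop).op
      one_smul := fun f => Quiver.Hom.unop_inj (one_smul k f.unop)
      mul_smul := fun r s f => Quiver.Hom.unop_inj (mul_smul r s f.unop)
      smul_zero := fun r => Quiver.Hom.unop_inj (smul_zero r)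
      smul_add := fun r f g => Quiver.Hom.unop_inj (smul_add r f.unop g.unop)
      add_smul := fun r s f => Quiver.Hom.unop_inj (add_smul r s f.unop)
      zero_smul := fun f => Quiver.Hom.unop_inj (zero_smul k f.unop) }
  smul_comp _ _ _ r f g := Quiver.Hom.unop_inj (Linear.comp_smul _ _ _ g.unop r f.unop)
  comp_smul _ _ _ f r g := Quiver.Hom.unop_inj (Linear.smul_comp _ _ _ r g.unop f.unop)

/-- The entrywise `k`-linear structure on matrices of morphisms. -/
instance linearMat (A : Type u) [Category.{u} A] [Preadditive A] [Linear k A] :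
    Linear k (Mat_ A) where
  homModule M N :=
    { smul := fun r f i j => r • f i j
      one_smul := fun f => Mat_.hom_ext _ _ fun i j => one_smul k (f i j)
      mul_smul := fun r s f => Mat_.hom_ext _ _ fun i j => mul_smul r s (f i j)
      smul_zero := fun r => Mat_.hom_ext _ _ fun i j => smul_zero r
      smul_add := fun r f g => Mat_.hom_ext _ _ fun i j => smul_add r (f i j) (g i j)
      add_smul := fun r s f => Mat_.hom_ext _ _ fun i j => add_smul r s (f i j)
      zero_smul := fun f => Mat_.hom_ext _ _ fun i j => zero_smul k (f i j) }
  smul_comp M N K r f g := Mat_.hom_ext _ _ fun i j => by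
    change ∑ l, (r • f i l) ≫ g l j = r • ∑ l, f i l ≫ g l j
    simp [Finset.smul_sum]
  comp_smul M N K f r g := Mat_.hom_ext _ _ fun i j => by
    change ∑ l, f i l ≫ (r • g l j) = r • ∑ l, f i l ≫ g l j
    simp [Finset.smul_sum]

end LinearInstances

/-! ## The 2-category of small `k`-linear additive categories -/

/-- A small `k`-linear additive category. -/
structure LinAddCat (k : Type u) [Field k] where
  carrier : Type u
  [category : Category.{u} carrier]
  [preadditive : Preadditive carrier]
  [linear : Linear k carrier]
  [hasFiniteBiproducts : HasFiniteBiproducts carrier]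

namespace LinAddCat

variable {k : Type u} [Field k]

instance : CoeSort (LinAddCat k) (Type u) := ⟨LinAddCat.carrier⟩

instance (A : LinAddCat k) : Category.{u} A := A.category
instance (A : LinAddCat k) : Preadditive A := A.preadditive
instance (A : LinAddCat k) : Linear k A := A.linear
instance (A : LinAddCat k) : HasFiniteBiproducts A := A.hasFiniteBiproducts

/-- The property of a functor of being `k`-linear. -/
def isLinearFunctor (A B : LinAddCat k) : ObjectProperty (A ⥤ B) :=
  fun F => F.Additive ∧ F.Linear k

/-- The category of `k`-linear functors and natural transformations. -/
abbrev Fun (A B : LinAddCat k) : Type u := (isLinearFunctor A B).FullSubcategory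

/-- Composition of `k`-linear functors. -/
def Fun.comp {A B C : LinAddCat k} (F : Fun A B) (G : Fun B C) : Fun A C where
  obj := F.obj ⋙ G.obj
  property := by
    obtain ⟨_, _⟩ := F.property
    obtain ⟨_, _⟩ := G.property
    exact ⟨inferInstance, inferInstance⟩

/-- The functor `- ∘ F` between categories of `k`-linear functors. -/
def precomp {A B : LinAddCat k} (F : Fun A B) (C : LinAddCat k) : Fun B C ⥤ Fun A C where
  obj G := F.comp G
  map β := ObjectProperty.homMk (Functor.whiskerLeft F.obj β.hom)

/-! ### The left adjoint `C ↦ kC` of the forgetful functor to small categories -/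

/-- The additive hull of a preadditive category: objects are finite tuples `(X₁, …, Xₙ)` of
objects, `n ≥ 0`, and morphisms are matrices of morphisms. -/
abbrev AddHull (A : Type u) [Category.{u} A] [Preadditive A] : Type u :=
  InducedCategory (Mat_ A) (fun X : Σ n : ℕ, Fin n → A => Mat_.mk (Fin X.1) X.2)

section

variable (A : Type u) [Category.{u} A] [Preadditive A]

instance addHull_essSurj :
    (inducedFunctor (fun X : Σ n : ℕ, Fin n → A => Mat_.mk (Fin X.1) X.2)).EssSurj where
  mem_essImage M := by
    classical
    let e := Fintype.equivFin M.ι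
    refine ⟨⟨Fintype.card M.ι, fun i => M.X (e.symm i)⟩, ⟨⟨?_, ?_, ?_, ?_⟩⟩⟩
    · exact fun i j => if h : e.symm i = j then eqToHom (congrArg M.X h) else 0
    · exact fun j i => if h : j = e.symm i then eqToHom (congrArg M.X h) else 0
    · apply Mat_.hom_ext
      intro i i'
      change ∑ j : M.ι, _ = _
      rw [Finset.sum_eq_single (e.symm i)]
      · by_cases h : i = i'
        · subst h
          simp
        · have h' : ¬ e.symm i = e.symm i' := fun h' => h (e.symm.injective h')
          refine Eq.trans ?_ (Mat_.id_apply_of_ne _ _ _ h).symm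
          beta_reduce
          rw [dif_neg h', comp_zero]
      · intro j _ hj
        beta_reduce
        rw [dif_neg (Ne.symm hj), zero_comp]
      · intro h
        exact absurd (Finset.mem_univ _) h
    · apply Mat_.hom_ext
      intro j j'
      change ∑ i : Fin (Fintype.card M.ι), _ = _
      rw [Finset.sum_eq_single (e j)]
      · by_cases h : j = j'
        · subst h
          simp
        · have h' : ¬ e.symm (e j) = j' := by simpa using h
          refine Eq.trans ?_ (Mat_.id_apply_of_ne _ _ _ h).symm
          beta_reduce
          rw [dif_neg h', comp_zero]
      · intro i _ hi
        have h' : ¬ j = e.symm i := fun h' => hi (by simp [h'])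
        beta_reduce
        rw [dif_neg h', zero_comp]
      · intro h
        exact absurd (Finset.mem_univ _) h

instance addHull_hasFiniteBiproducts : HasFiniteBiproducts (AddHull A) := by
  let F := inducedFunctor (fun X : Σ n : ℕ, Fin n → A => Mat_.mk (Fin X.1) X.2)
  have : F.IsEquivalence := { }
  have : HasFiniteProducts (AddHull A) :=
    ⟨fun n => Adjunction.hasLimitsOfShape_of_equivalence F⟩
  exact HasFiniteBiproducts.of_hasFiniteProducts

end

variable (k) in
/-- The free `k`-linear additive category `kC` on a small category `C`: the additive hull of the
category with the objects of `C` and with the vector spaces with basis `C(X, Y)` as morphisms. -/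
def free (C : Type u) [Category.{u} C] : LinAddCat k where
  carrier := AddHull (CategoryTheory.Free k C)

variable (k) in
/-- The `k`-linear functor `kC ⥤ kD` induced by a functor `C ⥤ D`. -/
def freeMap {C D : Type u} [Category.{u} C] [Category.{u} D] (F : C ⥤ D) :
    Fun (free k C) (free k D) where
  obj :=
    { obj := fun X => ⟨X.1, fun i => F.obj (X.2 i)⟩
      map := fun f => InducedCategory.homMk
        ((Free.lift k (F ⋙ Free.embedding k D)).mapMat_.map f.hom)
      map_id := fun _ => InducedCategory.hom_ext
        ((Free.lift k (F ⋙ Free.embedding k D)).mapMat_.map_id _)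
      map_comp := fun f g => InducedCategory.hom_ext
        ((Free.lift k (F ⋙ Free.embedding k D)).mapMat_.map_comp f.hom g.hom) }
  property :=
    ⟨⟨fun {_ _ f g} => InducedCategory.hom_ext (Mat_.hom_ext _ _ fun i j =>
        (Free.lift k (F ⋙ Free.embedding k D)).map_add (f := f.hom i j) (g := g.hom i j))⟩,
      ⟨fun f r => InducedCategory.hom_ext (Mat_.hom_ext _ _ fun i j =>
        (Free.lift k (F ⋙ Free.embedding k D)).map_smul r (f.hom i j))⟩⟩

/-! ### 2-pushouts -/

section TwoPushout

variable {A B C : LinAddCat k} (f : Fun A B) (g : Fun A C)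

/-- The category of 2-natural transformations from the span `B ←f- A -g→ C` to the category `E`:
its objects consist of `k`-linear functors `F : B ⥤ E` and `G : C ⥤ E` and a natural isomorphism
`F ∘ f ≅ G ∘ g`, and its morphisms (the modifications) are pairs of natural transformations that
are compatible with these isomorphisms. -/
abbrev Cocone (E : LinAddCat k) := CategoricalPullback (precomp f E) (precomp g E)

variable {f g}

/-- The functor `- ∘ σ : Fun(P, E) ⥤ Cocone(E)` given by a cocone `σ` with vertex `P`. -/
def Cocone.restrict {P : LinAddCat k} (σ : Cocone f g P) (E : LinAddCat k) :
    Fun P E ⥤ Cocone f g E where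
  obj H :=
    { fst := σ.fst.comp H
      snd := σ.snd.comp H
      iso := ObjectProperty.isoMk _
        ((Functor.associator f.obj σ.fst.obj H.obj).symm ≪≫
          Functor.isoWhiskerRight ((isLinearFunctor A P).ι.mapIso σ.iso) H.obj ≪≫
          Functor.associator g.obj σ.snd.obj H.obj) }
  map {H H'} β :=
    { fst := (precomp σ.fst E).map β
      snd := (precomp σ.snd E).map β
      w := by
        ext X
        simp [precomp, Fun.comp] }

variable (f g)

/-- A 2-pushout of the span `B ←f- A -g→ C` of small `k`-linear additive categories. -/
structure TwoPushout where
  pt : LinAddCat k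
  cocone : Cocone f g pt
  isEquivalence : ∀ E : LinAddCat k, (cocone.restrict E).IsEquivalence

end TwoPushout

end LinAddCat

/-! ## Modules, and dualizing and semi-hereditary `k`-varieties -/

section Varieties

variable (k : Type u) [Field k] (A : Type u) [Category.{u} A] [Preadditive A] [Linear k A]

/-- A finite `k`-variety: a Hom-finite additive `k`-linear category in which idempotents split. -/
structure IsFiniteVariety : Prop where
  hasFiniteBiproducts : HasFiniteBiproducts A
  finite_hom : ∀ X Y : A, Module.Finite k (X ⟶ Y)
  isIdempotentComplete : IsIdempotentComplete A

/-- The property of a contravariant functor `M` from an additive category `A` to vector spaces of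
being finitely presented: there is an exact sequence `A(-, X) ⟶ A(-, Y) ⟶ M ⟶ 0`.
(Such an `M` is automatically `k`-linear, and a finite direct sum of standard projectives is a
standard projective since `A` is additive.) -/
def isFinitelyPresented : ObjectProperty (Aᵒᵖ ⥤ ModuleCat.{u} k) := fun M =>
  ∃ (X Y : A) (φ : X ⟶ Y) (π : (linearYoneda k A).obj Y ⟶ M), ∀ Z : Aᵒᵖ,
    Function.Exact (((linearYoneda k A).map φ).app Z) (π.app Z) ∧ Function.Surjective (π.app Z)

/-- The category `mod A` of finitely presented right modules over the additive category `A`. -/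
abbrev FPMod := (isFinitelyPresented k A).FullSubcategory

/-- `A` is semi-hereditary: `mod A` is abelian, and it is hereditary, that is, all the groups
`Extⁱ(M, N)` with `i ≥ 2` vanish. -/
def IsSemiHereditary : Prop :=
  ∃ _ : Abelian (FPMod k A), ∀ M : FPMod k A, HasProjectiveDimensionLE M 1

/-- The vector space dual, as a contravariant functor. -/
def vectorDual : (ModuleCat.{u} k)ᵒᵖ ⥤ ModuleCat.{u} k where
  obj V := ModuleCat.of k (Module.Dual k V.unop)
  map f := ModuleCat.ofHom f.unop.hom.dualMap

/-- The contravariant functor `D` from right `A`-modules to right `Aᵒᵖ`-modules with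
`(D M)(X) = Hom_k(M(X), k)`. -/
def moduleDual : (Aᵒᵖ ⥤ ModuleCat.{u} k)ᵒᵖ ⥤ (Aᵒᵖᵒᵖ ⥤ ModuleCat.{u} k) :=
  Functor.opHom Aᵒᵖ (ModuleCat.{u} k) ⋙
    (Functor.whiskeringRight Aᵒᵖᵒᵖ (ModuleCat.{u} k)ᵒᵖ (ModuleCat.{u} k)).obj (vectorDual k)

/-- A dualizing `k`-variety: a finite `k`-variety such that `D` restricts to a duality (a
contravariant equivalence) from `mod A` to `mod Aᵒᵖ`. -/
structure IsDualizing : Prop where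
  isFiniteVariety : IsFiniteVariety k A
  duality : ∃ h : ∀ M : (FPMod k A)ᵒᵖ,
      isFinitelyPresented k Aᵒᵖ (((isFinitelyPresented k A).ι.op ⋙ moduleDual k A).obj M),
    ((isFinitelyPresented k Aᵒᵖ).lift
      ((isFinitelyPresented k A).ι.op ⋙ moduleDual k A) h).IsEquivalence

end Varieties

/-! ## Thread quivers -/

/-- A thread quiver: a quiver whose arrows are divided into standard arrows and thread arrows,
and where every thread arrow is labelled by a (possibly empty) linearly ordered set. -/
structure ThreadQuiver where
  vertex : Type u
  standardArrow : vertex → vertex → Type u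
  threadArrow : vertex → vertex → Type u
  label : ∀ {x y : vertex}, threadArrow x y → Type u
  [labelOrder : ∀ {x y : vertex} (t : threadArrow x y), LinearOrder (label t)]

/-- The linearly ordered set `ℕ · (T ×ₗ ℤ) · -ℕ`, where `P · P'` is the disjoint union in which
all elements of `P` precede all elements of `P'`. -/
abbrev ThreadOrder (T : Type u) [LinearOrder T] : Type u :=
  ℕ ⊕ₗ ((T ×ₗ ℤ) ⊕ₗ ℕᵒᵈ)

namespace ThreadOrder

variable (T : Type u) [LinearOrder T]

/-- The minimal element. -/
def bot : ThreadOrder T := Sum.inlₗ 0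

/-- The maximal element. -/
def top : ThreadOrder T := Sum.inrₗ (Sum.inrₗ (OrderDual.toDual 0))

lemma bot_le (a : ThreadOrder T) : bot T ≤ a := by
  rcases a with a | a
  · exact Sum.Lex.inl_le_inl_iff.2 (Nat.zero_le a)
  · exact Sum.Lex.inl_le_inr _ _

lemma le_top (a : ThreadOrder T) : a ≤ top T := by
  rcases a with a | a
  · exact Sum.Lex.inl_le_inr _ _
  · refine Sum.Lex.inr_le_inr_iff.2 ?_
    rcases a with a | a
    · exact Sum.Lex.inl_le_inr _ _
    · exact Sum.Lex.inr_le_inr_iff.2 (Nat.zero_le (OrderDual.ofDual a))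

end ThreadOrder

namespace ThreadQuiver

variable (Q : ThreadQuiver.{u})

attribute [instance] ThreadQuiver.labelOrder

/-- The vertices of the underlying quiver `Q_r`, in which standard and thread arrows are not
distinguished. -/
def Underlying : Type u := Q.vertex

instance : Quiver.{u} Q.Underlying :=
  ⟨fun x y => Q.standardArrow x y ⊕ Q.threadArrow x y⟩

/-- The underlying quiver `Q_r` is strongly locally finite: every vertex is incident to only
finitely many arrows, and there are no infinite paths `• → • → ⋯` or `⋯ → • → •`. -/
structure IsStronglyLocallyFinite : Prop where
  finite_out : ∀ x : Q.Underlying, Finite (Σ y : Q.Underlying, x ⟶ y)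
  finite_in : ∀ y : Q.Underlying, Finite (Σ x : Q.Underlying, x ⟶ y)
  no_infinite_path : ∀ v : ℕ → Q.Underlying, IsEmpty (∀ n, v n ⟶ v (n + 1))
  no_infinite_path' : ∀ v : ℕ → Q.Underlying, IsEmpty (∀ n, v (n + 1) ⟶ v n)

/-- The set of all thread arrows. -/
abbrev Thread : Type u := Σ (x : Q.vertex) (y : Q.vertex), Q.threadArrow x y

/-- The linearly ordered set that replaces the thread `t`. -/
abbrev order (t : Q.Thread) : Type u := ThreadOrder (Q.label t.2.2)

/-- The functor from `• → •` to the path category of `Q_r` that picks the thread arrow `t`. -/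
def arrowFunctor (t : Q.Thread) : Fin 2 ⥤ Paths Q.Underlying :=
  ComposableArrows.mk₁ (X₀ := (Paths.of Q.Underlying).obj t.1)
    (X₁ := (Paths.of Q.Underlying).obj t.2.1)
    ((Paths.of Q.Underlying).map (Sum.inr t.2.2))

/-- The functor from `• → •` to the poset `ℕ · (T ×ₗ ℤ) · -ℕ` that picks the minimal and the
maximal element. -/
def endsFunctor (t : Q.Thread) : Fin 2 ⥤ Q.order t :=
  ComposableArrows.mk₁ (homOfLE (ThreadOrder.bot_le (Q.label t.2.2) (ThreadOrder.top _)))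

variable (k : Type u) [Field k]

/-- The `k`-linear additive path category of `Q_r`. -/
abbrev pathCategory : LinAddCat k := LinAddCat.free k (Paths Q.Underlying)

/-- The direct sum of the categories `k(• → •)` over all threads. The direct sum of categories
`kC_t` is the free `k`-linear additive category on the disjoint union of the categories `C_t`. -/
abbrev arrowCategory : LinAddCat k := LinAddCat.free k (Σ _ : Q.Thread, Fin 2)

/-- The direct sum, over all threads `t`, of the `k`-linearizations of the posets
`ℕ · (T_t ×ₗ ℤ) · -ℕ`. -/
abbrev orderCategory : LinAddCat k := LinAddCat.free k (Σ t : Q.Thread, Q.order t)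

/-- The functor `f` from the direct sum of the `k(• → •)` to `kQ_r`. -/
def arrowMap : LinAddCat.Fun (Q.arrowCategory k) (Q.pathCategory k) :=
  LinAddCat.freeMap k (Sigma.desc Q.arrowFunctor)

/-- The functor `g` from the direct sum of the `k(• → •)` to the direct sum of the linearized
posets. -/
def endsMap : LinAddCat.Fun (Q.arrowCategory k) (Q.orderCategory k) :=
  LinAddCat.freeMap k (Sigma.desc fun t => Q.endsFunctor t ⋙ Sigma.incl t)

/-- The category `kQ` of a thread quiver, which is determined up to equivalence: a 2-pushout of
`f` and `g`. -/
abbrev PathVariety := LinAddCat.TwoPushout (Q.arrowMap k) (Q.endsMap k)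

end ThreadQuiver

end

end ThreadQuivers

/-! The 2-pushout is written down explicitly as `free k Q.Point`. The objects of `Q.Point` are the
vertices and the inner points of the threads; a morphism is a path of `Q_r` from the exit of one
point to the entry of another, or an inequality inside one thread. A functor on `Q.Point` amounts to
functors on the path category and on the thread orders that agree on thread arrows up to given
isomorphisms (`glue`, `Point.exists_natTrans`), and this is the universal property. All 2-pushouts
are equivalent (`TwoPushout.exists_isEquivalence`), and `IsFreeOn` is stable under equivalence, so
the other claims are proved from `IsFreeOn` over `Q.Point`.

Like a category of paths without cycles, `Q.Point` is equidivisible: its only endomorphisms are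
identities, and two factorizations of a morphism are comparable. In a linear relation between
morphisms one can therefore divide by a term that is minimal for left divisibility, and obtains a
relation with an invertible coefficient (`exists_relation`). Eliminating summands in this way writes
every morphism as a split epimorphism followed by a monomorphism. Hence idempotents split, weak
kernels exist and finitely presented modules form an abelian category, and each of them has a
resolution of length one by representables.

For the duality, finite-dimensionality makes `D` fully faithful and reflexive, and exactness of `D`
reduces the claim to representables: `D(A(-, X))` must be finitely presented. This is an induction
over `HasDualFiltration`. A representable is divided by the images of its immediate predecessors (at
a vertex) or of the start of its thread (at an inner point). The quotient is a simple functor or an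
interval of the thread, and its dual is presented by one point and finitely many morphisms out of
it; here local finiteness and the existence of immediate successors and predecessors in the thread
orders enter. The horseshoe argument `IsDualPresentable.of_mono` puts the pieces together, and the
induction terminates because there are no infinite paths. The same argument applies to the opposite
category. -/

namespace ThreadQuivers

noncomputable section

/-! ## Split factorizations and weak kernels -/

section Factorizations

/-- Every morphism is a split epimorphism followed by a monomorphism. -/
def HasSplitEpiMonoFactorizations (A : Type u) [Category.{u} A] : Prop :=
  ∀ ⦃X Y : A⦄ (φ : X ⟶ Y), ∃ (I : A) (p : X ⟶ I) (s : I ⟶ X) (m : I ⟶ Y),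
    s ≫ p = 𝟙 I ∧ Mono m ∧ p ≫ m = φ

/-- Every morphism has a weak kernel. -/
def HasWeakKernels (A : Type u) [Category.{u} A] [Preadditive A] : Prop :=
  ∀ ⦃X Y : A⦄ (φ : X ⟶ Y), ∃ (K : A) (κ : K ⟶ X), κ ≫ φ = 0 ∧
    ∀ ⦃Z : A⦄ (g : Z ⟶ X), g ≫ φ = 0 → ∃ h, h ≫ κ = g

variable {A : Type u} [Category.{u} A]

/-- If `p ≫ m` is idempotent, then cancelling `s ≫ p = 𝟙` on the left and the monomorphism `m` on
the right leaves `m ≫ p = 𝟙`, so the image itself splits the idempotent. -/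
theorem HasSplitEpiMonoFactorizations.isIdempotentComplete
    (H : HasSplitEpiMonoFactorizations A) : IsIdempotentComplete A where
  idempotents_split X e he := by
    obtain ⟨I, p, s, m, hs, hm, rfl⟩ := H e
    refine ⟨I, m, p, ?_, rfl⟩
    have h1 : s ≫ (p ≫ m) ≫ p ≫ m = s ≫ p ≫ m := by rw [he]
    simp only [Category.assoc, reassoc_of% hs] at h1
    rw [← cancel_mono m, Category.assoc, h1, Category.id_comp]

/-- Since `m` is a monomorphism, only the split epimorphism `p` has to be killed, and its kernel is
the image of the idempotent `𝟙 - p ≫ s`. -/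
theorem HasSplitEpiMonoFactorizations.hasWeakKernels [Preadditive A]
    (H : HasSplitEpiMonoFactorizations A) : HasWeakKernels A := by
  intro X Y φ
  obtain ⟨I, p, s, m, hs, hm, rfl⟩ := H φ
  have := H.isIdempotentComplete
  obtain ⟨K, i, e, hie, hei⟩ := IsIdempotentComplete.idempotents_split X (𝟙 X - p ≫ s)
    (by simp [reassoc_of% hs])
  refine ⟨K, i, ?_, fun Z g hg => ⟨g ≫ e, ?_⟩⟩
  · have h : i = i ≫ e ≫ i := by rw [reassoc_of% hie]
    rw [h, hei]
    simp [reassoc_of% hs]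
  · have h : g ≫ p = 0 := by rw [← cancel_mono m]; simpa using hg
    rw [Category.assoc, hei]
    simp [reassoc_of% h]

end Factorizations

/-! ## Presentations of the duals of representable functors -/

section DualPresentable

variable (k : Type u) [Field k] {A : Type u} [Category.{u} A] [Preadditive A] [Linear k A]

/-- The covariant functor `Z ↦ D(A(Z, X))` has a presentation
`A(V, -) ⟶ A(U, -) ⟶ D(A(-, X)) ⟶ 0`, the second map being given by an element of `D(A(U, X))`. -/
def IsDualPresentable (X : A) : Prop :=
  ∃ (U V : A) (ψ : U ⟶ V) (l : (U ⟶ X) →ₗ[k] k), ∀ Z : A,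
    (∀ μ : (Z ⟶ X) →ₗ[k] k, ∃ g : U ⟶ Z, ∀ q, μ q = l (g ≫ q)) ∧
    ∀ g : U ⟶ Z, (∀ q : Z ⟶ X, l (g ≫ q) = 0) ↔ ∃ h, ψ ≫ h = g

variable {k}

theorem IsDualPresentable.of_iso {X Y : A} (e : X ≅ Y) (h : IsDualPresentable k X) :
    IsDualPresentable k Y := by
  obtain ⟨U, V, ψ, l, h⟩ := h
  refine ⟨U, V, ψ, l ∘ₗ Linear.rightComp k U e.inv, fun Z => ⟨fun μ => ?_, fun g => ?_⟩⟩
  · obtain ⟨g, hg⟩ := (h Z).1 (μ ∘ₗ Linear.rightComp k Z e.hom)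
    refine ⟨g, fun q => ?_⟩
    have := hg (q ≫ e.inv)
    simpa using this
  · rw [← (h Z).2 g]
    refine ⟨fun hq q => ?_, fun hq q => ?_⟩
    · simpa using hq (q ≫ e.hom)
    · simpa using hq (q ≫ e.inv)

theorem biproduct_total {B : Type*} [Category* B] [Preadditive B] {J : Type*} [Fintype J]
    (f : J → B) [HasBiproduct f] : ∑ j, biproduct.π f j ≫ biproduct.ι f j = 𝟙 (⨁ f) :=
  IsBilimit.total (biproduct.isBilimit _)

variable [HasFiniteBiproducts A]

theorem IsDualPresentable.biproduct {J : Type*} [Fintype J] (W : J → A)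
    (h : ∀ i, IsDualPresentable k (W i)) : IsDualPresentable k (⨁ W) := by
  choose U V ψ l h using h
  refine ⟨⨁ U, ⨁ V, biproduct.map ψ,
    ∑ i, l i ∘ₗ Linear.rightComp k _ (biproduct.π W i) ∘ₗ Linear.leftComp k _ (biproduct.ι U i),
    fun Z => ⟨fun μ => ?_, fun g => ?_⟩⟩
  · choose g hg using fun i => (h i Z).1 (μ ∘ₗ Linear.rightComp k Z (biproduct.ι W i))
    refine ⟨biproduct.desc g, fun q => ?_⟩
    have hq : q = ∑ i, (q ≫ biproduct.π W i) ≫ biproduct.ι W i := by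
      simp only [Category.assoc, ← Preadditive.comp_sum, biproduct_total, Category.comp_id]
    conv_lhs => rw [hq, map_sum]
    simp only [LinearMap.sum_apply, LinearMap.comp_apply, Linear.rightComp_apply,
      Linear.leftComp_apply, biproduct.ι_desc_assoc, Category.assoc]
    exact Finset.sum_congr rfl fun i _ => by simpa using hg i (q ≫ biproduct.π W i)
  · simp only [LinearMap.sum_apply, LinearMap.comp_apply, Linear.rightComp_apply,
      Linear.leftComp_apply, Category.assoc]
    constructor
    · intro hq
      have : ∀ j, ∃ h', ψ j ≫ h' = biproduct.ι U j ≫ g := fun j => by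
        rw [← (h j Z).2]
        intro q
        have := hq (q ≫ biproduct.ι W j)
        rw [Finset.sum_eq_single j] at this
        · simpa using this
        · intro i _ hij
          simp [biproduct.ι_π_ne _ (Ne.symm hij)]
        · simp
      choose h' hh' using this
      exact ⟨biproduct.desc h', biproduct.hom_ext' _ _ fun j => by simp [hh']⟩
    · rintro ⟨h', rfl⟩ q
      refine Finset.sum_eq_zero fun i _ => ?_
      have := ((h i Z).2 (ψ i ≫ biproduct.ι V i ≫ h')).2 ⟨_, rfl⟩ (q ≫ biproduct.π W i)
      simpa using this

/-- If `0 ⟶ A(-, W) ⟶ A(-, X)` is exact and the dual of its cokernel is presented by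
`c : U ⟶ V`, then a presentation for `W` yields one for `X`. -/
theorem IsDualPresentable.of_mono {X W U V : A} (b : W ⟶ X) [Mono b] (c : U ⟶ V)
    (l : (U ⟶ X) →ₗ[k] k)
    (h₁ : ∀ (Z : A) (g : U ⟶ Z), (∀ q : Z ⟶ X, l (g ≫ q) = 0) ↔ ∃ h, c ≫ h = g)
    (h₂ : ∀ (Z : A) (μ : (Z ⟶ X) →ₗ[k] k), (∀ r : Z ⟶ W, μ (r ≫ b) = 0) ↔
      ∃ g : U ⟶ Z, ∀ q, μ q = l (g ≫ q))
    (hW : IsDualPresentable k W) : IsDualPresentable k X := by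
  have := HasBinaryBiproducts.of_hasBinaryProducts (C := A)
  obtain ⟨U₁, V₁, ψ₁, l₁, hW⟩ := hW
  -- The generator `l₁` of the dual of `W` lifts to the dual of `X`, because a functional on a
  -- subspace extends.
  obtain ⟨l', hl'⟩ : ∃ l' : (U₁ ⟶ X) →ₗ[k] k, ∀ r, l' (r ≫ b) = l₁ r := by
    have hb : Function.Injective (Linear.rightComp k U₁ b) := fun r r' hr =>
      (cancel_mono b).1 hr
    obtain ⟨l', hl'⟩ := LinearMap.dualMap_surjective_of_injective hb l₁
    exact ⟨l', fun r => LinearMap.congr_fun hl' r⟩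
  -- The relation `ψ₁` holds for `l₁` but only up to a correction for `l'`; the correction vanishes
  -- on `W`, hence is a multiple `d` of `l`.
  obtain ⟨d, hd⟩ : ∃ d : U ⟶ V₁, ∀ q, l' (ψ₁ ≫ q) = l (d ≫ q) :=
    (h₂ V₁ (l' ∘ₗ Linear.leftComp k X ψ₁)).1 fun r => by
      have := ((hW V₁).2 ψ₁).2 ⟨𝟙 _, by simp⟩ r
      simpa [← Category.assoc, hl'] using this
  -- The horseshoe: the generators are `l` and `l'`, and the relations are `c` and `ψ₁` corrected by
  -- `-d`.
  refine ⟨U ⊞ U₁, V ⊞ V₁, biprod.desc (biprod.lift c (-d)) (biprod.lift 0 ψ₁),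
    l ∘ₗ Linear.leftComp k X biprod.inl + l' ∘ₗ Linear.leftComp k X biprod.inr,
    fun Z => ⟨fun μ => ?_, fun g => ?_⟩⟩
  · obtain ⟨g₁, hg₁⟩ := (hW Z).1 (μ ∘ₗ Linear.rightComp k Z b)
    obtain ⟨g, hg⟩ := (h₂ Z (μ - l' ∘ₗ Linear.leftComp k X g₁)).1 fun r => by
      have := hg₁ r
      simp only [LinearMap.comp_apply, Linear.rightComp_apply] at this
      simp [this, ← Category.assoc, hl']
    refine ⟨biprod.desc g g₁, fun q => ?_⟩
    have := hg q
    simp only [LinearMap.sub_apply, LinearMap.comp_apply, Linear.leftComp_apply] at this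
    simp [← this]
  · simp only [LinearMap.add_apply, LinearMap.comp_apply, Linear.leftComp_apply]
    constructor
    · intro hq
      obtain ⟨h', hh'⟩ := ((hW Z).2 (biprod.inr ≫ g)).1 fun r => by
        have e := hq (r ≫ b)
        have e' := (h₂ Z (l ∘ₗ Linear.leftComp k X (biprod.inl ≫ g))).2 ⟨_, fun _ => rfl⟩ r
        simp only [LinearMap.comp_apply, Linear.leftComp_apply, Category.assoc] at e'
        rw [e', zero_add, ← Category.assoc, ← Category.assoc, hl'] at e
        simpa using e
      obtain ⟨h'', hh''⟩ := (h₁ Z (biprod.inl ≫ g + d ≫ h')).1 fun q => by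
        have e := hq q
        rw [← Category.assoc biprod.inr, ← hh', Category.assoc, hd] at e
        simpa using e
      refine ⟨biprod.desc h'' h', ?_⟩
      ext
      · simp [biprod.lift_desc, hh'']
      · simp [biprod.lift_desc, hh']
    · rintro ⟨h', rfl⟩ q
      have e := (h₁ Z (c ≫ biprod.inl ≫ h')).2 ⟨_, rfl⟩ q
      have e' := hd (biprod.inr ≫ h' ≫ q)
      simp only [Category.assoc] at e e'
      simp [biprod.lift_eq, e, e']

end DualPresentable

/-! ## Free `k`-linear additive categories on equidivisible categories -/

/-- A category without nontrivial endomorphisms in which any two factorizations of a morphism are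
comparable. -/
structure IsEquidivisible (C : Type u) [Category.{u} C] : Prop where
  eq_id : ∀ {X : C} (f : X ⟶ X), f = 𝟙 X
  comparable : ∀ {Z X V Y : C} (q : Z ⟶ X) (r : X ⟶ Y) (p : Z ⟶ V) (w : V ⟶ Y),
    q ≫ r = p ≫ w → (∃ s : V ⟶ X, p ≫ s = q ∧ s ≫ r = w) ∨ ∃ s : X ⟶ V, q ≫ s = p ∧ s ≫ w = r

namespace IsEquidivisible

variable {C : Type u} [Category.{u} C] (h : IsEquidivisible C)
include h

/-- Comparing `f ≫ r` with `f ≫ w` produces an endomorphism relating `r` and `w`, and it must be an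
identity. -/
theorem epi {X Y : C} (f : X ⟶ Y) : Epi f where
  left_cancellation r w e := by
    obtain ⟨s, -, hs⟩ | ⟨s, -, hs⟩ := h.comparable f r f w e <;> simpa [h.eq_id s, eq_comm] using hs

theorem mono {X Y : C} (f : X ⟶ Y) : Mono f where
  right_cancellation q p e := by
    obtain ⟨s, hs, -⟩ | ⟨s, hs, -⟩ := h.comparable q f p f e <;> simpa [h.eq_id s, eq_comm] using hs

theorem op : IsEquidivisible Cᵒᵖ where
  eq_id f := Quiver.Hom.unop_inj (h.eq_id f.unop)
  comparable q r p w e := by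
    obtain ⟨s, h₁, h₂⟩ | ⟨s, h₁, h₂⟩ := h.comparable r.unop q.unop w.unop p.unop
      (congrArg Quiver.Hom.unop e)
    · exact Or.inr ⟨s.op, Quiver.Hom.unop_inj h₂, Quiver.Hom.unop_inj h₁⟩
    · exact Or.inl ⟨s.op, Quiver.Hom.unop_inj h₂, Quiver.Hom.unop_inj h₁⟩

end IsEquidivisible

/-- Objects of an equidivisible category for which the dual of the contravariant representable
functor is an iterated extension of functors `D(C(-, X)/⋃ᵢ C(-, Wᵢ) bᵢ) ≅ C(U, -)/⋃ⱼ cⱼ C(Vⱼ, -)`. -/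
inductive HasDualFiltration {C : Type u} [Category.{u} C] : C → Prop
  | intro {X U : C} {I J : Type u} [Finite I] [Finite J] (W : I → C) (V : J → C)
      (b : ∀ i, W i ⟶ X) (u : U ⟶ X) (c : ∀ j, U ⟶ V j)
      -- In an equidivisible category this makes the subfunctors generated by the `b i` disjoint, so
      -- that their linear spans form a direct sum.
      (b_inj : ∀ i j (s : W i ⟶ W j), s ≫ b j = b i → i = j)
      -- With `factor`, this identifies the complement of the union of the `C(-, Wᵢ) bᵢ` as the set
      -- of right divisors of `u`; `ne_u'` and `factor'` do the same for the left divisors.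
      (ne_u : ∀ i (s : U ⟶ W i), s ≫ b i ≠ u)
      (ne_u' : ∀ j (q : V j ⟶ X), c j ≫ q ≠ u)
      (factor : ∀ {Z : C} (q : Z ⟶ X), (∃ i, ∃ r : Z ⟶ W i, r ≫ b i = q) ∨ ∃ s, s ≫ q = u)
      (factor' : ∀ {Z : C} (s : U ⟶ Z), (∃ j, ∃ h : V j ⟶ Z, c j ≫ h = s) ∨ ∃ q, s ≫ q = u)
      (hW : ∀ i, HasDualFiltration (W i)) : HasDualFiltration X

/-- `A` is the free `k`-linear additive category on `C`: morphism spaces between objects of `C` have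
the morphisms of `C` as a basis, and all objects are finite direct sums of objects of `C`. -/
structure IsFreeOn (k : Type u) [Field k] {C A : Type u} [Category.{u} C] [Category.{u} A]
    [Preadditive A] [Linear k A] (ι : C ⥤ A) : Prop where
  linearIndependent : ∀ X Y : C,
    LinearIndependent k (fun f : X ⟶ Y => (ι.map f : ι.obj X ⟶ ι.obj Y))
  span_eq_top : ∀ X Y : C,
    ⊤ ≤ Submodule.span k (Set.range fun f : X ⟶ Y => (ι.map f : ι.obj X ⟶ ι.obj Y))
  decomposition : ∀ Z : A, ∃ (n : ℕ) (X : Fin n → C) (i : ∀ j, ι.obj (X j) ⟶ Z)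
    (p : ∀ j, Z ⟶ ι.obj (X j)), (∀ j, i j ≫ p j = 𝟙 _) ∧ (∀ j j', j ≠ j' → i j ≫ p j' = 0) ∧
      ∑ j, p j ≫ i j = 𝟙 Z

namespace IsFreeOn

variable {k : Type u} [Field k] {C A : Type u} [Category.{u} C] [Category.{u} A]
  [Preadditive A] [Linear k A] {ι : C ⥤ A} (F : IsFreeOn k ι)

include F in
theorem op : IsFreeOn k ι.op where
  linearIndependent X Y := by
    let e : (unop (ι.op.obj Y) ⟶ unop (ι.op.obj X)) →ₗ[k] (ι.op.obj X ⟶ ι.op.obj Y) :=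
      { toFun := fun f => f.op, map_add' := fun _ _ => rfl, map_smul' := fun _ _ => rfl }
    have h := ((F.linearIndependent Y.unop X.unop).map' e
      (LinearMap.ker_eq_bot.2 fun _ _ h => Quiver.Hom.op_inj h))
    exact h.comp (fun f : X ⟶ Y => f.unop) Quiver.Hom.unop_inj
  span_eq_top X Y := by
    let e : (unop (ι.op.obj Y) ⟶ unop (ι.op.obj X)) →ₗ[k] (ι.op.obj X ⟶ ι.op.obj Y) :=
      { toFun := fun f => f.op, map_add' := fun _ _ => rfl, map_smul' := fun _ _ => rfl }
    intro f _
    have h := Submodule.mem_map_of_mem (f := e)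
      (F.span_eq_top Y.unop X.unop (Submodule.mem_top (x := f.unop)))
    rw [Submodule.map_span, ← Set.range_comp] at h
    refine Submodule.span_mono ?_ h
    rintro _ ⟨g, rfl⟩
    exact ⟨g.op, rfl⟩
  decomposition Z := by
    obtain ⟨n, X, i, p, h₁, h₂, h₃⟩ := F.decomposition Z.unop
    refine ⟨n, fun j => Opposite.op (X j), fun j => (p j).op, fun j => (i j).op,
      fun j => Quiver.Hom.unop_inj (h₁ j),
      fun j j' h => Quiver.Hom.unop_inj (h₂ j' j h.symm), ?_⟩
    apply Quiver.Hom.unop_inj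
    rw [unop_sum]
    exact h₃

/-- The basis of a morphism space. -/
def basis (X Y : C) : Module.Basis (X ⟶ Y) k (ι.obj X ⟶ ι.obj Y) :=
  Module.Basis.mk (F.linearIndependent X Y) (F.span_eq_top X Y)

@[simp]
theorem basis_apply {X Y : C} (f : X ⟶ Y) : F.basis X Y f = ι.map f :=
  Module.Basis.mk_apply _ _ f

@[simp]
theorem repr_map {X Y : C} (f : X ⟶ Y) : (F.basis X Y).repr (ι.map f) = Finsupp.single f 1 := by
  rw [← F.basis_apply, Module.Basis.repr_self]

include F in
/-- Decompositions as biproducts. -/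
theorem exists_iso [HasFiniteBiproducts A] (Z : A) :
    ∃ (n : ℕ) (X : Fin n → C), Nonempty (Z ≅ ⨁ fun j => ι.obj (X j)) := by
  obtain ⟨n, X, i, p, h₁, h₂, h₃⟩ := F.decomposition Z
  refine ⟨n, X, ⟨⟨biproduct.lift p, biproduct.desc i, by rw [biproduct.lift_desc, h₃], ?_⟩⟩⟩
  refine biproduct.hom_ext' _ _ fun j => biproduct.hom_ext _ _ fun j' => ?_
  by_cases h : j = j'
  · subst h
    simp [h₁]
  · simp [h₂ _ _ h, biproduct.ι_π_ne _ h]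

include F in
theorem finite_hom [∀ X Y : C, Finite (X ⟶ Y)] (Z Z' : A) : Module.Finite k (Z ⟶ Z') := by
  obtain ⟨n, X, i, p, -, -, h⟩ := F.decomposition Z
  obtain ⟨n', X', i', p', -, -, h'⟩ := F.decomposition Z'
  have (a : Fin n) (b : Fin n') : Module.Finite k (ι.obj (X a) ⟶ ι.obj (X' b)) :=
    Module.Finite.of_basis (F.basis _ _)
  let e : (Z ⟶ Z') →ₗ[k] (∀ (a : Fin n) (b : Fin n'), ι.obj (X a) ⟶ ι.obj (X' b)) :=
    LinearMap.pi fun a => LinearMap.pi fun b =>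
      Linear.leftComp k _ (i a) ∘ₗ Linear.rightComp k _ (p' b)
  refine Module.Finite.of_injective e fun f g hfg => ?_
  have key : ∀ f : Z ⟶ Z', f = ∑ a, ∑ b, p a ≫ e f a b ≫ i' b := fun f => by
    calc f = (∑ a, p a ≫ i a) ≫ f ≫ ∑ b, p' b ≫ i' b := by rw [h, h']; simp
      _ = _ := by
        simp only [Preadditive.sum_comp, Preadditive.comp_sum, Category.assoc, e,
          LinearMap.pi_apply, LinearMap.comp_apply, Linear.leftComp_apply, Linear.rightComp_apply]
        exact Finset.sum_comm
  rw [key f, key g, hfg]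

/-! ### Coefficients of composites with morphisms of `C`. -/

section Coefficients

variable (hC : IsEquidivisible C)
include hC

/-- As `b` is a monomorphism, composition with it maps the basis injectively into the basis, so
coefficients are carried along. -/
theorem repr_comp_map {Z X Y : C} (b : X ⟶ Y) (z : ι.obj Z ⟶ ι.obj X) (s : Z ⟶ X) :
    (F.basis Z Y).repr (z ≫ ι.map b) (s ≫ b) = (F.basis Z X).repr z s := by
  classical
  have := hC.mono b
  have : (F.basis Z Y).coord (s ≫ b) ∘ₗ Linear.rightComp k _ (ι.map b) = (F.basis Z X).coord s :=
    (F.basis Z X).ext fun f => by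
      simp [← Functor.map_comp, Finsupp.single_apply, cancel_mono]
  exact LinearMap.congr_fun this z

omit hC in
theorem repr_comp_map_of_ne {Z X Y : C} (b : X ⟶ Y) (z : ι.obj Z ⟶ ι.obj X) (q : Z ⟶ Y)
    (hq : ∀ s : Z ⟶ X, s ≫ b ≠ q) : (F.basis Z Y).repr (z ≫ ι.map b) q = 0 := by
  classical
  have : (F.basis Z Y).coord q ∘ₗ Linear.rightComp k _ (ι.map b) = 0 :=
    (F.basis Z X).ext fun f => by
      simp [← Functor.map_comp, hq]
  exact LinearMap.congr_fun this z

omit hC in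
theorem repr_map_comp_of_ne {Z X Y : C} (a : Z ⟶ X) (z : ι.obj X ⟶ ι.obj Y) (q : Z ⟶ Y)
    (hq : ∀ s : X ⟶ Y, a ≫ s ≠ q) : (F.basis Z Y).repr (ι.map a ≫ z) q = 0 := by
  classical
  have : (F.basis Z Y).coord q ∘ₗ Linear.leftComp k _ (ι.map a) = 0 :=
    (F.basis X Y).ext fun f => by
      simp [← Functor.map_comp, hq]
  exact LinearMap.congr_fun this z

end Coefficients

/-! ### Kernels of morphisms -/

/-- Left division by a morphism `p` of `C`: it sends `p ≫ s` to `s`, and other morphisms of `C`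
to `0`. -/
def leftDivision {Z V : C} (p : Z ⟶ V) (X : C) :
    (ι.obj Z ⟶ ι.obj X) →ₗ[k] (ι.obj V ⟶ ι.obj X) :=
  (F.basis Z X).constr k fun q =>
    open Classical in if h : ∃ s, p ≫ s = q then ι.map h.choose else 0

section

variable (hC : IsEquidivisible C)
include hC F

theorem leftDivision_map_comp {Z V X : C} (p : Z ⟶ V) (s : V ⟶ X) :
    F.leftDivision p X (ι.map (p ≫ s)) = ι.map s := by
  have := hC.epi p
  have h : ∃ s', p ≫ s' = p ≫ s := ⟨s, rfl⟩
  rw [← F.basis_apply, leftDivision, Module.Basis.constr_basis, dif_pos h]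
  rw [(cancel_epi p).1 h.choose_spec]

omit hC in
theorem leftDivision_map_of_ne {Z V X : C} (p : Z ⟶ V) (q : Z ⟶ X) (hq : ∀ s, p ≫ s ≠ q) :
    F.leftDivision p X (ι.map q) = 0 := by
  rw [← F.basis_apply, leftDivision, Module.Basis.constr_basis, dif_neg]
  simpa using hq

theorem repr_leftDivision {Z V X : C} (p : Z ⟶ V) (z : ι.obj Z ⟶ ι.obj X) (s : V ⟶ X) :
    (F.basis V X).repr (F.leftDivision p X z) s = (F.basis Z X).repr z (p ≫ s) := by
  classical
  have := hC.epi p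
  have : (F.basis V X).coord s ∘ₗ F.leftDivision p X = (F.basis Z X).coord (p ≫ s) := by
    refine (F.basis Z X).ext fun q => ?_
    by_cases hq : ∃ s', p ≫ s' = q
    · obtain ⟨s', rfl⟩ := hq
      simp only [LinearMap.comp_apply, basis_apply, F.leftDivision_map_comp hC]
      simp [Finsupp.single_apply, cancel_epi, -Functor.map_comp]
    · push Not at hq
      simp [F.leftDivision_map_of_ne p q hq, (hq s).symm]
  exact LinearMap.congr_fun this z

/-- The hypothesis `hz` says that `p` is minimal, for left divisibility, relative to the support of
`z`. If a term `q` is not divisible by `p`, then neither is `q ≫ r`: otherwise `p` and `q` would be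
comparable, and minimality would make `p` divide `q`. -/
theorem leftDivision_comp [∀ X Y : C, Finite (X ⟶ Y)] {Z V X Y : C} (p : Z ⟶ V)
    (z : ι.obj Z ⟶ ι.obj X) (φ : ι.obj X ⟶ ι.obj Y)
    (hz : ∀ q : Z ⟶ X, (F.basis Z X).repr z q ≠ 0 → ∀ s : X ⟶ V, q ≫ s = p → ∃ s', p ≫ s' = q) :
    F.leftDivision p Y (z ≫ φ) = F.leftDivision p X z ≫ φ := by
  classical
  have := Fintype.ofFinite (Z ⟶ X)
  suffices h : F.leftDivision p Y ∘ₗ Linear.leftComp k _ z =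
      Linear.leftComp k _ (F.leftDivision p X z) from LinearMap.congr_fun h φ
  refine (F.basis X Y).ext fun r => ?_
  simp only [LinearMap.comp_apply, Linear.leftComp_apply, basis_apply]
  conv_lhs => rw [← (F.basis Z X).sum_repr z]
  conv_rhs => rw [← (F.basis Z X).sum_repr z]
  simp only [Preadditive.sum_comp, map_sum, Linear.smul_comp, map_smul, basis_apply]
  refine Finset.sum_congr rfl fun q _ => ?_
  by_cases h0 : (F.basis Z X).repr z q = 0
  · simp [h0]
  congr 1
  have := hC.epi p
  by_cases hq : ∃ s, p ≫ s = q
  · obtain ⟨s, rfl⟩ := hq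
    rw [F.leftDivision_map_comp hC, ← Functor.map_comp, ← Functor.map_comp, Category.assoc,
      F.leftDivision_map_comp hC]
  · rw [← Functor.map_comp, F.leftDivision_map_of_ne p q (by simpa using hq), zero_comp,
      F.leftDivision_map_of_ne]
    intro w hw
    obtain ⟨s, hs, -⟩ | ⟨s, hs, -⟩ := hC.comparable p w q r hw
    · exact hq (hz q h0 s hs)
    · exact hq ⟨s, hs⟩

theorem exists_eq_smul_id (X : C) (f : ι.obj X ⟶ ι.obj X) :
    f = (F.basis X X).repr f (𝟙 X) • 𝟙 (ι.obj X) := by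
  apply (F.basis X X).repr.injective
  ext g
  rw [hC.eq_id g, map_smul, ← ι.map_id, F.repr_map]
  simp

/-- A nonzero relation between morphisms `φ i` yields a relation in which one of the coefficients
is invertible. -/
theorem exists_relation [∀ X Y : C, Finite (X ⟶ Y)] {I : Type*} [Fintype I] {Z : C} {W : I → C}
    {Y : A} (φ : ∀ i, ι.obj (W i) ⟶ Y) (z : ∀ i, ι.obj Z ⟶ ι.obj (W i)) (hz : z ≠ 0)
    (h : ∑ i, z i ≫ φ i = 0) :
    ∃ (j : I) (z' : ∀ i, ι.obj (W j) ⟶ ι.obj (W i)) (c : k), c ≠ 0 ∧ z' j = c • 𝟙 _ ∧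
      ∑ i, z' i ≫ φ i = 0 := by
  classical
  let S : Set (Σ i, Z ⟶ W i) := {x | (F.basis Z (W x.1)).repr (z x.1) x.2 ≠ 0}
  have hS : S.Nonempty := by
    by_contra! hS
    refine hz (funext fun i => (F.basis Z (W i)).repr.injective ?_)
    ext q
    by_contra! hq
    have : (⟨i, q⟩ : Σ i, Z ⟶ W i) ∈ S := by simpa [S] using hq
    simp [hS] at this
  -- All basis morphisms that occur in the relation, ordered by left divisibility; dividing by a
  -- minimal one keeps its coefficient, which becomes the coefficient of an identity.
  let _ : Preorder (Σ i, Z ⟶ W i) :=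
    { le := fun x y => ∃ s, x.2 ≫ s = y.2
      le_refl := fun x => ⟨𝟙 _, by simp⟩
      le_trans := by
        rintro x y w ⟨s, hs⟩ ⟨s', hs'⟩
        exact ⟨s ≫ s', by rw [← Category.assoc, hs, hs']⟩ }
  obtain ⟨⟨j, p⟩, hp, hmin⟩ := S.toFinite.exists_minimal hS
  have hmin' : ∀ i (q : Z ⟶ W i), (F.basis Z (W i)).repr (z i) q ≠ 0 → ∀ s : W i ⟶ W j,
      q ≫ s = p → ∃ s', p ≫ s' = q := fun i q hq s hs => hmin (y := ⟨i, q⟩) hq ⟨s, hs⟩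
  refine ⟨j, fun i => F.leftDivision p _ (z i),
    (F.basis _ _).repr (F.leftDivision p _ (z j)) (𝟙 _), ?_, F.exists_eq_smul_id hC _ _, ?_⟩
  · rw [F.repr_leftDivision hC, Category.comp_id]
    exact hp
  -- Left division is only defined for targets in `C`, so the relation is divided one component of
  -- `Y` at a time.
  · obtain ⟨n, Y', a, b, -, -, hY⟩ := F.decomposition Y
    have key : ∀ l, (∑ i, F.leftDivision p _ (z i) ≫ φ i) ≫ b l = 0 := fun l => by
      have := congrArg (fun f => F.leftDivision p _ (f ≫ b l)) h
      simp only [Preadditive.sum_comp, map_sum, Category.assoc, zero_comp, map_zero] at this ⊢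
      rw [← this]
      exact Finset.sum_congr rfl fun i _ => (F.leftDivision_comp hC p _ _ (hmin' i)).symm
    rw [← Category.comp_id (∑ i, _), ← hY, Preadditive.comp_sum]
    exact Finset.sum_eq_zero fun l _ => by rw [← Category.assoc, key, zero_comp]

/-- Gaussian elimination, by induction on the number of summands of the source: if `φ` is not a
monomorphism, a relation with an invertible coefficient expresses one component of `φ` by the
others, so `φ` factors through a split epimorphism onto the sum of the other summands. -/
theorem hasSplitEpiMonoFactorizations [HasFiniteBiproducts A] [∀ X Y : C, Finite (X ⟶ Y)] :
    HasSplitEpiMonoFactorizations A := by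
  have key : ∀ (n : ℕ) (W : Fin n → C) (Y : A) (φ : ⨁ (fun i => ι.obj (W i)) ⟶ Y),
      ∃ (I : A) (p : ⨁ (fun i => ι.obj (W i)) ⟶ I) (s : I ⟶ ⨁ (fun i => ι.obj (W i)))
        (m : I ⟶ Y), s ≫ p = 𝟙 I ∧ Mono m ∧ p ≫ m = φ := by
    intro n
    induction n with
    | zero =>
      intro W Y φ
      refine ⟨_, 𝟙 _, 𝟙 _, φ, by simp, ⟨fun g h _ => ?_⟩, by simp⟩
      exact biproduct.hom_ext _ _ fun j => j.elim0
    | succ n ih =>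
      intro W Y φ
      by_cases hφ : Mono φ
      · exact ⟨_, 𝟙 _, 𝟙 _, φ, by simp, hφ, by simp⟩
      -- A nonzero morphism killed by `φ` can be tested on an object of `C`, since every source is a
      -- sum of such objects.
      obtain ⟨Z, z, hz, hz'⟩ : ∃ (Z : C) (z : ι.obj Z ⟶ ⨁ (fun i => ι.obj (W i))),
          z ≠ 0 ∧ z ≫ φ = 0 := by
        by_contra! H
        refine hφ (Preadditive.mono_of_cancel_zero φ fun {T} g hg => ?_)
        obtain ⟨n, X, i, p, -, -, hT⟩ := F.decomposition T
        rw [← Category.id_comp g, ← hT, Preadditive.sum_comp]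
        refine Finset.sum_eq_zero fun j _ => ?_
        rw [Category.assoc]
        by_cases h0 : i j ≫ g = 0
        · rw [h0, comp_zero]
        · exact absurd (by rw [Category.assoc, hg, comp_zero]) (H (X j) _ h0)
      obtain ⟨j, z', c, hc, hj, hz''⟩ := F.exists_relation hC
        (fun i => biproduct.ι (fun i => ι.obj (W i)) i ≫ φ)
        (fun i => z ≫ biproduct.π (fun i => ι.obj (W i)) i)
        (fun h0 => hz (biproduct.hom_ext _ _ fun i => by simpa using congrFun h0 i))
        (by
          have h0 : z ≫ (∑ i, biproduct.π (fun i => ι.obj (W i)) i ≫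
              biproduct.ι (fun i => ι.obj (W i)) i) ≫ φ = 0 := by
            rw [biproduct_total, Category.id_comp, hz']
          simpa only [Preadditive.sum_comp, Preadditive.comp_sum, Category.assoc] using h0)
      rw [Fin.sum_univ_succAbove _ j, hj, Linear.smul_comp, Category.id_comp] at hz''
      -- `R` replaces the `j`-th summand by its expression `-c⁻¹ • z'` in the others, and `T` is the
      -- inclusion of the others.
      let R : ⨁ (fun i => ι.obj (W i)) ⟶ ⨁ (fun i => ι.obj (W (j.succAbove i))) :=
        biproduct.lift fun i => biproduct.π (fun i => ι.obj (W i)) (j.succAbove i) -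
          c⁻¹ • (biproduct.π (fun i => ι.obj (W i)) j ≫ z' (j.succAbove i))
      let T : ⨁ (fun i => ι.obj (W (j.succAbove i))) ⟶ ⨁ (fun i => ι.obj (W i)) :=
        biproduct.desc fun i => biproduct.ι (fun i => ι.obj (W i)) (j.succAbove i)
      have hTR : T ≫ R = 𝟙 _ := by
        refine biproduct.hom_ext' _ _ fun a => biproduct.hom_ext _ _ fun b => ?_
        have h0 : biproduct.ι (fun i => ι.obj (W i)) (j.succAbove a) ≫
            biproduct.π (fun i => ι.obj (W i)) j = 0 :=
          biproduct.ι_π_ne _ (Fin.succAbove_ne j a)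
        by_cases hab : a = b
        · subst hab
          simp [T, R, reassoc_of% h0]
        · have h1 : biproduct.ι (fun i => ι.obj (W i)) (j.succAbove a) ≫
              biproduct.π (fun i => ι.obj (W i)) (j.succAbove b) = 0 :=
            biproduct.ι_π_ne _ fun h => hab (Fin.succAbove_right_injective h)
          simp [T, R, reassoc_of% h0, h1, biproduct.ι_π_ne _ hab]
      have hRT : R ≫ T ≫ φ = φ := by
        have h1 : R ≫ T ≫ φ = ∑ i, (biproduct.π (fun i => ι.obj (W i)) (j.succAbove i) ≫
              biproduct.ι (fun i => ι.obj (W i)) (j.succAbove i) ≫ φ) -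
            c⁻¹ • (biproduct.π (fun i => ι.obj (W i)) j ≫ ∑ i, z' (j.succAbove i) ≫
              biproduct.ι (fun i => ι.obj (W i)) (j.succAbove i) ≫ φ) := by
          rw [← Category.assoc R, biproduct.lift_desc, Preadditive.sum_comp]
          simp [Preadditive.sub_comp, Finset.smul_sum, Preadditive.comp_sum]
        rw [h1, eq_neg_of_add_eq_zero_right hz'']
        conv_rhs => rw [← Category.id_comp φ, ← biproduct_total, Fin.sum_univ_succAbove _ j]
        simp [Preadditive.sum_comp, smul_smul, inv_mul_cancel₀ hc, add_comm]
      obtain ⟨I, p, s, m, hs, hm, hpm⟩ := ih _ Y (T ≫ φ)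
      refine ⟨I, R ≫ p, s ≫ T, m, ?_, hm, ?_⟩
      · rw [Category.assoc, reassoc_of% hTR, hs]
      · rw [Category.assoc, hpm, hRT]
  intro X Y φ
  obtain ⟨n, W, ⟨e⟩⟩ := F.exists_iso X
  obtain ⟨I, p, s, m, hs, hm, hpm⟩ := key n W Y (e.inv ≫ φ)
  exact ⟨I, e.hom ≫ p, s ≫ e.inv, m, by simp [hs], hm, by simp [hpm]⟩

/-! ### Duals of representable functors -/

/-- On an object `Z` of `C`, the quotient of `A(Z, X)` by the images of the `b i` is at most
one-dimensional: by comparability, at most one `q : Z ⟶ X` divides `u` on the right. Taking the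
coefficient of `u` in `g ≫ q` therefore pairs this quotient perfectly with `A(U, Z)` modulo the
multiples of the `c j`, and `IsDualPresentable.of_mono` applies. -/
theorem isDualPresentable [HasFiniteBiproducts A] [∀ X Y : C, Finite (X ⟶ Y)] {X : C}
    (hX : HasDualFiltration X) : IsDualPresentable k (ι.obj X) := by
  classical
  induction hX with
  | @intro X U I J _ _ W V b u c b_inj ne_u ne_u' factor factor' _ ih =>
  have := Fintype.ofFinite I
  have := Fintype.ofFinite J
  have hcoord : ∀ {Z Y : C} (a : Z ⟶ Y) (f : ι.obj Z ⟶ ι.obj Y),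
      (F.basis Z Y).coord a f = (F.basis Z Y).repr f a := fun _ _ => rfl
  have hdesc : ∀ {T : A} (g : T ⟶ ⨁ fun i => ι.obj (W i)),
      g ≫ biproduct.desc (fun i => ι.map (b i)) = ∑ i, (g ≫ biproduct.π _ i) ≫ ι.map (b i) := by
    intro T g
    conv_lhs => rw [← Category.comp_id g, ← biproduct_total]
    simp [Preadditive.comp_sum, Preadditive.sum_comp]
  have hlift : ∀ {T : A} (g : (⨁ fun j => ι.obj (V j)) ⟶ T),
      biproduct.lift (fun j => ι.map (c j)) ≫ g = ∑ j, ι.map (c j) ≫ biproduct.ι (fun j => ι.obj (V j)) j ≫ g := by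
    intro T g
    conv_lhs => rw [← Category.id_comp g, ← biproduct_total]
    simp [Preadditive.comp_sum, Preadditive.sum_comp]
  -- Only the summand `i` contributes to the coefficient of `s ≫ b i`: a coincidence `s' ≫ b i' = s
  -- ≫ b i` forces `i' = i` by comparability and `b_inj`.
  have hmono : Mono (biproduct.desc fun i => ι.map (b i)) := by
    refine Preadditive.mono_of_cancel_zero _ fun {T} g hg => ?_
    obtain ⟨n, Z, a, p, -, -, hT⟩ := F.decomposition T
    suffices H : ∀ l, a l ≫ g = 0 by
      rw [← Category.id_comp g, ← hT, Preadditive.sum_comp]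
      exact Finset.sum_eq_zero fun l _ => by rw [Category.assoc, H, comp_zero]
    intro l
    refine biproduct.hom_ext _ _ fun i => (F.basis _ _).repr.injective (Finsupp.ext fun s => ?_)
    have h : (F.basis _ _).repr ((a l ≫ g) ≫ biproduct.desc fun i => ι.map (b i)) (s ≫ b i) = 0 := by
      rw [Category.assoc, hg, comp_zero, map_zero, Finsupp.zero_apply]
    rw [hdesc, map_sum, Finsupp.finsetSum_apply] at h
    rw [Finset.sum_eq_single i] at h
    · rw [F.repr_comp_map hC] at h
      rw [h, zero_comp, map_zero, Finsupp.zero_apply]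
    · intro i' _ hi'
      refine F.repr_comp_map_of_ne _ _ _ fun s' hs' => hi' ?_
      obtain ⟨e, -, he⟩ | ⟨e, -, he⟩ := hC.comparable s' (b i') s (b i) hs'
      · exact (b_inj _ _ e he).symm
      · exact b_inj _ _ e he
    · simp
  refine IsDualPresentable.of_mono (biproduct.desc fun i => ι.map (b i))
    (biproduct.lift fun j => ι.map (c j)) ((F.basis U X).coord u) (fun T g => ⟨fun hg => ?_, ?_⟩)
    (fun T μ => ⟨fun hμ => ?_, ?_⟩) (IsDualPresentable.biproduct _ ih)
  · obtain ⟨n, Z, a, p, -, -, hT⟩ := F.decomposition T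
    suffices H : ∀ l, ∃ h, biproduct.lift (fun j => ι.map (c j)) ≫ h = g ≫ p l by
      choose h hh using H
      refine ⟨∑ l, h l ≫ a l, ?_⟩
      rw [Preadditive.comp_sum, ← Category.comp_id g, ← hT, Preadditive.comp_sum]
      exact Finset.sum_congr rfl fun l _ => by rw [← Category.assoc, hh, Category.assoc]
    intro l
    change g ≫ p l ∈ LinearMap.range
      (Linear.leftComp k (ι.obj (Z l)) (biproduct.lift fun j => ι.map (c j)))
    have := Fintype.ofFinite (U ⟶ Z l)
    rw [← (F.basis _ _).sum_repr (g ≫ p l)]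
    refine Submodule.sum_mem _ fun s _ => ?_
    obtain ⟨j, h, rfl⟩ | ⟨q, hq⟩ := factor' s
    · refine Submodule.smul_mem _ _ ⟨biproduct.π _ j ≫ ι.map h, ?_⟩
      simp
    -- Composition with `q` turns the coefficient of `s` into the coefficient of `u`, which vanishes
    -- by assumption.
    · have h := hg (p l ≫ ι.map q)
      rw [← Category.assoc, hcoord, ← hq, F.repr_comp_map hC] at h
      rw [h, zero_smul]
      exact zero_mem _
  · rintro ⟨h, rfl⟩ q
    rw [Category.assoc, hlift, map_sum]
    exact Finset.sum_eq_zero fun j _ => F.repr_map_comp_of_ne _ _ _ (ne_u' j)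
  · obtain ⟨n, Z, a, p, -, -, hT⟩ := F.decomposition T
    suffices H : ∀ l, ∃ g : ι.obj U ⟶ ι.obj (Z l), ∀ q,
        μ (p l ≫ q) = (F.basis U X).coord u (g ≫ q) by
      choose g hg using H
      refine ⟨∑ l, g l ≫ a l, fun q => ?_⟩
      conv_lhs => rw [← Category.id_comp q, ← hT]
      simp only [Preadditive.sum_comp, map_sum, Category.assoc]
      exact Finset.sum_congr rfl fun l _ => hg l _
    intro l
    have hμ' : ∀ (i : I) (r : Z l ⟶ W i), μ (p l ≫ ι.map (r ≫ b i)) = 0 := fun i r => by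
      have := hμ (p l ≫ ι.map r ≫ biproduct.ι (fun i => ι.obj (W i)) i)
      simpa using this
    by_cases H : ∃ (q : Z l ⟶ X) (s : U ⟶ Z l), s ≫ q = u
    · obtain ⟨q₀, s₀, h₀⟩ := H
      refine ⟨μ (p l ≫ ι.map q₀) • ι.map s₀, fun q => ?_⟩
      suffices E : μ ∘ₗ Linear.leftComp k _ (p l) = (F.basis U X).coord u ∘ₗ
          Linear.leftComp k _ (μ (p l ≫ ι.map q₀) • ι.map s₀) from LinearMap.congr_fun E q
      refine (F.basis _ _).ext fun q => ?_
      simp only [LinearMap.comp_apply, basis_apply, Linear.leftComp_apply, Linear.smul_comp,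
        map_smul, ← Functor.map_comp, hcoord, F.repr_map, Finsupp.smul_apply, Finsupp.single_apply,
        smul_eq_mul]
      obtain ⟨i, r, rfl⟩ | ⟨s, hs⟩ := factor q
      · rw [hμ', if_neg, mul_zero]
        rw [← Category.assoc]
        exact ne_u i _
      -- Two right divisors of `u` with the same source differ by an endomorphism of `Z`, hence
      -- agree.
      · have : q = q₀ := by
          obtain ⟨e, -, he⟩ | ⟨e, -, he⟩ := hC.comparable s q s₀ q₀ (hs.trans h₀.symm)
          · rw [← he, hC.eq_id e, Category.id_comp]
          · rw [← he, hC.eq_id e, Category.id_comp]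
        subst this
        rw [if_pos h₀, mul_one]
    · refine ⟨0, fun q => ?_⟩
      suffices E : μ ∘ₗ Linear.leftComp k _ (p l) = 0 by
        simpa using LinearMap.congr_fun E q
      refine (F.basis _ _).ext fun q => ?_
      obtain ⟨i, r, rfl⟩ | ⟨s, hs⟩ := factor q
      · simpa using hμ' i r
      · exact absurd ⟨q, s, hs⟩ H
  · rintro ⟨g, hg⟩ r
    rw [hg, ← Category.assoc, hdesc, map_sum]
    exact Finset.sum_eq_zero fun i _ => F.repr_comp_map_of_ne _ _ _ (ne_u i)

theorem isDualPresentable_of_forall [HasFiniteBiproducts A] [∀ X Y : C, Finite (X ⟶ Y)]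
    (h : ∀ X : C, HasDualFiltration X) (Z : A) : IsDualPresentable k Z := by
  obtain ⟨n, W, ⟨e⟩⟩ := F.exists_iso Z
  exact (IsDualPresentable.biproduct _ fun i => F.isDualPresentable hC (h (W i))).of_iso e.symm

end

end IsFreeOn

/-! ## Finitely presented modules -/

section FinitelyPresented

variable {k : Type u} [Field k]

/-! ### Kernels and exactness in functor categories, computed pointwise. -/

section Pointwise

variable {J : Type u} [Category.{u} J]

theorem exists_lift_of_injective {L N M : J ⥤ ModuleCat.{u} k} (i : N ⟶ M)
    (hi : ∀ Z, Function.Injective (i.app Z)) (α : L ⟶ M)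
    (hα : ∀ Z x, ∃ y, i.app Z y = α.app Z x) : ∃ β : L ⟶ N, β ≫ i = α := by
  have hmono (Z) : Mono (i.app Z) := (ModuleCat.mono_iff_injective _).2 (hi Z)
  let e (Z : J) := LinearEquiv.ofInjective (i.app Z).hom (hi Z)
  let β (Z : J) : L.obj Z ⟶ N.obj Z := ModuleCat.ofHom
    ((e Z).symm.toLinearMap ∘ₗ (α.app Z).hom.codRestrict (LinearMap.range (i.app Z).hom) (hα Z))
  have hβ (Z : J) : β Z ≫ i.app Z = α.app Z := by
    ext x
    exact congrArg Subtype.val ((e Z).apply_symm_apply ⟨(α.app Z).hom x, hα Z x⟩)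
  refine ⟨{ app := β, naturality := fun Z Z' f => ?_ }, by ext Z : 2; exact hβ Z⟩
  rw [← cancel_mono (i.app Z'), Category.assoc, hβ, Category.assoc, i.naturality,
    ← Category.assoc, hβ, α.naturality]

theorem app_injective_of_mono {N M : J ⥤ ModuleCat.{u} k} (i : N ⟶ M) [Mono i] (Z : J) :
    Function.Injective (i.app Z) :=
  (ModuleCat.mono_iff_injective _).1 inferInstance

theorem app_surjective_of_epi {N M : J ⥤ ModuleCat.{u} k} (i : N ⟶ M) [Epi i] (Z : J) :
    Function.Surjective (i.app Z) :=
  (ModuleCat.epi_iff_surjective _).1 inferInstance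

theorem app_exact_of_exact {S : ShortComplex (J ⥤ ModuleCat.{u} k)} (hS : S.Exact) (Z : J) :
    Function.Exact (S.f.app Z) (S.g.app Z) :=
  (ShortComplex.ShortExact.moduleCat_exact_iff_function_exact _).1
    (hS.map ((evaluation J (ModuleCat.{u} k)).obj Z))

end Pointwise

variable {A : Type u} [Category.{u} A] [Preadditive A] [Linear k A]

/-- The components of a morphism from a representable functor. -/
def ev {X : A} {N : Aᵒᵖ ⥤ ModuleCat.{u} k} (α : (linearYoneda k A).obj X ⟶ N) (Z : A) :
    (Z ⟶ X) →ₗ[k] N.obj (op Z) :=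
  (α.app (op Z)).hom

theorem ev_map_comp {X Y : A} {N : Aᵒᵖ ⥤ ModuleCat.{u} k} (f : X ⟶ Y)
    (β : (linearYoneda k A).obj Y ⟶ N) {Z : A} (g : Z ⟶ X) :
    ev ((linearYoneda k A).map f ≫ β) Z g = ev β Z (g ≫ f) := rfl

theorem ev_comp {X : A} {N M : Aᵒᵖ ⥤ ModuleCat.{u} k} (α : (linearYoneda k A).obj X ⟶ N)
    (f : N ⟶ M) {Z : A} (g : Z ⟶ X) : ev (α ≫ f) Z g = f.app (op Z) (ev α Z g) := rfl

theorem ev_comp_apply {X : A} {N : Aᵒᵖ ⥤ ModuleCat.{u} k} (α : (linearYoneda k A).obj X ⟶ N)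
    {Z W : A} (g : Z ⟶ W) (f : W ⟶ X) : ev α Z (g ≫ f) = N.map g.op (ev α W f) :=
  LinearMap.congr_fun (ModuleCat.hom_ext_iff.1 (α.naturality g.op)) f

theorem linearYoneda_obj_hom_ext {X : A} {N : Aᵒᵖ ⥤ ModuleCat.{u} k}
    {α β : (linearYoneda k A).obj X ⟶ N} (h : ev α X (𝟙 X) = ev β X (𝟙 X)) : α = β := by
  have (Z : A) : ev α Z = ev β Z := by
    ext f
    rw [← Category.comp_id f, ev_comp_apply, ev_comp_apply, h]
  ext Z f
  exact LinearMap.congr_fun (this Z.unop) f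

/-- Projectivity of representables: by the Yoneda lemma, lifting `α` means choosing a preimage of
one element at `X`. -/
theorem exists_map_comp_eq {X Y : A} {N : Aᵒᵖ ⥤ ModuleCat.{u} k}
    (α : (linearYoneda k A).obj X ⟶ N) (β : (linearYoneda k A).obj Y ⟶ N)
    (hβ : Function.Surjective (ev β X)) : ∃ f : X ⟶ Y, (linearYoneda k A).map f ≫ β = α := by
  obtain ⟨f, hf⟩ := hβ (ev α X (𝟙 X))
  exact ⟨f, linearYoneda_obj_hom_ext (by rw [ev_map_comp, Category.id_comp, hf])⟩

/-- The sequence `A(-, X) ⟶ A(-, Y) ⟶ M ⟶ 0` is exact. -/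
def IsPresentation {X Y : A} (φ : X ⟶ Y) {M : Aᵒᵖ ⥤ ModuleCat.{u} k}
    (π : (linearYoneda k A).obj Y ⟶ M) : Prop :=
  ∀ Z : A, (∀ g : Z ⟶ Y, ev π Z g = 0 ↔ ∃ w : Z ⟶ X, w ≫ φ = g) ∧ Function.Surjective (ev π Z)

theorem isFinitelyPresented_iff {M : Aᵒᵖ ⥤ ModuleCat.{u} k} : isFinitelyPresented k A M ↔
    ∃ (X Y : A) (φ : X ⟶ Y) (π : (linearYoneda k A).obj Y ⟶ M), IsPresentation φ π :=
  ⟨fun ⟨X, Y, φ, π, h⟩ => ⟨X, Y, φ, π, fun Z => h (op Z)⟩,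
    fun ⟨X, Y, φ, π, h⟩ => ⟨X, Y, φ, π, fun Z => h Z.unop⟩⟩

theorem isFinitelyPresented_of_iso {M N : Aᵒᵖ ⥤ ModuleCat.{u} k} (e : M ≅ N)
    (h : isFinitelyPresented k A M) : isFinitelyPresented k A N := by
  rw [isFinitelyPresented_iff] at h ⊢
  obtain ⟨X, Y, φ, π, h⟩ := h
  refine ⟨X, Y, φ, π ≫ e.hom, fun Z => ⟨fun x => ?_, fun y => ?_⟩⟩
  · rw [← (h Z).1 x, ev_comp, map_eq_zero_iff _ (app_injective_of_mono e.hom (op Z))]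
  · obtain ⟨x, rfl⟩ := app_surjective_of_epi e.hom (op Z) y
    obtain ⟨w, rfl⟩ := (h Z).2 x
    exact ⟨w, rfl⟩

instance : (isFinitelyPresented k A).IsClosedUnderIsomorphisms where
  of_iso e h := isFinitelyPresented_of_iso e h

/-! ### Closure of finitely presented modules under cokernels, kernels and sums. -/

variable [HasFiniteBiproducts A]

theorem isFinitelyPresented_linearYoneda (X : A) :
    isFinitelyPresented k A ((linearYoneda k A).obj X) := by
  obtain ⟨O, hO⟩ := (hasZeroObject_of_hasFiniteBiproducts A).zero
  rw [isFinitelyPresented_iff]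
  refine ⟨O, X, 0, 𝟙 _, fun Z => ⟨fun x => ?_, fun x => ⟨x, rfl⟩⟩⟩
  change x = 0 ↔ _
  simp [eq_comm]

/-- `L` has the generators of `N`; its relations are those of `N` together with the images of the
generators of `M`, lifted to `f₀`. -/
theorem isFinitelyPresented_cokernel {M N L : Aᵒᵖ ⥤ ModuleCat.{u} k} (f : M ⟶ N) (g : N ⟶ L)
    (hfg : ∀ Z, Function.Exact (f.app Z) (g.app Z)) (hg : ∀ Z, Function.Surjective (g.app Z))
    (hM : isFinitelyPresented k A M) (hN : isFinitelyPresented k A N) :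
    isFinitelyPresented k A L := by
  have := HasBinaryBiproducts.of_hasBinaryProducts (C := A)
  rw [isFinitelyPresented_iff] at hM hN ⊢
  obtain ⟨X₁, X₀, φ, π, hM⟩ := hM
  obtain ⟨Y₁, Y₀, φ', π', hN⟩ := hN
  obtain ⟨f₀, hf₀⟩ := exists_map_comp_eq (π ≫ f) π' (hN _).2
  have hf₀' : ∀ (Z : A) (x : Z ⟶ X₀), ev π' Z (x ≫ f₀) = f.app (op Z) (ev π Z x) := fun Z x => by
    rw [← ev_map_comp, hf₀, ev_comp]
  refine ⟨X₀ ⊞ Y₁, Y₀, biprod.desc f₀ φ', π' ≫ g, fun Z => ⟨fun y => ?_, (hg _).comp (hN Z).2⟩⟩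
  rw [ev_comp]
  constructor
  · intro hy
    obtain ⟨m, hm⟩ := (hfg _ _).1 hy
    obtain ⟨x, rfl⟩ := (hM _).2 m
    obtain ⟨w, hw⟩ := ((hN Z).1 (y - x ≫ f₀)).1 (by rw [map_sub, hf₀', hm, sub_self])
    exact ⟨biprod.lift x w, by rw [biprod.lift_desc, hw]; abel⟩
  · rintro ⟨w, rfl⟩
    have : w ≫ biprod.desc f₀ φ' = (w ≫ biprod.fst) ≫ f₀ + (w ≫ biprod.snd) ≫ φ' := by
      rw [biprod.desc_eq]
      simp
    rw [this, map_add, map_add, hf₀', (hfg _).apply_apply_eq_zero, zero_add,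
      ((hN Z).1 _).2 ⟨_, rfl⟩, map_zero]

omit [HasFiniteBiproducts A] in
theorem comp_snd_comp_eq_neg [HasBinaryBiproducts A] {Z K X Y W : A} {f : X ⟶ W} {g : Y ⟶ W}
    {κ : K ⟶ X ⊞ Y} (hκ : κ ≫ biprod.desc f g = 0) (h : Z ⟶ K) :
    (-(h ≫ κ ≫ biprod.snd)) ≫ g = (h ≫ κ ≫ biprod.fst) ≫ f := by
  have := h ≫= hκ
  rw [biprod.desc_eq, Preadditive.comp_add, Preadditive.comp_add, comp_zero] at this
  simp only [Preadditive.neg_comp, Category.assoc]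
  exact (eq_neg_of_add_eq_zero_left this).symm

/-- A relation between the generators of `N` is an `x` such that `x ≫ f` is a multiple of `φ`; such
pairs are the morphisms into a weak kernel of `biprod.desc f φ`. -/
theorem isFinitelyPresented_of_injective (hA : HasWeakKernels A) {N M : Aᵒᵖ ⥤ ModuleCat.{u} k}
    {X : A} (i : N ⟶ M) (hi : ∀ Z, Function.Injective (i.app Z))
    (π : (linearYoneda k A).obj X ⟶ N) (hπ : ∀ Z, Function.Surjective (ev π Z))
    (hM : isFinitelyPresented k A M) : isFinitelyPresented k A N := by
  have := HasBinaryBiproducts.of_hasBinaryProducts (C := A)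
  rw [isFinitelyPresented_iff] at hM ⊢
  obtain ⟨Y₁, Y₀, φ, ρ, hM⟩ := hM
  obtain ⟨f, hf⟩ := exists_map_comp_eq (π ≫ i) ρ (hM _).2
  have hf' : ∀ (Z : A) (x : Z ⟶ X), ev ρ Z (x ≫ f) = i.app (op Z) (ev π Z x) := fun Z x => by
    rw [← ev_map_comp, hf, ev_comp]
  obtain ⟨K, κ, hκ, hK⟩ := hA (biprod.desc f φ)
  refine ⟨K, X, κ ≫ biprod.fst, π, fun Z => ⟨fun x => ?_, hπ Z⟩⟩
  rw [← map_eq_zero_iff _ (hi (op Z)), ← hf', (hM Z).1]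
  constructor
  · rintro ⟨w, hw⟩
    obtain ⟨h, hh⟩ := hK (biprod.lift x (-w)) (by simp [biprod.lift_desc, hw])
    exact ⟨h, by rw [reassoc_of% hh, biprod.lift_fst]⟩
  · rintro ⟨h, rfl⟩
    exact ⟨_, comp_snd_comp_eq_neg hκ h⟩

/-- A weak kernel of `biprod.desc f₀ φ'` describes the elements of `A(-, X₀)` whose image in `L`
vanishes. It makes the kernel `N` finitely generated, and `isFinitelyPresented_of_injective` then
provides the relations. -/
theorem isFinitelyPresented_kernel (hA : HasWeakKernels A) {N M L : Aᵒᵖ ⥤ ModuleCat.{u} k}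
    (i : N ⟶ M) (f : M ⟶ L) (hi : ∀ Z, Function.Injective (i.app Z))
    (hf : ∀ Z, Function.Exact (i.app Z) (f.app Z)) (hM : isFinitelyPresented k A M)
    (hL : isFinitelyPresented k A L) : isFinitelyPresented k A N := by
  have := HasBinaryBiproducts.of_hasBinaryProducts (C := A)
  have hM' := hM
  rw [isFinitelyPresented_iff] at hM hL
  obtain ⟨X₁, X₀, φ, π, hM⟩ := hM
  obtain ⟨Y₁, Y₀, φ', π', hL⟩ := hL
  obtain ⟨f₀, hf₀⟩ := exists_map_comp_eq (π ≫ f) π' (hL _).2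
  have hf₀' : ∀ (Z : A) (x : Z ⟶ X₀), ev π' Z (x ≫ f₀) = f.app (op Z) (ev π Z x) := fun Z x => by
    rw [← ev_map_comp, hf₀, ev_comp]
  obtain ⟨K, κ, hκ, hK⟩ := hA (biprod.desc f₀ φ')
  have hκ' : ∀ {Z : A} (x : Z ⟶ K),
      ∃ n, i.app (op Z) n = ev ((linearYoneda k A).map (κ ≫ biprod.fst) ≫ π) Z x := fun {Z} x => by
    refine (hf (op Z) _).1 ?_
    rw [ev_map_comp, ← hf₀', (hL Z).1]
    exact ⟨_, comp_snd_comp_eq_neg hκ x⟩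
  obtain ⟨β, hβ⟩ := exists_lift_of_injective i hi
    ((linearYoneda k A).map (κ ≫ biprod.fst) ≫ π) (fun Z x => hκ' (Z := Z.unop) x)
  refine isFinitelyPresented_of_injective hA i hi β (fun Z n => ?_) hM'
  obtain ⟨x, hx⟩ := (hM Z).2 (i.app (op Z) n)
  obtain ⟨w, hw⟩ := ((hL Z).1 (x ≫ f₀)).1 (by rw [hf₀', hx, (hf _).apply_apply_eq_zero])
  obtain ⟨h, hh⟩ := hK (biprod.lift x (-w)) (by simp [biprod.lift_desc, hw])
  refine ⟨h, hi (op Z) ?_⟩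
  rw [← ev_comp, hβ, ev_map_comp, reassoc_of% hh, biprod.lift_fst, hx]

theorem isFinitelyPresented_biprod {M N : Aᵒᵖ ⥤ ModuleCat.{u} k}
    (hM : isFinitelyPresented k A M) (hN : isFinitelyPresented k A N) :
    isFinitelyPresented k A (M ⊞ N) := by
  have := HasBinaryBiproducts.of_hasBinaryProducts (C := A)
  rw [isFinitelyPresented_iff] at hM hN ⊢
  obtain ⟨X₁, X₀, φ, π, hM⟩ := hM
  obtain ⟨Y₁, Y₀, φ', π', hN⟩ := hN
  let ρ : (linearYoneda k A).obj (X₀ ⊞ Y₀) ⟶ M ⊞ N :=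
    biprod.lift ((linearYoneda k A).map biprod.fst ≫ π) ((linearYoneda k A).map biprod.snd ≫ π')
  have h1 : ∀ (Z : A) (x : Z ⟶ X₀ ⊞ Y₀),
      (biprod.fst : M ⊞ N ⟶ M).app (op Z) (ev ρ Z x) = ev π Z (x ≫ biprod.fst) := fun Z x => by
    rw [← ev_comp, biprod.lift_fst, ev_map_comp]
  have h2 : ∀ (Z : A) (x : Z ⟶ X₀ ⊞ Y₀),
      (biprod.snd : M ⊞ N ⟶ N).app (op Z) (ev ρ Z x) = ev π' Z (x ≫ biprod.snd) := fun Z x => by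
    rw [← ev_comp, biprod.lift_snd, ev_map_comp]
  have ext (Z : A) (x y : (M ⊞ N).obj (op Z))
      (h : (biprod.fst : M ⊞ N ⟶ M).app (op Z) x = (biprod.fst : M ⊞ N ⟶ M).app (op Z) y)
      (h' : (biprod.snd : M ⊞ N ⟶ N).app (op Z) x = (biprod.snd : M ⊞ N ⟶ N).app (op Z) y) :
      x = y := by
    have (z : (M ⊞ N).obj (op Z)) : z =
        (biprod.inl : M ⟶ M ⊞ N).app (op Z) ((biprod.fst : M ⊞ N ⟶ M).app (op Z) z) +
        (biprod.inr : N ⟶ M ⊞ N).app (op Z) ((biprod.snd : M ⊞ N ⟶ N).app (op Z) z) :=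
      LinearMap.congr_fun (ModuleCat.hom_ext_iff.1
        (NatTrans.congr_app (biprod.total (X := M) (Y := N)).symm (op Z))) z
    rw [this x, this y, h, h']
  refine ⟨X₁ ⊞ Y₁, X₀ ⊞ Y₀, biprod.map φ φ', ρ, fun Z => ⟨fun x => ⟨fun hx => ?_, ?_⟩, fun m => ?_⟩⟩
  · obtain ⟨w, hw⟩ := ((hM Z).1 (x ≫ biprod.fst)).1 (by rw [← h1, hx, map_zero])
    obtain ⟨w', hw'⟩ := ((hN Z).1 (x ≫ biprod.snd)).1 (by rw [← h2, hx, map_zero])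
    exact ⟨biprod.lift w w', by apply biprod.hom_ext <;> simp [hw, hw']⟩
  · rintro ⟨w, rfl⟩
    apply ext
    · rw [h1, map_zero, (hM Z).1]
      exact ⟨w ≫ biprod.fst, by simp⟩
    · rw [h2, map_zero, (hN Z).1]
      exact ⟨w ≫ biprod.snd, by simp⟩
  · obtain ⟨x, hx⟩ := (hM Z).2 ((biprod.fst : M ⊞ N ⟶ M).app (op Z) m)
    obtain ⟨y, hy⟩ := (hN Z).2 ((biprod.snd : M ⊞ N ⟶ N).app (op Z) m)
    refine ⟨biprod.lift x y, ext _ _ _ ?_ ?_⟩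
    · rw [h1, biprod.lift_fst, hx]
    · rw [h2, biprod.lift_snd, hy]

instance : (isFinitelyPresented k A).IsClosedUnderCokernels where
  cokernels_le := by
    rintro _ ⟨f, c, hc, hM, hN⟩
    have : Epi c.π := Cofork.IsColimit.epi hc
    have hS : (ShortComplex.mk f c.π c.condition).Exact :=
      ShortComplex.exact_of_g_is_cokernel _
        (IsColimit.ofIsoColimit hc (Cofork.ext (Iso.refl _) (by simp)))
    exact isFinitelyPresented_cokernel f c.π (app_exact_of_exact hS) (app_surjective_of_epi _)
      hM hN

theorem isClosedUnderKernels_isFinitelyPresented (hA : HasWeakKernels A) :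
    (isFinitelyPresented k A).IsClosedUnderKernels where
  kernels_le := by
    rintro _ ⟨f, c, hc, hM, hN⟩
    have : Mono c.ι := Fork.IsLimit.mono hc
    have hS : (ShortComplex.mk c.ι f c.condition).Exact :=
      ShortComplex.exact_of_f_is_kernel _
        (IsLimit.ofIsoLimit hc (Fork.ext (Iso.refl _) (by simp)))
    exact isFinitelyPresented_kernel hA c.ι f (app_injective_of_mono _) (app_exact_of_exact hS)
      hM hN

instance : (isFinitelyPresented k A).ContainsZero where
  exists_zero := by
    obtain ⟨O, hO⟩ := (hasZeroObject_of_hasFiniteBiproducts A).zero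
    refine ⟨_, ?_, isFinitelyPresented_linearYoneda O⟩
    rw [IsZero.iff_id_eq_zero]
    exact linearYoneda_obj_hom_ext (hO.eq_of_src _ _)

instance : (isFinitelyPresented k A).IsClosedUnderFiniteProducts := by
  have : (isFinitelyPresented k A).IsClosedUnderBinaryProducts :=
    ⟨by
      rintro M ⟨p⟩
      have hb := BinaryBiproduct.isLimit (p.diag.obj ⟨.left⟩) (p.diag.obj ⟨.right⟩)
      have hl := (IsLimit.postcomposeHomEquiv (diagramIsoPair p.diag) _).symm p.isLimit
      exact isFinitelyPresented_of_iso (hb.conePointUniqueUpToIso hl)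
        (isFinitelyPresented_biprod (p.prop_diag_obj _) (p.prop_diag_obj _))⟩
  exact .mk'

end FinitelyPresented

variable {k : Type u} [Field k] {A : Type u} [Category.{u} A] [Preadditive A] [Linear k A]

/-! ## Semi-hereditary categories -/

section SemiHereditary

variable [HasFiniteBiproducts A]

/-- Write the presentation as `φ = p ≫ m`. Since `p` is a split epimorphism, `φ` and `m` have the
same image on representables, so `0 ⟶ A(-, I) ⟶ A(-, Y) ⟶ M ⟶ 0` is exact with projective terms. -/
theorem isSemiHereditary_of_factorizations (H : HasSplitEpiMonoFactorizations A) :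
    IsSemiHereditary k A := by
  have := isClosedUnderKernels_isFinitelyPresented (k := k) H.hasWeakKernels
  refine ⟨inferInstance, fun M => ?_⟩
  -- Projectivity and projective dimension refer to the epimorphisms of `mod A`; these have to be
  -- known to be pointwise surjective.
  have hsurj {N L : FPMod k A} (e : N ⟶ L) [Epi e] : Epi e.hom := by
    have := (isFinitelyPresented k A).preservesEpimorphisms_ι_of_isNormalMonoCategory
    exact inferInstanceAs (Epi ((isFinitelyPresented k A).ι.map e))
  let P (X : A) : FPMod k A := ⟨_, isFinitelyPresented_linearYoneda X⟩
  have hP (X : A) : Projective (P X) := ⟨fun {N L} f e he => by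
    obtain ⟨Y₁, Y₀, φ, ρ, hN⟩ := isFinitelyPresented_iff.1 N.property
    have := hsurj e
    obtain ⟨f₀, hf₀⟩ := exists_map_comp_eq (A := A) f.hom (ρ ≫ e.hom)
      ((app_surjective_of_epi e.hom _).comp (hN X).2)
    exact ⟨ObjectProperty.homMk ((linearYoneda k A).map f₀ ≫ ρ),
      ObjectProperty.hom_ext _ (by simpa using hf₀)⟩⟩
  obtain ⟨X, Y, φ, π, hM⟩ := isFinitelyPresented_iff.1 M.property
  obtain ⟨I, p, s, m, hs, hm, rfl⟩ := H φ
  let f : P I ⟶ P Y := ObjectProperty.homMk ((linearYoneda k A).map m)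
  let g : P Y ⟶ M := ObjectProperty.homMk π
  have hf : ∀ Z, Function.Injective (((linearYoneda k A).map m).app Z) := fun Z a b hab =>
    (cancel_mono m).1 hab
  have hI {Z : A} (y : Z ⟶ Y) : ev π Z y = 0 ↔ ∃ w, w ≫ m = y := by
    rw [(hM Z).1]
    constructor
    · rintro ⟨w, rfl⟩
      exact ⟨w ≫ p, by simp⟩
    · rintro ⟨w, rfl⟩
      exact ⟨w ≫ s, by simp [reassoc_of% hs]⟩
  have hfg : f ≫ g = 0 := ObjectProperty.hom_ext _ (linearYoneda_obj_hom_ext ((hI _).2 ⟨_, rfl⟩))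
  have hmono : Mono f := by
    have : Mono ((isFinitelyPresented k A).ι.map f) :=
      (NatTrans.mono_iff_mono_app _).2 fun Z => (ModuleCat.mono_iff_injective _).2 (hf Z)
    exact (isFinitelyPresented k A).ι.mono_of_mono_map this
  have hepi : Epi g := by
    have : Epi ((isFinitelyPresented k A).ι.map g) :=
      (NatTrans.epi_iff_epi_app _).2 fun Z => (ModuleCat.epi_iff_surjective _).2 (hM Z.unop).2
    exact (isFinitelyPresented k A).ι.epi_of_epi_map this
  have hexact : (ShortComplex.mk f g hfg).Exact := by
    refine ShortComplex.exact_of_f_is_kernel _ (Fork.IsLimit.ofExistsUnique fun c => ?_)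
    obtain ⟨β, hβ⟩ := exists_lift_of_injective ((linearYoneda k A).map m) hf c.ι.hom (by
      intro Z x
      refine (hI (Z := Z.unop) _).1 ?_
      exact LinearMap.congr_fun (ModuleCat.hom_ext_iff.1
        (NatTrans.congr_app (congrArg (fun a => a.hom) c.condition) Z)) x)
    refine ⟨ObjectProperty.homMk β, ObjectProperty.hom_ext _ hβ, fun b hb => ?_⟩
    rw [← cancel_mono f]
    exact Eq.trans hb (ObjectProperty.hom_ext _ hβ.symm)
  exact ShortComplex.ShortExact.hasProjectiveDimensionLT_X₃
    (S := ShortComplex.mk f g hfg) { exact := hexact } 1 inferInstance inferInstance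

end SemiHereditary

/-! ## Duality -/

section Duality

variable {k : Type u} [Field k] {A : Type u} [Category.{u} A] [Preadditive A] [Linear k A]

theorem IsDualPresentable.isFinitelyPresented_moduleDual {X : A} (h : IsDualPresentable k X) :
    isFinitelyPresented k Aᵒᵖ ((moduleDual k A).obj (op ((linearYoneda k A).obj X))) := by
  obtain ⟨U, V, ψ, l, h⟩ := h
  let π : (linearYoneda k Aᵒᵖ).obj (op U) ⟶
      (moduleDual k A).obj (op ((linearYoneda k A).obj X)) :=
    { app := fun Z => ModuleCat.ofHom
        { toFun := fun (g : unop Z ⟶ op U) =>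
            (l ∘ₗ Linear.leftComp k X g.unop : (unop (unop Z) ⟶ X) →ₗ[k] k)
          map_add' := fun (g g' : unop Z ⟶ op U) => LinearMap.ext fun (q : unop (unop Z) ⟶ X) => by
            change l ((g.unop + g'.unop) ≫ q) = l (g.unop ≫ q) + l (g'.unop ≫ q)
            rw [Preadditive.add_comp, map_add]
          map_smul' := fun c (g : unop Z ⟶ op U) => LinearMap.ext fun (q : unop (unop Z) ⟶ X) => by
            change l ((c • g.unop) ≫ q) = c • l (g.unop ≫ q)
            rw [Linear.smul_comp, map_smul] }
      naturality := fun Z Z' f => by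
        ext (g : unop Z ⟶ op U)
        refine LinearMap.ext fun (q : unop (unop Z') ⟶ X) => ?_
        change l ((g.unop ≫ f.unop.unop) ≫ q) = l (g.unop ≫ f.unop.unop ≫ q)
        rw [Category.assoc] }
  have hπ (Z : Aᵒᵖ) (g : Z ⟶ op U) (q : unop Z ⟶ X) :
      (show (unop Z ⟶ X) →ₗ[k] k from ev π Z g) q = l (g.unop ≫ q) := rfl
  refine isFinitelyPresented_iff.2 ⟨op V, op U, ψ.op, π, fun Z => ⟨fun g => ?_, fun μ => ?_⟩⟩
  · have h1 : ev π Z g = 0 ↔ ∀ q : unop Z ⟶ X, l (g.unop ≫ q) = 0 :=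
      ⟨fun hg q => LinearMap.congr_fun hg q, fun hg => LinearMap.ext hg⟩
    rw [h1, (h _).2]
    exact ⟨fun ⟨w, hw⟩ => ⟨w.op, Quiver.Hom.unop_inj hw⟩,
      fun ⟨w, hw⟩ => ⟨w.unop, congrArg Quiver.Hom.unop hw⟩⟩
  · obtain ⟨g, hg⟩ := (h (unop Z)).1 μ
    exact ⟨g.op, LinearMap.ext fun q => (hg q).symm⟩

instance hasFiniteBiproducts_opposite [HasFiniteBiproducts A] : HasFiniteBiproducts Aᵒᵖ :=
  HasFiniteBiproducts.of_hasFiniteProducts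

/-- `D` is exact, so `D M` is the kernel of `D(A(-, Y)) ⟶ D(A(-, X))`, a morphism between finitely
presented modules. -/
theorem isFinitelyPresented_moduleDual [HasFiniteBiproducts A]
    (hA : HasWeakKernels Aᵒᵖ) (h : ∀ X : A, IsDualPresentable k X) {M : Aᵒᵖ ⥤ ModuleCat.{u} k}
    (hM : isFinitelyPresented k A M) :
    isFinitelyPresented k Aᵒᵖ ((moduleDual k A).obj (op M)) := by
  obtain ⟨X, Y, φ, π, hM⟩ := hM
  refine isFinitelyPresented_kernel hA ((moduleDual k A).map π.op)
    ((moduleDual k A).map ((linearYoneda k A).map φ).op) (fun Z l l' hl => ?_) (fun Z l => ?_)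
    (h Y).isFinitelyPresented_moduleDual (h X).isFinitelyPresented_moduleDual
  · refine LinearMap.ext fun x => ?_
    obtain ⟨y, rfl⟩ := (hM (unop Z)).2 x
    exact LinearMap.congr_fun hl y
  · constructor
    · intro hl
      have hker : LinearMap.ker (π.app (unop Z)).hom ≤ LinearMap.ker (R := k) (M₂ := k) l := by
        intro y hy
        obtain ⟨x, rfl⟩ := ((hM (unop Z)).1 y).1 hy
        exact LinearMap.congr_fun hl x
      let e := LinearMap.quotKerEquivOfSurjective (π.app (unop Z)).hom (hM (unop Z)).2
      refine ⟨((LinearMap.ker (π.app (unop Z)).hom).liftQ l hker ∘ₗ e.symm.toLinearMap :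
        Module.Dual k (M.obj (unop Z))), LinearMap.ext fun y => ?_⟩
      change (LinearMap.ker (π.app (unop Z)).hom).liftQ l hker
        (e.symm ((π.app (unop Z)).hom y)) =
          (show Module.Dual k (((linearYoneda k A).obj Y).obj (unop Z)) from l) y
      have : (π.app (unop Z)).hom y = e (Submodule.Quotient.mk y) := rfl
      rw [this, e.symm_apply_apply]
      rfl
    · rintro ⟨μ, rfl⟩
      refine LinearMap.ext fun x => ?_
      change (show Module.Dual k (M.obj (unop Z)) from μ)
        (π.app (unop Z) (((linearYoneda k A).map φ).app (unop Z) x)) = 0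
      rw [(hM (unop Z)).1.apply_apply_eq_zero, map_zero]

/-- The bidual of an `A`-module lives over the double opposite of `A`; this brings presentations
back to `A`. -/
theorem isFinitelyPresented_opOp_comp {M : Aᵒᵖᵒᵖᵒᵖ ⥤ ModuleCat.{u} k}
    (hM : isFinitelyPresented k Aᵒᵖᵒᵖ M) : isFinitelyPresented k A ((opOp A).op ⋙ M) := by
  obtain ⟨X, Y, φ, π, hM⟩ := hM
  let ρ : (linearYoneda k A).obj (unop (unop Y)) ⟶ (opOp A).op ⋙ M :=
    { app := fun Z => ModuleCat.ofHom
        { toFun := fun (g : unop Z ⟶ unop (unop Y)) => ev π (op (op (unop Z))) g.op.op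
          map_add' := fun (g g' : unop Z ⟶ unop (unop Y)) =>
            map_add (ev π (op (op (unop Z)))) g.op.op g'.op.op
          map_smul' := fun c (g : unop Z ⟶ unop (unop Y)) =>
            map_smul (ev π (op (op (unop Z)))) c g.op.op }
      naturality := fun Z Z' f => by
        ext (g : unop Z ⟶ unop (unop Y))
        exact ev_comp_apply π f.unop.op.op g.op.op }
  refine ⟨X.unop.unop, Y.unop.unop, φ.unop.unop, ρ, fun Z => ⟨fun g => ?_, fun x => ?_⟩⟩
  · refine ((hM (op (op (op (unop Z))))).1 (Quiver.Hom.op (Quiver.Hom.op g))).trans ?_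
    exact ⟨fun ⟨w, hw⟩ => ⟨w.unop.unop, congrArg (fun a => a.unop.unop) hw⟩,
      fun ⟨w, hw⟩ => ⟨Quiver.Hom.op (Quiver.Hom.op w),
        congrArg (fun a => Quiver.Hom.op (Quiver.Hom.op a)) hw⟩⟩
  · obtain ⟨g, hg⟩ := (hM (op (op (op (unop Z))))).2 x
    exact ⟨g.unop.unop, hg⟩

theorem HasWeakKernels.opOp (h : HasWeakKernels A) : HasWeakKernels Aᵒᵖᵒᵖ := by
  intro X Y φ
  obtain ⟨K, κ, hκ, hK⟩ := h φ.unop.unop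
  refine ⟨op (op K), κ.op.op, congrArg (fun a => a.op.op) hκ, fun Z g hg => ?_⟩
  obtain ⟨w, hw⟩ := hK g.unop.unop (congrArg (fun a => a.unop.unop) hg)
  exact ⟨w.op.op, congrArg (fun a => a.op.op) hw⟩

theorem finite_obj_of_isFinitelyPresented [∀ X Y : A, Module.Finite k (X ⟶ Y)]
    {M : Aᵒᵖ ⥤ ModuleCat.{u} k} (hM : isFinitelyPresented k A M) (Z : Aᵒᵖ) :
    Module.Finite k (M.obj Z) := by
  obtain ⟨X, Y, φ, π, hM⟩ := hM
  have : Module.Finite k (((linearYoneda k A).obj Y).obj Z) :=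
    inferInstanceAs (Module.Finite k (unop Z ⟶ Y))
  exact Module.Finite.of_surjective (π.app Z).hom (hM Z).2

/-- The restriction of `D` to finitely presented modules. -/
abbrev fpModuleDual (h : ∀ M : (FPMod k A)ᵒᵖ,
    isFinitelyPresented k Aᵒᵖ (((isFinitelyPresented k A).ι.op ⋙ moduleDual k A).obj M)) :
    (FPMod k A)ᵒᵖ ⥤ FPMod k Aᵒᵖ :=
  (isFinitelyPresented k Aᵒᵖ).lift ((isFinitelyPresented k A).ι.op ⋙ moduleDual k A) h

variable (h : ∀ M : (FPMod k A)ᵒᵖ,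
  isFinitelyPresented k Aᵒᵖ (((isFinitelyPresented k A).ι.op ⋙ moduleDual k A).obj M))

theorem faithful_fpModuleDual : (fpModuleDual h).Faithful where
  map_injective {M N} f g hfg := by
    refine Quiver.Hom.unop_inj (ObjectProperty.hom_ext _ ?_)
    ext Z x
    refine (Module.forall_dual_apply_eq_zero_iff k _).1 (fun l => ?_) |> sub_eq_zero.1
    rw [map_sub, sub_eq_zero]
    exact LinearMap.congr_fun (LinearMap.congr_fun (ModuleCat.hom_ext_iff.1
      (NatTrans.congr_app (congrArg (fun a => a.hom) hfg) (op Z))) l) x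

/-- The values of `M` are finite-dimensional, hence reflexive, so the transpose of `τ` takes values
in `M` itself. -/
theorem full_fpModuleDual [∀ X Y : A, Module.Finite k (X ⟶ Y)] : (fpModuleDual h).Full where
  map_surjective {M N} τ := by
    have (Z : Aᵒᵖ) := finite_obj_of_isFinitelyPresented M.unop.property Z
    let t (Z : Aᵒᵖ) : Module.Dual k (M.unop.obj.obj Z) →ₗ[k] Module.Dual k (N.unop.obj.obj Z) :=
      (τ.hom.app (op Z)).hom
    have ht {Z Z' : Aᵒᵖ} (g : Z ⟶ Z') (l : Module.Dual k (M.unop.obj.obj Z'))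
        (x : N.unop.obj.obj Z) : t Z' l (N.unop.obj.map g x) =
          t Z (l ∘ₗ (M.unop.obj.map g).hom) x :=
      LinearMap.congr_fun (LinearMap.congr_fun (ModuleCat.hom_ext_iff.1
        (τ.hom.naturality g.op)) l) x |>.symm
    let f (Z : Aᵒᵖ) : N.unop.obj.obj Z →ₗ[k] M.unop.obj.obj Z :=
      (Module.evalEquiv k (M.unop.obj.obj Z)).symm.toLinearMap ∘ₗ (t Z).dualMap ∘ₗ
        Module.Dual.eval k (N.unop.obj.obj Z)
    have hf (Z : Aᵒᵖ) (l : Module.Dual k (M.unop.obj.obj Z)) (x : N.unop.obj.obj Z) :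
        l (f Z x) = t Z l x := by
      simp [f]
    let F : N.unop.obj ⟶ M.unop.obj :=
      { app := fun Z => ModuleCat.ofHom (f Z)
        naturality := fun Z Z' g => by
          ext x
          refine (Module.forall_dual_apply_eq_zero_iff k _).1 (fun l => ?_) |> sub_eq_zero.1
          rw [map_sub, sub_eq_zero]
          change l (f Z' (N.unop.obj.map g x)) = (l ∘ₗ (M.unop.obj.map g).hom) (f Z x)
          rw [hf, hf, ht] }
    refine ⟨(ObjectProperty.homMk F : N.unop ⟶ M.unop).op, ObjectProperty.hom_ext _ ?_⟩
    ext Z l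
    exact LinearMap.ext fun x => hf (unop Z) l x

/-- By reflexivity a finitely presented `N` is the dual of its own dual, and `h'` says that this
dual is finitely presented over `A`. -/
theorem essSurj_fpModuleDual [∀ X Y : A, Module.Finite k (X ⟶ Y)]
    (h' : ∀ N : Aᵒᵖᵒᵖ ⥤ ModuleCat.{u} k, isFinitelyPresented k Aᵒᵖ N →
      isFinitelyPresented k A ((opOp A).op ⋙ (moduleDual k Aᵒᵖ).obj (op N))) :
    (fpModuleDual h).EssSurj where
  mem_essImage N := by
    have hfin (X Y : Aᵒᵖ) : Module.Finite k (X ⟶ Y) :=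
      Module.Finite.of_surjective
        ({ toFun := fun g => g.op, map_add' := fun _ _ => rfl, map_smul' := fun _ _ => rfl } :
          (unop Y ⟶ unop X) →ₗ[k] (X ⟶ Y)) fun g => ⟨g.unop, rfl⟩
    have (Z : Aᵒᵖᵒᵖ) := finite_obj_of_isFinitelyPresented N.property Z
    exact ⟨op ⟨_, h' N.obj N.property⟩, ⟨(ObjectProperty.isoMk _ (NatIso.ofComponents
      (fun Z => LinearEquiv.toModuleIso (Module.evalEquiv k (N.obj.obj Z)))
      fun _ => rfl)).symm⟩⟩

theorem isDualizing_of_isDualPresentable (hA : IsFiniteVariety k A) (hA₁ : HasWeakKernels A)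
    (hA₂ : HasWeakKernels Aᵒᵖ) (h₁ : ∀ X : A, IsDualPresentable k X)
    (h₂ : ∀ X : Aᵒᵖ, IsDualPresentable k X) : IsDualizing k A := by
  have := hA.hasFiniteBiproducts
  have := hA.finite_hom
  have h : ∀ M : (FPMod k A)ᵒᵖ, isFinitelyPresented k Aᵒᵖ
      (((isFinitelyPresented k A).ι.op ⋙ moduleDual k A).obj M) := fun M =>
    isFinitelyPresented_moduleDual hA₂ h₁ M.unop.property
  have := faithful_fpModuleDual h
  have := full_fpModuleDual h
  have := essSurj_fpModuleDual h fun N hN =>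
    isFinitelyPresented_opOp_comp (isFinitelyPresented_moduleDual hA₁.opOp h₂ hN)
  exact ⟨hA, h, { }⟩

end Duality

theorem IsFreeOn.isSemiHereditary_and_isDualizing {k : Type u} [Field k] {C A : Type u}
    [Category.{u} C] [Category.{u} A] [Preadditive A] [Linear k A] [HasFiniteBiproducts A]
    {ι : C ⥤ A} (F : IsFreeOn k ι) (hC : IsEquidivisible C) [∀ X Y : C, Finite (X ⟶ Y)]
    (h₁ : ∀ X : C, HasDualFiltration X) (h₂ : ∀ X : Cᵒᵖ, HasDualFiltration X) :
    IsSemiHereditary k A ∧ IsDualizing k A := by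
  have (X Y : Cᵒᵖ) : Finite (X ⟶ Y) := Finite.of_injective _ Quiver.Hom.unop_inj
  have H := F.hasSplitEpiMonoFactorizations hC
  have H' := F.op.hasSplitEpiMonoFactorizations hC.op
  exact ⟨isSemiHereditary_of_factorizations H, isDualizing_of_isDualPresentable
    ⟨inferInstance, F.finite_hom, H.isIdempotentComplete⟩ H.hasWeakKernels H'.hasWeakKernels
    (F.isDualPresentable_of_forall hC h₁) (F.op.isDualPresentable_of_forall hC.op h₂)⟩

/-! ## Paths in quivers -/

section Paths

open Quiver

variable {V : Type*} [Quiver V]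

theorem comp_eq_comp {a b b' c : V} (p : Path a b) (q : Path b c) (p' : Path a b')
    (q' : Path b' c) (h : p.comp q = p'.comp q') :
    (∃ s : Path b b', p' = p.comp s ∧ q = s.comp q') ∨
      ∃ s : Path b' b, p = p'.comp s ∧ q' = s.comp q := by
  induction q with
  | nil => exact Or.inr ⟨q', h, rfl⟩
  | @cons d c q e ih =>
    cases q' with
    | nil => exact Or.inl ⟨q.cons e, h.symm, rfl⟩
    | @cons d' _ q' e' =>
      simp only [Path.comp_cons, Path.cons.injEq] at h
      obtain ⟨rfl, h, he⟩ := h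
      obtain rfl := eq_of_heq he
      obtain ⟨s, h₁, h₂⟩ | ⟨s, h₁, h₂⟩ := ih q' (eq_of_heq h)
      · exact Or.inl ⟨s, h₁, by rw [h₂, Path.comp_cons]⟩
      · exact Or.inr ⟨s, h₁, by rw [h₂, Path.comp_cons]⟩

/-- A cut of a path at a vertex lies on one side of any given arrow `e` of the path. This is
comparability between a vertex and an inner point of a thread, which takes the place of the arrow
`e`. -/
theorem comp_eq_cons_comp {a b b' c d : V} (p : Path a b) (q : Path b c) (p' : Path a b')
    (e : b' ⟶ d) (q' : Path d c) (h : p.comp q = (p'.cons e).comp q') :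
    (∃ s : Path b b', p' = p.comp s ∧ q = (s.cons e).comp q') ∨
      ∃ s : Path d b, p = (p'.cons e).comp s ∧ q' = s.comp q := by
  obtain ⟨s, h₁, h₂⟩ | h := comp_eq_comp p q (p'.cons e) q' h
  · cases s with
    | nil => exact Or.inr ⟨.nil, h₁.symm, by simpa using h₂.symm⟩
    | cons s e' =>
      simp only [Path.comp_cons, Path.cons.injEq] at h₁
      obtain ⟨rfl, h₁, he⟩ := h₁
      obtain rfl := eq_of_heq he
      exact Or.inl ⟨s, eq_of_heq h₁, h₂⟩
  · exact Or.inr h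

/-- Two marked arrows of one path follow each other or coincide. For two inner points, the last
alternative means that they lie on the same passage of one thread. -/
theorem cons_comp_eq_cons_comp {a b b' c d d' : V} (p : Path a b) (e : b ⟶ d) (q : Path d c)
    (p' : Path a b') (e' : b' ⟶ d') (q' : Path d' c)
    (h : (p.cons e).comp q = (p'.cons e').comp q') :
    (∃ s : Path d b', p' = (p.cons e).comp s ∧ q = (s.cons e').comp q') ∨
      (∃ s : Path d' b, p = (p'.cons e').comp s ∧ q' = (s.cons e).comp q) ∨
      ((⟨b, d, e⟩ : Σ b d : V, b ⟶ d) = ⟨b', d', e'⟩ ∧ HEq p p' ∧ HEq q q') := by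
  obtain ⟨s, h₁, h₂⟩ | ⟨s, h₁, h₂⟩ := comp_eq_cons_comp (p.cons e) q p' e' q' h
  · exact Or.inl ⟨s, h₁, h₂⟩
  · cases s with
    | nil =>
      simp only [Path.comp_nil, Path.cons.injEq, Path.nil_comp] at h₁ h₂
      obtain ⟨rfl, h₁, he⟩ := h₁
      obtain rfl := eq_of_heq he
      exact Or.inr (Or.inr ⟨rfl, h₁, heq_of_eq h₂.symm⟩)
    | cons s e'' =>
      simp only [Path.comp_cons, Path.cons.injEq] at h₁
      obtain ⟨rfl, h₁, he⟩ := h₁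
      obtain rfl := eq_of_heq he
      exact Or.inr (Or.inl ⟨s, eq_of_heq h₁, h₂⟩)

theorem eq_nil_or_eq_toPath_comp {a b : V} (p : Path a b) :
    (∃ h : a = b, p = h ▸ .nil) ∨ ∃ (c : V) (e : a ⟶ c) (q : Path c b), p = e.toPath.comp q := by
  induction p with
  | nil => exact Or.inl ⟨rfl, rfl⟩
  | @cons c d p e ih =>
    right
    obtain ⟨rfl, rfl⟩ | ⟨c', e', q, rfl⟩ := ih
    · exact ⟨_, e, .nil, rfl⟩
    · exact ⟨_, e', q.cons e, rfl⟩

theorem finite_path (hV : WellFounded fun x y : V => Nonempty (x ⟶ y))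
    (hfin : ∀ y : V, Finite (Σ x : V, x ⟶ y)) (x y : V) : Finite (Path x y) := by
  induction y using hV.induction with
  | _ y ih =>
  have (i : Σ w : V, w ⟶ y) : Finite (Path x i.1) := ih i.1 ⟨i.2⟩
  let f : Path x y → Option (Σ i : (Σ w : V, w ⟶ y), Path x i.1) := fun p =>
    match p with
    | .nil => none
    | .cons p e => some ⟨⟨_, e⟩, p⟩
  refine Finite.of_injective f fun p q h => ?_
  cases p with
  | nil => cases q with
    | nil => rfl
    | cons q e => simp [f] at h
  | cons p e => cases q with
    | nil => simp [f] at h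
    | cons q e' =>
      simp only [f, Option.some.injEq] at h
      cases h
      rfl

theorem isEmpty_path_of_hom (hV : WellFounded fun x y : V => Nonempty (x ⟶ y)) {x y : V}
    (e : x ⟶ y) : IsEmpty (Path y x) := by
  refine ⟨fun p => ?_⟩
  have key : ∀ {a b : V} (p : Path a b), Relation.ReflTransGen
      (fun x y : V => Nonempty (x ⟶ y)) a b := fun p => by
    induction p with
    | nil => exact .refl
    | cons p e ih => exact ih.tail ⟨e⟩
  exact hV.transGen.irrefl.irrefl _ (Relation.TransGen.head' ⟨e⟩ (key p))

theorem eq_nil_of_wellFounded (hV : WellFounded fun x y : V => Nonempty (x ⟶ y)) {x : V}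
    (p : Path x x) : p = .nil := by
  obtain ⟨_, h⟩ | ⟨c, e, q, -⟩ := eq_nil_or_eq_toPath_comp p
  · exact h
  · exact ((isEmpty_path_of_hom hV e).false q).elim

end Paths

/-! ## The orders of the threads -/

namespace ThreadOrder

variable (T : Type u) [LinearOrder T]

/-- This is the reason for the shape `ℕ · (T ×ₗ ℤ) · -ℕ`: the order is discrete whatever `T` is, so
intervals bounded by `a` can be cut off by a representable functor. -/
theorem exists_succ (a : ThreadOrder T) (ha : a ≠ top T) : ∃ b, a < b ∧ ∀ c, a < c → b ≤ c := by
  rcases a with n | p | n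
  · refine ⟨Sum.inlₗ (n + 1), Sum.Lex.inl_lt_inl_iff.2 n.lt_succ_self, ?_⟩
    rintro (m | c) h
    · exact Sum.Lex.inl_le_inl_iff.2 (Sum.Lex.inl_lt_inl_iff.1 h)
    · exact Sum.Lex.inl_le_inr _ _
  · refine ⟨Sum.inrₗ (Sum.inlₗ (toLex ((ofLex p).1, (ofLex p).2 + 1))),
      Sum.Lex.inr_lt_inr_iff.2 (Sum.Lex.inl_lt_inl_iff.2 ?_), ?_⟩
    · exact Prod.Lex.lt_iff.2 (Or.inr ⟨rfl, Int.lt_succ _⟩)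
    · rintro (m | q | m) h
      · exact absurd h Sum.Lex.not_inr_lt_inl
      · refine Sum.Lex.inr_le_inr_iff.2 (Sum.Lex.inl_le_inl_iff.2 (Prod.Lex.le_iff.2 ?_))
        obtain h | ⟨h, h'⟩ := Prod.Lex.lt_iff.1
          (Sum.Lex.inl_lt_inl_iff.1 (Sum.Lex.inr_lt_inr_iff.1 h))
        · exact Or.inl h
        · exact Or.inr ⟨h, h'⟩
      · exact Sum.Lex.inr_le_inr_iff.2 (Sum.Lex.inl_le_inr _ _)
  · obtain _ | n := n
    · exact absurd rfl ha
    refine ⟨Sum.inrₗ (Sum.inrₗ (OrderDual.toDual n)), Sum.Lex.inr_lt_inr_iff.2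
      (Sum.Lex.inr_lt_inr_iff.2 (OrderDual.toDual_lt_toDual.2 n.lt_succ_self)), ?_⟩
    rintro (m | q | m) h
    · exact absurd h Sum.Lex.not_inr_lt_inl
    · exact absurd (Sum.Lex.inr_lt_inr_iff.1 h) Sum.Lex.not_inr_lt_inl
    · exact Sum.Lex.inr_le_inr_iff.2 (Sum.Lex.inr_le_inr_iff.2
        (Nat.le_of_lt_succ (OrderDual.toDual_lt_toDual.1
          (Sum.Lex.inr_lt_inr_iff.1 (Sum.Lex.inr_lt_inr_iff.1 h)))))

theorem exists_pred (a : ThreadOrder T) (ha : a ≠ bot T) : ∃ b, b < a ∧ ∀ c, c < a → c ≤ b := by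
  rcases a with n | p | n
  · obtain _ | n := n
    · exact absurd rfl ha
    refine ⟨Sum.inlₗ n, Sum.Lex.inl_lt_inl_iff.2 n.lt_succ_self, ?_⟩
    rintro (m | c) h
    · exact Sum.Lex.inl_le_inl_iff.2 (Nat.le_of_lt_succ (Sum.Lex.inl_lt_inl_iff.1 h))
    · exact absurd h Sum.Lex.not_inr_lt_inl
  · refine ⟨Sum.inrₗ (Sum.inlₗ (toLex ((ofLex p).1, (ofLex p).2 - 1))),
      Sum.Lex.inr_lt_inr_iff.2 (Sum.Lex.inl_lt_inl_iff.2 ?_), ?_⟩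
    · exact Prod.Lex.lt_iff.2 (Or.inr ⟨rfl, Int.pred_self_lt _⟩)
    · rintro (m | q | m) h
      · exact Sum.Lex.inl_le_inr _ _
      · refine Sum.Lex.inr_le_inr_iff.2 (Sum.Lex.inl_le_inl_iff.2 (Prod.Lex.le_iff.2 ?_))
        obtain h | ⟨h, h'⟩ := Prod.Lex.lt_iff.1
          (Sum.Lex.inl_lt_inl_iff.1 (Sum.Lex.inr_lt_inr_iff.1 h))
        · exact Or.inl h
        · exact Or.inr ⟨h, Int.le_sub_one_of_lt h'⟩
      · exact absurd (Sum.Lex.inr_lt_inr_iff.1 h) Sum.Lex.not_inr_lt_inl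
  · refine ⟨Sum.inrₗ (Sum.inrₗ (OrderDual.toDual (OrderDual.ofDual n + 1))),
      Sum.Lex.inr_lt_inr_iff.2 (Sum.Lex.inr_lt_inr_iff.2 (Nat.lt_succ_self (OrderDual.ofDual n))),
      ?_⟩
    rintro (m | q | m) h
    · exact Sum.Lex.inl_le_inr _ _
    · exact Sum.Lex.inr_le_inr_iff.2 (Sum.Lex.inl_le_inr _ _)
    · exact Sum.Lex.inr_le_inr_iff.2 (Sum.Lex.inr_le_inr_iff.2 (Nat.succ_le_of_lt
        (OrderDual.toDual_lt_toDual.1 (Sum.Lex.inr_lt_inr_iff.1 (Sum.Lex.inr_lt_inr_iff.1 h)))))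

/-- The order without its extremal elements. -/
abbrev Inner : Type u := {a : ThreadOrder T // a ≠ bot T ∧ a ≠ top T}

theorem exists_least : ∃ b : Inner T, ∀ a : Inner T, b ≤ a := by
  refine ⟨⟨Sum.inlₗ 1, fun h => ?_, fun h => ?_⟩, fun ⟨a, ha, _⟩ => ?_⟩
  · exact absurd (Sum.inl_injective h) one_ne_zero
  · exact absurd h Sum.inl_ne_inr
  · rcases a with (_ | n) | a
    · exact absurd rfl ha
    · exact Sum.Lex.inl_le_inl_iff.2 (Nat.succ_le_succ n.zero_le)
    · exact Sum.Lex.inl_le_inr _ _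

theorem exists_greatest : ∃ b : Inner T, ∀ a : Inner T, a ≤ b := by
  refine ⟨⟨Sum.inrₗ (Sum.inrₗ (OrderDual.toDual 1)), fun h => ?_, fun h => ?_⟩,
    fun ⟨a, _, ha⟩ => ?_⟩
  · exact absurd h Sum.inr_ne_inl
  · exact absurd (Sum.inr_injective (Sum.inr_injective h)) one_ne_zero
  · rcases a with a | a | (_ | n)
    · exact Sum.Lex.inl_le_inr _ _
    · exact Sum.Lex.inr_le_inr_iff.2 (Sum.Lex.inl_le_inr _ _)
    · exact absurd rfl ha
    · exact Sum.Lex.inr_le_inr_iff.2 (Sum.Lex.inr_le_inr_iff.2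
        (OrderDual.toDual_le_toDual.2 (Nat.succ_le_succ n.zero_le)))

variable {T}

theorem Inner.exists_succ (a : Inner T) :
    (∀ d : Inner T, d ≤ a) ∨ ∃ b : Inner T, a < b ∧ ∀ d : Inner T, a < d → b ≤ d := by
  obtain ⟨b, hab, hb⟩ := ThreadOrder.exists_succ T a.1 a.2.2
  by_cases h : b = top T
  · subst h
    exact Or.inl fun d => not_lt.1 fun hd => d.2.2 (le_antisymm (le_top T d.1) (hb d.1 hd))
  · exact Or.inr ⟨⟨b, fun h' => (bot_le T a.1).not_gt (h' ▸ hab), h⟩, hab, fun d => hb d.1⟩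

theorem Inner.exists_pred (a : Inner T) :
    (∀ d : Inner T, a ≤ d) ∨ ∃ b : Inner T, b < a ∧ ∀ d : Inner T, d < a → d ≤ b := by
  obtain ⟨b, hab, hb⟩ := ThreadOrder.exists_pred T a.1 a.2.1
  by_cases h : b = bot T
  · subst h
    exact Or.inl fun d => not_lt.1 fun hd => d.2.1 (le_antisymm (hb d.1 hd) (bot_le T d.1))
  · exact Or.inr ⟨⟨b, h, fun h' => (le_top T a.1).not_gt (h' ▸ hab)⟩, hab, fun d => hb d.1⟩

/-- The least element of the interior. -/
def Inner.least (T : Type u) [LinearOrder T] : Inner T := (exists_least T).choose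

theorem Inner.least_le (a : Inner T) : least T ≤ a := (exists_least T).choose_spec a

/-- The greatest element of the interior. -/
def Inner.greatest (T : Type u) [LinearOrder T] : Inner T := (exists_greatest T).choose

theorem Inner.le_greatest (a : Inner T) : a ≤ greatest T := (exists_greatest T).choose_spec a

end ThreadOrder

/-! ## The category of paths in a thread quiver -/

namespace ThreadQuiver

open Quiver ThreadOrder

variable (Q : ThreadQuiver.{u})

/-- The points in the interior of a thread. -/
abbrev Interior (t : Q.Thread) : Type u := ThreadOrder.Inner (Q.label t.2.2)

/-- The points of a thread quiver: vertices, and points in the interior of threads. -/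
inductive Point : Type u
  | vertex (x : Q.Underlying) : Point
  | inner (t : Q.Thread) (a : Q.Interior t) : Point

namespace Point

variable {Q}

/-- The first vertex on a path that starts at a given point. -/
def exit : Q.Point → Q.Underlying
  | vertex x => x
  | inner t _ => t.2.1

/-- The last vertex on a path that ends at a given point. -/
def entry : Q.Point → Q.Underlying
  | vertex x => x
  | inner t _ => t.1

/-- The arrow of a thread. -/
def arrow (t : Q.Thread) : (show Q.Underlying from t.1) ⟶ (show Q.Underlying from t.2.1) :=
  Sum.inr t.2.2

/-- The path from the entry to the exit of a point. -/
def passage : ∀ X : Q.Point, Path (entry X) (exit X)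
  | vertex _ => .nil
  | inner t _ => (arrow t).toPath

/-- A path from `X` to `Y` either passes through vertices, and it is then determined by the path
in `Q_r` between its first and its last vertex, or it stays in the interior of a thread. -/
inductive Hom : Q.Point → Q.Point → Type u
  | path {X Y : Q.Point} (p : Path (exit X) (entry Y)) : Hom X Y
  | le {t : Q.Thread} {a b : Q.Interior t} (h : a ≤ b) : Hom (inner t a) (inner t b)

/-- The identity path. -/
def Hom.id : ∀ X : Q.Point, Hom X X
  | vertex _ => .path .nil
  | inner _ _ => .le le_rfl

/-- The composition of paths. -/
def Hom.comp : ∀ {X Y Z : Q.Point}, Hom X Y → Hom Y Z → Hom X Z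
  -- At a vertex nothing is inserted; at an inner point the path crosses the thread of `Y`. A move
  -- inside a thread leaves the path unchanged in the next two cases.
  | _, Y, _, .path p, .path q => .path ((p.comp (passage Y)).comp q)
  | _, _, _, .path p, .le _ => .path p
  | _, _, _, .le _, .path q => .path q
  | _, _, _, .le h, .le h' => .le (h.trans h')

instance : Category.{u} Q.Point where
  Hom := Hom
  id := Hom.id
  comp := Hom.comp
  id_comp {X Y} f := by
    cases X <;> cases f
    · exact congrArg Hom.path ((congrArg (Path.comp · _) (Path.nil_comp .nil)).trans
        (Path.nil_comp _))
    · rfl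
    · rfl
  comp_id {X Y} f := by
    cases Y <;> cases f <;> rfl
  assoc f g h := by
    cases f <;> cases g <;> cases h
    · exact congrArg Hom.path (by simp only [Path.comp_assoc])
    · rfl
    · rfl
    · rfl
    · rfl
    · rfl
    · rfl
    · rfl

/-- The morphism given by a path in `Q_r`. -/
def ofPath {X Y : Q.Point} (p : Path (exit X) (entry Y)) : X ⟶ Y := Hom.path p

/-- The morphism between points of the same thread. -/
def ofLE {t : Q.Thread} {a b : Q.Interior t} (h : a ≤ b) : inner t a ⟶ inner t b := Hom.le h

theorem ofPath_injective {X Y : Q.Point} : Function.Injective (ofPath (X := X) (Y := Y)) :=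
  fun _ _ h => Hom.path.inj h

theorem arrow_sigma_injective {t t' : Q.Thread}
    (h : (⟨t.1, t.2.1, arrow t⟩ : Σ x y : Q.Underlying, x ⟶ y) = ⟨t'.1, t'.2.1, arrow t'⟩) :
    t = t' := by
  obtain ⟨x, y, a⟩ := t
  obtain ⟨x', y', a'⟩ := t'
  obtain ⟨h₁, h⟩ := Sigma.mk.inj h
  cases h₁
  obtain ⟨h₁, h⟩ := Sigma.mk.inj (eq_of_heq h)
  cases h₁
  cases Sum.inr_injective (eq_of_heq h)
  rfl

/-- Two factorizations into morphisms that pass through vertices are comparable. -/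
theorem comparable_of_path {Z X V Y : Q.Point} (q : Path (exit Z) (entry X))
    (r : Path (exit X) (entry Y)) (p : Path (exit Z) (entry V)) (w : Path (exit V) (entry Y))
    (h : (q.comp (passage X)).comp r = (p.comp (passage V)).comp w) :
    (∃ s : V ⟶ X, ofPath p ≫ s = ofPath q ∧ s ≫ ofPath r = ofPath w) ∨
      ∃ s : X ⟶ V, ofPath q ≫ s = ofPath p ∧ s ≫ ofPath w = ofPath r := by
  have h' := h
  rcases X with x | ⟨t, a⟩ <;> rcases V with v | ⟨t', b⟩
  · obtain ⟨s, h₁, h₂⟩ | ⟨s, h₁, h₂⟩ := comp_eq_comp q r p w h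
    · exact Or.inr ⟨ofPath s, congrArg ofPath h₁.symm, congrArg ofPath h₂.symm⟩
    · exact Or.inl ⟨ofPath s, congrArg ofPath h₁.symm, congrArg ofPath h₂.symm⟩
  · obtain ⟨s, h₁, h₂⟩ | ⟨s, h₁, h₂⟩ := comp_eq_cons_comp q r p (arrow t') w h
    · exact Or.inr ⟨ofPath s, congrArg ofPath h₁.symm, congrArg ofPath h₂.symm⟩
    · exact Or.inl ⟨ofPath s, congrArg ofPath h₁.symm, congrArg ofPath h₂.symm⟩
  · obtain ⟨s, h₁, h₂⟩ | ⟨s, h₁, h₂⟩ := comp_eq_cons_comp p w q (arrow t) r h.symm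
    · exact Or.inl ⟨ofPath s, congrArg ofPath h₁.symm, congrArg ofPath h₂.symm⟩
    · exact Or.inr ⟨ofPath s, congrArg ofPath h₁.symm, congrArg ofPath h₂.symm⟩
  · obtain ⟨s, h₁, h₂⟩ | ⟨s, h₁, h₂⟩ | ⟨h₁, h₂, h₃⟩ :=
      cons_comp_eq_cons_comp q (arrow t) r p (arrow t') w h
    · exact Or.inr ⟨ofPath s, congrArg ofPath h₁.symm, congrArg ofPath h₂.symm⟩
    · exact Or.inl ⟨ofPath s, congrArg ofPath h₁.symm, congrArg ofPath h₂.symm⟩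
    · obtain rfl := arrow_sigma_injective h₁
      obtain rfl := eq_of_heq h₂
      obtain rfl := eq_of_heq h₃
      obtain h | h := le_total a b
      · exact Or.inr ⟨ofLE h, rfl, rfl⟩
      · exact Or.inl ⟨ofLE h, rfl, rfl⟩

/-- Factors `le` do not change paths. If one occurs, the equation either identifies one factor with
a composite, so that a given path compares `X` and `V`, or places `X` and `V` on one thread, whose
order is linear. -/
theorem Hom.comparable {Z X V Y : Q.Point} (q : Hom Z X) (r : Hom X Y) (p : Hom Z V)
    (w : Hom V Y) (h : q.comp r = p.comp w) :
    (∃ s : Hom V X, p.comp s = q ∧ s.comp r = w) ∨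
      ∃ s : Hom X V, q.comp s = p ∧ s.comp w = r := by
  match Z, X, V, Y, q, r, p, w, h with
  | _, _, _, _, Hom.path q, Hom.path r, Hom.path p, Hom.path w, h =>
    exact comparable_of_path q r p w (ofPath_injective h)
  | _, _, _, _, Hom.path q, Hom.path r, Hom.path p, Hom.le _, h =>
    have h := ofPath_injective h
    exact Or.inr ⟨ofPath r, congrArg Hom.path h, rfl⟩
  | _, _, _, _, Hom.path q, Hom.path r, Hom.le _, Hom.path w, h =>
    have h := ofPath_injective h
    exact Or.inl ⟨ofPath q, rfl, congrArg Hom.path h⟩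
  | _, _, _, _, Hom.path q, Hom.le _, Hom.path p, Hom.path w, h =>
    have h := ofPath_injective h.symm
    exact Or.inl ⟨ofPath w, congrArg Hom.path h, rfl⟩
  | _, inner _ a, inner _ b, _, Hom.path q, Hom.le _, Hom.path p, Hom.le _, h =>
    obtain rfl := ofPath_injective h
    obtain h | h := le_total a b
    · exact Or.inr ⟨ofLE h, rfl, rfl⟩
    · exact Or.inl ⟨ofLE h, rfl, rfl⟩
  | _, _, _, _, Hom.path q, Hom.le _, Hom.le _, Hom.path w, h =>
    have h := ofPath_injective h
    exact Or.inl ⟨ofPath q, rfl, congrArg Hom.path h⟩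
  | _, _, _, _, Hom.le _, Hom.path r, Hom.path p, Hom.path w, h =>
    have h := ofPath_injective h.symm
    exact Or.inr ⟨ofPath p, rfl, congrArg Hom.path h⟩
  | _, _, _, _, Hom.le _, Hom.path r, Hom.path p, Hom.le _, h =>
    have h := ofPath_injective h.symm
    exact Or.inr ⟨ofPath p, rfl, congrArg Hom.path h⟩
  | _, inner _ a, inner _ b, _, Hom.le _, Hom.path r, Hom.le _, Hom.path w, h =>
    obtain rfl := ofPath_injective h
    obtain h | h := le_total a b
    · exact Or.inr ⟨ofLE h, rfl, rfl⟩
    · exact Or.inl ⟨ofLE h, rfl, rfl⟩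
  | _, inner _ a, inner _ b, _, Hom.le _, Hom.le _, Hom.le _, Hom.le _, _ =>
    obtain h | h := le_total a b
    · exact Or.inr ⟨ofLE h, rfl, rfl⟩
    · exact Or.inl ⟨ofLE h, rfl, rfl⟩

variable (hV : WellFounded fun x y : Q.Underlying => Nonempty (x ⟶ y))
include hV

theorem Hom.eq_id : ∀ {X : Q.Point} (f : Hom X X), f = Hom.id X
  | vertex _, .path p => congrArg Hom.path (eq_nil_of_wellFounded hV p)
  | inner t _, .path p => ((isEmpty_path_of_hom hV (arrow t)).false p).elim
  | inner _ _, .le _ => rfl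

theorem isEquidivisible : IsEquidivisible Q.Point where
  eq_id f := Hom.eq_id hV f
  comparable q r p w h := Hom.comparable q r p w h

theorem finite_hom (hfin : ∀ y : Q.Underlying, Finite (Σ x : Q.Underlying, x ⟶ y))
    (X Y : Q.Point) : Finite (X ⟶ Y) := by
  have := finite_path hV hfin (exit X) (entry Y)
  let f : Hom X Y → Option (Path (exit X) (entry Y)) := fun g =>
    match g with
    | .path p => some p
    | .le _ => none
  refine Finite.of_injective (α := Hom X Y) f fun g g' h => ?_
  cases g with
  | path p => cases g' with
    | path p' => exact congrArg Hom.path (Option.some.inj h)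
    | le _ => exact (Option.some_ne_none _ h).elim
  | le _ => cases g' with
    | path p' => exact (Option.some_ne_none _ h.symm).elim
    | le _ => rfl

end Point

end ThreadQuiver

namespace ThreadQuiver

open Quiver ThreadOrder

/-! ### Recovering the first or the last arrow of a path. -/

theorem cons_inj {V : Type*} [Quiver V] {a b b' c : V} {p : Path a b} {e : b ⟶ c}
    {p' : Path a b'} {e' : b' ⟶ c} (h : p.cons e = p'.cons e') :
    (⟨b, e⟩ : Σ b : V, b ⟶ c) = ⟨b', e'⟩ := by
  cases h
  rfl

theorem toPath_comp_inj {V : Type*} [Quiver V] {a b b' c : V} {e : a ⟶ b} {p : Path b c}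
    {e' : a ⟶ b'} {p' : Path b' c} (h : e.toPath.comp p = e'.toPath.comp p') :
    (⟨b, e⟩ : Σ b : V, a ⟶ b) = ⟨b', e'⟩ := by
  induction p with
  | nil => cases p' with
    | nil => cases h; rfl
    | cons p' f =>
      have := congrArg Path.length h
      simp [Path.length_comp] at this
  | cons p f ih => cases p' with
    | nil =>
      have := congrArg Path.length h
      simp [Path.length_comp] at this
    | cons p' f' =>
      simp only [Path.comp_cons, Path.cons.injEq] at h
      obtain ⟨rfl, h, -⟩ := h
      exact ih (eq_of_heq h)

theorem toPath_comp_ne_nil {V : Type*} [Quiver V] {a b : V} (e : a ⟶ b) (p : Path b a) :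
    e.toPath.comp p ≠ .nil := by
  intro h
  have := congrArg Path.length h
  simp [Path.length_comp] at this

variable {Q : ThreadQuiver.{u}}


namespace Point

/-! ### Predecessors and successors of vertices -/

/-- The immediate predecessors of a vertex. -/
def pred {x : Q.Underlying} : (Σ w : Q.Underlying, w ⟶ x) → Q.Point
  | ⟨w, .inl _⟩ => vertex w
  | ⟨w, .inr t⟩ => inner ⟨w, x, t⟩ (Inner.greatest _)

/-- The morphism from an immediate predecessor. -/
def predHom {x : Q.Underlying} : ∀ i : Σ w : Q.Underlying, w ⟶ x, Hom (pred i) (vertex x)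
  | ⟨w, .inl e⟩ => .path (X := vertex w) (Quiver.Hom.toPath (V := Q.Underlying) (Sum.inl e))
  | ⟨w, .inr t⟩ => .path (X := inner ⟨w, x, t⟩ _) .nil

/-- The immediate successors of a vertex. -/
def succ {x : Q.Underlying} : (Σ y : Q.Underlying, x ⟶ y) → Q.Point
  | ⟨y, .inl _⟩ => vertex y
  | ⟨y, .inr t⟩ => inner ⟨x, y, t⟩ (Inner.least _)

/-- The morphism to an immediate successor. -/
def succHom {x : Q.Underlying} : ∀ i : Σ y : Q.Underlying, x ⟶ y, Hom (vertex x) (succ i)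
  | ⟨y, .inl e⟩ => .path (Y := vertex y) (Quiver.Hom.toPath (V := Q.Underlying) (Sum.inl e))
  | ⟨y, .inr t⟩ => .path (Y := inner ⟨x, y, t⟩ _) .nil

theorem Hom.eq_or_eq_path : ∀ {t t' : Q.Thread} {a : Q.Interior t} {b : Q.Interior t'}
    (s : Hom (inner t a) (inner t' b)), t = t' ∨ ∃ p, s = .path p
  | _, _, _, _, .path p => Or.inr ⟨p, rfl⟩
  | _, _, _, _, .le _ => Or.inl rfl

/-- The last arrow of a path recovers a standard predecessor. A thread predecessor has the empty
path, which no nonempty path can equal, so two of them are related only inside one thread. -/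
theorem predHom_inj {x : Q.Underlying} (i j : Σ w : Q.Underlying, w ⟶ x)
    (s : Hom (pred i) (pred j)) (h : s.comp (predHom j) = predHom i) : i = j := by
  obtain ⟨w, e | t⟩ := i <;> obtain ⟨w', e' | t'⟩ := j
  · cases s with
    | path p => exact (cons_inj (Hom.path.inj h)).symm
  · cases s with
    | path p => exact (cons_inj (Hom.path.inj h)).symm
  · cases s with
    | path p => exact (Path.cons_ne_nil _ _ (Hom.path.inj h)).elim
  · obtain h' | ⟨p, rfl⟩ := Hom.eq_or_eq_path (t := ⟨w, x, t⟩) (t' := ⟨w', x, t'⟩) s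
    · cases h'
      rfl
    · exact (Path.cons_ne_nil _ _ (Hom.path.inj h)).elim

theorem predHom_ne_id {x : Q.Underlying} (i : Σ w : Q.Underlying, w ⟶ x)
    (s : Hom (vertex x) (pred i)) : s.comp (predHom i) ≠ Hom.id _ := by
  intro h
  obtain ⟨w, e | t⟩ := i <;> cases s with
    | path p => exact Path.cons_ne_nil _ _ (Hom.path.inj h)

/-- Strip off the last arrow. If the path is empty, then `Z` is the vertex itself or an inner point
of a thread ending there, which lies below the greatest inner point. -/
theorem exists_comp_predHom {x : Q.Underlying} {Z : Q.Point} (q : Hom Z (vertex x)) :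
    (∃ i, ∃ r : Hom Z (pred i), r.comp (predHom i) = q) ∨
      ∃ s : Hom (vertex x) Z, s.comp q = Hom.id _ ∧ q.comp s = Hom.id _ := by
  cases q with
  | path p =>
  change Path (exit Z) x at p
  cases p with
  | nil =>
    rcases Z with x | ⟨⟨w, y, t⟩, a⟩
    · exact Or.inr ⟨.path .nil, rfl, rfl⟩
    · exact Or.inl ⟨⟨w, .inr t⟩, .le (Inner.le_greatest a), rfl⟩
  | @cons w _ p e =>
    rcases e with e | t
    · exact Or.inl ⟨⟨w, .inl e⟩, .path (Y := vertex w) p, rfl⟩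
    · exact Or.inl ⟨⟨w, .inr t⟩, .path (Y := inner ⟨w, x, t⟩ _) p, rfl⟩

theorem succHom_inj {x : Q.Underlying} (i j : Σ y : Q.Underlying, x ⟶ y)
    (s : Hom (succ j) (succ i)) (h : (succHom j).comp s = succHom i) : i = j := by
  obtain ⟨y, e | t⟩ := i <;> obtain ⟨y', e' | t'⟩ := j
  · cases s with
    | path p => exact (toPath_comp_inj (p' := .nil) (Hom.path.inj h)).symm
  · cases s with
    | path p => exact (toPath_comp_inj (p' := .nil) (Hom.path.inj h)).symm
  · cases s with
    | path p => exact (toPath_comp_ne_nil _ _ (Hom.path.inj h)).elim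
  · obtain h' | ⟨p, rfl⟩ := Hom.eq_or_eq_path (t := ⟨x, y', t'⟩) (t' := ⟨x, y, t⟩) s
    · cases h'
      rfl
    · exact (toPath_comp_ne_nil _ _ (Hom.path.inj h)).elim

theorem succHom_ne_id {x : Q.Underlying} (i : Σ y : Q.Underlying, x ⟶ y)
    (s : Hom (succ i) (vertex x)) : (succHom i).comp s ≠ Hom.id _ := by
  intro h
  obtain ⟨w, e | t⟩ := i <;> cases s with
    | path p => exact toPath_comp_ne_nil _ _ (Hom.path.inj h)

theorem exists_succHom_comp {x : Q.Underlying} {Z : Q.Point} (q : Hom (vertex x) Z) :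
    (∃ i, ∃ r : Hom (succ i) Z, (succHom i).comp r = q) ∨
      ∃ s : Hom Z (vertex x), q.comp s = Hom.id _ ∧ s.comp q = Hom.id _ := by
  cases q with
  | path p =>
  change Path x (entry Z) at p
  obtain ⟨h, hp⟩ | ⟨y, e | t, p, rfl⟩ := eq_nil_or_eq_toPath_comp p
  · rcases Z with z | ⟨⟨w, y, t⟩, a⟩
    · cases h
      cases hp
      exact Or.inr ⟨.path .nil, rfl, rfl⟩
    · cases h
      cases hp
      exact Or.inl ⟨⟨y, .inr t⟩, .le (Inner.least_le a), rfl⟩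
  · exact Or.inl ⟨⟨y, .inl e⟩, .path (X := vertex y) p, rfl⟩
  · exact Or.inl ⟨⟨y, .inr t⟩, .path (X := inner ⟨x, y, t⟩ _) p, rfl⟩

/-! ### Filtrations -/

/-- Here `U` is the vertex and `u` its identity: modulo the predecessors the representable functor
becomes the simple functor at `x`, whose dual is presented by the immediate successors. -/
theorem hasDualFiltration_vertex {x : Q.Underlying} [Finite (Σ w : Q.Underlying, w ⟶ x)]
    [Finite (Σ y : Q.Underlying, x ⟶ y)]
    (h : ∀ i : Σ w : Q.Underlying, w ⟶ x, HasDualFiltration (pred i)) :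
    HasDualFiltration (vertex x) := by
  refine .intro (U := vertex x) pred succ predHom (𝟙 _) succHom predHom_inj predHom_ne_id
    succHom_ne_id (fun q => ?_) (fun s => ?_) h
  · obtain h | ⟨s, h, -⟩ := exists_comp_predHom q
    · exact Or.inl h
    · exact Or.inr ⟨s, h⟩
  · obtain h | ⟨q, h, -⟩ := exists_succHom_comp s
    · exact Or.inl h
    · exact Or.inr ⟨q, h⟩

theorem hasDualFiltration_op_vertex {x : Q.Underlying} [Finite (Σ w : Q.Underlying, w ⟶ x)]
    [Finite (Σ y : Q.Underlying, x ⟶ y)]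
    (h : ∀ i : Σ y : Q.Underlying, x ⟶ y, HasDualFiltration (op (succ i))) :
    HasDualFiltration (op (vertex x)) := by
  refine .intro (U := op (vertex x)) (fun i => op (succ i)) (fun i => op (pred i))
    (fun i => Quiver.Hom.op (succHom i)) (𝟙 _) (fun i => Quiver.Hom.op (predHom i)) ?_ ?_ ?_
    (fun q => ?_) (fun s => ?_) h
  · exact fun i j s h => succHom_inj i j s.unop (congrArg Quiver.Hom.unop h)
  · exact fun i s h => succHom_ne_id i s.unop (congrArg Quiver.Hom.unop h)
  · exact fun i s h => predHom_ne_id i s.unop (congrArg Quiver.Hom.unop h)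
  · obtain ⟨i, r, h⟩ | ⟨s, h, -⟩ := exists_succHom_comp q.unop
    · exact Or.inl ⟨i, Quiver.Hom.op r, congrArg Quiver.Hom.op h⟩
    · exact Or.inr ⟨Quiver.Hom.op s, congrArg Quiver.Hom.op h⟩
  · obtain ⟨i, r, h⟩ | ⟨s, h, -⟩ := exists_comp_predHom s.unop
    · exact Or.inl ⟨i, Quiver.Hom.op r, congrArg Quiver.Hom.op h⟩
    · exact Or.inr ⟨Quiver.Hom.op s, congrArg Quiver.Hom.op h⟩

/-- The first vertex of a thread, as a morphism to an interior point. -/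
def source (t : Q.Thread) (a : Q.Interior t) : Hom (vertex t.1) (inner t a) :=
  .path (X := vertex t.1) .nil

/-- The last vertex of a thread, as a morphism from an interior point. -/
def target (t : Q.Thread) (a : Q.Interior t) : Hom (inner t a) (vertex t.2.1) :=
  .path (Y := vertex t.2.1) .nil

theorem comp_source_ne_le {t : Q.Thread} {a b : Q.Interior t} (h : b ≤ a)
    (s : Hom (inner t b) (vertex t.1)) : s.comp (source t a) ≠ .le h := by
  cases s
  exact fun h => Hom.noConfusion rfl (heq_of_eq rfl) (heq_of_eq rfl) (heq_of_eq h)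

theorem target_comp_ne_le {t : Q.Thread} {a b : Q.Interior t} (h : a ≤ b)
    (s : Hom (vertex t.2.1) (inner t b)) : (target t a).comp s ≠ .le h := by
  cases s
  exact fun h => Hom.noConfusion rfl (heq_of_eq rfl) (heq_of_eq rfl) (heq_of_eq h)

theorem le_comp_ne_le {t : Q.Thread} {a b c : Q.Interior t} (h : a ≤ b) (h' : a ≤ c)
    (hbc : ¬ b ≤ c) (s : Hom (inner t b) (inner t c)) : (Hom.le h).comp s ≠ .le h' := by
  cases s with
  | path p => exact fun h => Hom.noConfusion rfl (heq_of_eq rfl) (heq_of_eq rfl) (heq_of_eq h)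
  | le h => exact (hbc h).elim

theorem comp_le_ne_le {t : Q.Thread} {a b c : Q.Interior t} (h : b ≤ c) (h' : a ≤ c)
    (hab : ¬ a ≤ b) (s : Hom (inner t a) (inner t b)) : s.comp (Hom.le h) ≠ .le h' := by
  cases s with
  | path p => exact fun h => Hom.noConfusion rfl (heq_of_eq rfl) (heq_of_eq rfl) (heq_of_eq h)
  | le h => exact (hab h).elim

/-- Modulo the morphisms through the start of the thread, what remains is the interval from the
least inner point to `a`. Its dual is generated at the least inner point, with one relation: the
successor of `a`, or the end of the thread if `a` is the greatest inner point. -/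
theorem hasDualFiltration_inner {t : Q.Thread} (h : HasDualFiltration (vertex (Q := Q) t.1))
    (a : Q.Interior t) : HasDualFiltration (inner t a) := by
  have factor {Z : Q.Point} (q : Hom Z (inner t a)) :
      (∃ _ : PUnit.{u + 1}, ∃ r : Hom Z (vertex t.1), r.comp (source t a) = q) ∨
        ∃ s : Hom (inner t (Inner.least _)) Z, s.comp q = .le (Inner.least_le a) := by
    cases q with
    | path p => exact Or.inl ⟨⟨⟩, .path (Y := vertex t.1) p, rfl⟩
    | le h => exact Or.inr ⟨.le (Inner.least_le _), rfl⟩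
  obtain ha | ⟨d, had, hd⟩ := Inner.exists_succ a
  · refine .intro (U := inner t (Inner.least _)) (I := PUnit) (J := PUnit) (fun _ => vertex t.1)
      (fun _ => vertex t.2.1) (fun _ => source t a) (ofLE (Inner.least_le a))
      (fun _ => target t _) (fun _ _ _ _ => rfl) (fun _ s => comp_source_ne_le _ s)
      (fun _ s => target_comp_ne_le _ s) factor (fun {Z} s => ?_) (fun _ => h)
    change Hom _ _ at s
    cases s with
    | path p =>
      exact Or.inl ⟨⟨⟩, Hom.path (X := vertex t.2.1) p, congrArg Hom.path (Path.nil_comp p)⟩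
    | le h => exact Or.inr ⟨ofLE (ha _), rfl⟩
  · refine .intro (U := inner t (Inner.least _)) (I := PUnit) (J := PUnit) (fun _ => vertex t.1)
      (fun _ => inner t d) (fun _ => source t a) (ofLE (Inner.least_le a))
      (fun _ => ofLE (Inner.least_le d)) (fun _ _ _ _ => rfl) (fun _ s => comp_source_ne_le _ s)
      (fun _ s => le_comp_ne_le _ _ had.not_ge s) factor (fun {Z} s => ?_) (fun _ => h)
    change Hom _ _ at s
    cases s with
    | path p => exact Or.inl ⟨⟨⟩, Hom.path (X := inner t d) p, rfl⟩
    | @le _ _ b h =>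
      obtain hb | hb := le_or_gt b a
      · exact Or.inr ⟨ofLE hb, rfl⟩
      · exact Or.inl ⟨⟨⟩, ofLE (hd b hb), rfl⟩

theorem hasDualFiltration_op_inner {t : Q.Thread}
    (h : HasDualFiltration (op (vertex (Q := Q) t.2.1)))
    (a : Q.Interior t) : HasDualFiltration (op (inner t a)) := by
  have factor {Z : Q.Pointᵒᵖ} (q : Z ⟶ op (inner t a)) :
      (∃ _ : PUnit.{u + 1}, ∃ r : Z ⟶ op (vertex t.2.1),
        r ≫ Quiver.Hom.op (target t a : inner t a ⟶ vertex t.2.1) = q) ∨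
        ∃ s : op (inner t (Inner.greatest _)) ⟶ Z, s ≫ q = (ofLE (Inner.le_greatest a)).op := by
    obtain ⟨Z⟩ := Z
    obtain ⟨q⟩ := q
    change Hom (inner t a) Z at q
    cases q with
    | path p =>
      exact Or.inl ⟨⟨⟩, Quiver.Hom.op (Hom.path (X := vertex t.2.1) p),
        congrArg (fun p => Quiver.Hom.op (ofPath p)) (Path.nil_comp p)⟩
    | le h => exact Or.inr ⟨Quiver.Hom.op (ofLE (Inner.le_greatest _)), rfl⟩
  obtain ha | ⟨d, had, hd⟩ := Inner.exists_pred a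
  · refine .intro (U := op (inner t (Inner.greatest _))) (I := PUnit) (J := PUnit)
      (fun _ => op (vertex t.2.1)) (fun _ => op (vertex t.1))
      (fun _ => Quiver.Hom.op (target t a)) (ofLE (Inner.le_greatest a)).op
      (fun _ => Quiver.Hom.op (source t _)) (fun _ _ _ _ => rfl)
      (fun _ s h => target_comp_ne_le _ s.unop (congrArg Quiver.Hom.unop h))
      (fun _ s h => comp_source_ne_le _ s.unop (congrArg Quiver.Hom.unop h)) factor
      (fun {Z} s => ?_) (fun _ => h)
    obtain ⟨Z⟩ := Z
    obtain ⟨s⟩ := s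
    change Hom _ _ at s
    cases s with
    | path p => exact Or.inl ⟨⟨⟩, Quiver.Hom.op (Hom.path (Y := vertex t.1) p), rfl⟩
    | le h => exact Or.inr ⟨Quiver.Hom.op (ofLE (ha _)), rfl⟩
  · refine .intro (U := op (inner t (Inner.greatest _))) (I := PUnit) (J := PUnit)
      (fun _ => op (vertex t.2.1)) (fun _ => op (inner t d))
      (fun _ => Quiver.Hom.op (target t a)) (ofLE (Inner.le_greatest a)).op
      (fun _ => Quiver.Hom.op (ofLE (Inner.le_greatest d))) (fun _ _ _ _ => rfl)
      (fun _ s h => target_comp_ne_le _ s.unop (congrArg Quiver.Hom.unop h))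
      (fun _ s h => comp_le_ne_le _ _ had.not_ge s.unop (congrArg Quiver.Hom.unop h)) factor
      (fun {Z} s => ?_) (fun _ => h)
    obtain ⟨Z⟩ := Z
    obtain ⟨s⟩ := s
    change Hom _ _ at s
    cases s with
    | path p => exact Or.inl ⟨⟨⟩, Quiver.Hom.op (Hom.path (Y := inner t d) p), rfl⟩
    | @le _ b _ h =>
      obtain hb | hb := le_or_gt a b
      · exact Or.inr ⟨Quiver.Hom.op (ofLE hb), rfl⟩
      · exact Or.inl ⟨⟨⟩, Quiver.Hom.op (ofLE (hd b hb)), rfl⟩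

end Point

/-! ### Induction along the arrows of `Q_r`. -/

namespace IsStronglyLocallyFinite

variable (hQ : Q.IsStronglyLocallyFinite)
include hQ

theorem wellFounded : WellFounded fun x y : Q.Underlying => Nonempty (x ⟶ y) :=
  wellFounded_iff_isEmpty_descending_chain.2
    ⟨fun ⟨v, hv⟩ => (hQ.no_infinite_path' v).false fun n => (hv n).some⟩

theorem wellFounded' : WellFounded fun x y : Q.Underlying => Nonempty (y ⟶ x) :=
  wellFounded_iff_isEmpty_descending_chain.2
    ⟨fun ⟨v, hv⟩ => (hQ.no_infinite_path v).false fun n => (hv n).some⟩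

/-- A standard arrow into `x` leads to an earlier vertex, and a thread arrow leads to an inner point
whose filtration rests on the start of the thread, again an earlier vertex. No infinite path runs
backwards, so the recursion ends. -/
theorem hasDualFiltration (X : Q.Point) : HasDualFiltration X := by
  have key (x : Q.Underlying) : HasDualFiltration (Point.vertex x) := by
    induction x using hQ.wellFounded.induction with
    | _ x ih =>
    have := hQ.finite_in x
    have := hQ.finite_out x
    refine Point.hasDualFiltration_vertex ?_
    rintro ⟨w, e | t⟩
    · exact ih w ⟨Sum.inl e⟩
    · exact Point.hasDualFiltration_inner (t := ⟨w, x, t⟩) (ih w ⟨Sum.inr t⟩) _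
  cases X with
  | vertex x => exact key x
  | inner t a => exact Point.hasDualFiltration_inner (key _) a

theorem hasDualFiltration_op (X : Q.Pointᵒᵖ) : HasDualFiltration X := by
  have key (x : Q.Underlying) : HasDualFiltration (op (Point.vertex x)) := by
    induction x using hQ.wellFounded'.induction with
    | _ x ih =>
    have := hQ.finite_in x
    have := hQ.finite_out x
    refine Point.hasDualFiltration_op_vertex ?_
    rintro ⟨y, e | t⟩
    · exact ih y ⟨Sum.inl e⟩
    · exact Point.hasDualFiltration_op_inner (t := ⟨x, y, t⟩) (ih y ⟨Sum.inr t⟩) _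
  obtain ⟨x | ⟨t, a⟩⟩ := X
  · exact key x
  · exact Point.hasDualFiltration_op_inner (key _) a

end IsStronglyLocallyFinite

end ThreadQuiver

/-! ## Functors out of free linear additive categories -/

namespace IsFreeOn

variable {k : Type u} [Field k] {C A : Type u} [Category.{u} C] [Category.{u} A]
  [Preadditive A] [Linear k A] {ι : C ⥤ A} (F : IsFreeOn k ι)
  {B : Type u} [Category.{u} B] [Preadditive B] [Linear k B]
include F

omit [Linear k B] in
theorem natTrans_ext {G H : A ⥤ B} [G.Additive] {α β : G ⟶ H}
    (h : ∀ X, α.app (ι.obj X) = β.app (ι.obj X)) : α = β := by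
  ext Z
  obtain ⟨n, X, i, p, -, -, hZ⟩ := F.decomposition Z
  have key (α : G ⟶ H) : α.app Z = ∑ j, G.map (p j) ≫ α.app _ ≫ H.map (i j) := by
    simp only [← NatTrans.naturality, ← Category.assoc, ← Functor.map_comp,
      ← Preadditive.sum_comp, ← Functor.map_sum, hZ]
    simp
  rw [key, key]
  simp only [h]

theorem naturality_of_naturality {G H : A ⥤ B} [G.Additive] [G.Linear k] [H.Additive] [H.Linear k]
    (γ : ι ⋙ G ⟶ ι ⋙ H) {X Y : C} (f : ι.obj X ⟶ ι.obj Y) :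
    G.map f ≫ γ.app Y = γ.app X ≫ H.map f := by
  induction F.span_eq_top X Y (Submodule.mem_top (x := f)) using Submodule.span_induction with
  | mem f h =>
    obtain ⟨f, rfl⟩ := h
    exact γ.naturality f
  | zero => rw [G.map_zero, H.map_zero, zero_comp, comp_zero]
  | add f g _ _ hf hg =>
    rw [G.map_add, H.map_add, Preadditive.add_comp, Preadditive.comp_add, hf, hg]
  | smul r f _ hf => rw [G.map_smul, H.map_smul, Linear.smul_comp, Linear.comp_smul, hf]

/-- The component at `Z` is the diagonal matrix of the given components in a chosen decomposition of
`Z`; naturality between objects of `C` makes it natural and independent of the choice. -/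
theorem exists_natTrans {G H : A ⥤ B} [G.Additive] [G.Linear k] [H.Additive] [H.Linear k]
    (γ : ι ⋙ G ⟶ ι ⋙ H) : ∃ α : G ⟶ H, ∀ X, α.app (ι.obj X) = γ.app X := by
  choose n X i p _ _ hZ using F.decomposition
  refine ⟨{ app := fun Z => ∑ j, G.map (p Z j) ≫ γ.app (X Z j) ≫ H.map (i Z j)
            naturality := fun Z Z' f => ?_ }, fun Y => ?_⟩
  · have h₁ (j : Fin (n Z)) : H.map (i Z j) ≫ H.map f =
        ∑ j', H.map (i Z j ≫ f ≫ p Z' j') ≫ H.map (i Z' j') := by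
      simp only [← Functor.map_comp, Category.assoc, ← Functor.map_sum, ← Preadditive.comp_sum, hZ,
        Category.comp_id]
    have h₂ (j' : Fin (n Z')) : G.map f ≫ G.map (p Z' j') =
        ∑ j, G.map (p Z j) ≫ G.map (i Z j ≫ f ≫ p Z' j') := by
      simp only [← Functor.map_comp, ← Category.assoc, ← Functor.map_sum, ← Preadditive.sum_comp, hZ,
        Category.id_comp]
    simp only [Preadditive.comp_sum, Preadditive.sum_comp, Category.assoc, h₁]
    simp only [← Category.assoc, h₂, Preadditive.sum_comp]
    simp only [Category.assoc]
    rw [Finset.sum_comm]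
    refine Finset.sum_congr rfl fun j _ => Finset.sum_congr rfl fun j' _ => ?_
    rw [reassoc_of% F.naturality_of_naturality γ (i Z j ≫ f ≫ p Z' j')]
  · have (j : Fin (n (ι.obj Y))) : G.map (p (ι.obj Y) j) ≫ γ.app (X (ι.obj Y) j) ≫ H.map (i (ι.obj Y) j) =
        γ.app Y ≫ H.map (p (ι.obj Y) j ≫ i (ι.obj Y) j) := by
      rw [← Category.assoc, F.naturality_of_naturality γ, Category.assoc, ← H.map_comp]
    simp only [this]
    rw [← Preadditive.comp_sum, ← H.map_sum, hZ, H.map_id]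
    exact Category.comp_id _

theorem exists_natIso {G H : A ⥤ B} [G.Additive] [G.Linear k] [H.Additive] [H.Linear k]
    (γ : ι ⋙ G ≅ ι ⋙ H) : ∃ α : G ≅ H, ∀ X, α.hom.app (ι.obj X) = γ.hom.app X := by
  obtain ⟨α, hα⟩ := F.exists_natTrans γ.hom
  obtain ⟨β, hβ⟩ := F.exists_natTrans γ.inv
  refine ⟨⟨α, β, F.natTrans_ext fun X => ?_, F.natTrans_ext fun X => ?_⟩, hα⟩
  · rw [NatTrans.comp_app, hα, hβ]
    exact γ.hom_inv_id_app X
  · rw [NatTrans.comp_app, hα, hβ]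
    exact γ.inv_hom_id_app X

/-- This carries the freeness of the explicit model over to an arbitrary 2-pushout. -/
theorem comp_equivalence (G : A ⥤ B) [G.Additive] [G.Linear k] [G.IsEquivalence] :
    IsFreeOn k (ι ⋙ G) where
  linearIndependent X Y := by
    have := (F.linearIndependent X Y).map' (G.mapLinearMap k)
      (LinearMap.ker_eq_bot.2 G.map_injective)
    exact this
  span_eq_top X Y := by
    have h := (F.span_eq_top X Y)
    have h' := Submodule.map_mono (f := G.mapLinearMap k (X := ι.obj X) (Y := ι.obj Y)) h
    rw [Submodule.map_span, ← Set.range_comp, Submodule.map_top,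
      LinearMap.range_eq_top.2 G.map_surjective] at h'
    exact h'
  decomposition Z := by
    obtain ⟨n, X, i, p, h₁, h₂, h₃⟩ := F.decomposition (G.objPreimage Z)
    let e := G.objObjPreimageIso Z
    refine ⟨n, X, fun j => G.map (i j) ≫ e.hom, fun j => e.inv ≫ G.map (p j), fun j => ?_,
      fun j j' h => ?_, ?_⟩
    · simp [← Functor.map_comp, h₁]
    · simp [← Functor.map_comp, h₂ j j' h]
    · have : ∑ j, (e.inv ≫ G.map (p j)) ≫ G.map (i j) ≫ e.hom =
          e.inv ≫ G.map (∑ j, p j ≫ i j) ≫ e.hom := by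
        simp [Preadditive.comp_sum, Preadditive.sum_comp]
      rw [this, h₃]
      simp

end IsFreeOn

/-! ### The inclusion of `C` in `kC` and its universal property. -/

namespace LinAddCat

variable (k : Type u) [Field k]

section

variable (C : Type u) [Category.{u} C]

/-- The inclusion `C ⥤ kC`. -/
def incl : C ⥤ free k C where
  obj X := ⟨1, fun _ => X⟩
  map f := InducedCategory.homMk fun _ _ => (Free.embedding k C).map f
  map_id X := InducedCategory.hom_ext (Mat_.hom_ext _ _ fun i j => by
    obtain rfl := Subsingleton.elim (α := Fin 1) i j
    exact (Mat_.id_apply_self (Mat_.mk (C := CategoryTheory.Free k C) (Fin 1) fun _ => X) i).symm)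
  map_comp f g := InducedCategory.hom_ext (Mat_.hom_ext _ _ fun i j =>
    ((Free.embedding k C).map_comp f g).trans (Fin.sum_univ_one fun _ : Fin 1 =>
      (Free.embedding k C).map f ≫ (Free.embedding k C).map g).symm)

variable {C}

/-- The morphisms in `kC` between objects of `C`. -/
def inclHomEquiv (X Y : C) :
    ((incl k C).obj X ⟶ (incl k C).obj Y) ≃ₗ[k] ((X ⟶ Y) →₀ k) where
  toFun f := f.hom (0 : Fin 1) (0 : Fin 1)
  invFun f := InducedCategory.homMk fun _ _ => f
  map_add' _ _ := rfl
  map_smul' _ _ := rfl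
  left_inv f := InducedCategory.hom_ext (Mat_.hom_ext _ _ fun i j => by
    obtain rfl := Subsingleton.elim (α := Fin 1) i 0
    obtain rfl := Subsingleton.elim (α := Fin 1) j 0
    rfl)
  right_inv _ := rfl

variable (C)

theorem isFreeOn_incl : IsFreeOn k (incl k C) where
  linearIndependent X Y := (Module.Basis.ofRepr (inclHomEquiv k X Y)).linearIndependent
  span_eq_top X Y := (Module.Basis.ofRepr (inclHomEquiv k X Y)).span_eq.ge
  decomposition Z := by
    obtain ⟨n, X⟩ := Z
    let M : Mat_ (CategoryTheory.Free k C) := Mat_.mk (Fin n) X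
    have hM (i j : Fin n) : ∑ l, (𝟙 M : Mat_.Hom M M) i l ≫ (𝟙 M : Mat_.Hom M M) l j =
        (𝟙 M : Mat_.Hom M M) i j := congrFun (congrFun (Category.id_comp (𝟙 M)) i) j
    -- Inclusions and projections are the rows and columns of the identity matrix; the required
    -- identities are the entries of `𝟙 M ≫ 𝟙 M = 𝟙 M`.
    refine ⟨n, X, fun j => InducedCategory.homMk fun _ l => (𝟙 M : Mat_.Hom M M) j l,
      fun j => InducedCategory.homMk fun l _ => (𝟙 M : Mat_.Hom M M) l j, fun j => ?_,
      fun j j' h => ?_, ?_⟩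
    · refine InducedCategory.hom_ext (Mat_.hom_ext _ _ fun a b => ?_)
      obtain rfl := Subsingleton.elim (α := Fin 1) a b
      exact (hM j j).trans ((Mat_.id_apply_self M j).trans (Mat_.id_apply_self
        (Mat_.mk (Fin 1) fun _ => X j) a).symm)
    · refine InducedCategory.hom_ext (Mat_.hom_ext _ _ fun a b => ?_)
      exact (hM j j').trans (Mat_.id_apply_of_ne M _ _ h)
    · refine InducedCategory.hom_ext (Mat_.hom_ext _ _ fun a b => ?_)
      let Z : free k C := ⟨n, X⟩
      let entry : (Z ⟶ Z) →+ (M.X a ⟶ M.X b) :=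
        { toFun := fun f => f.hom a b, map_zero' := rfl, map_add' := fun _ _ => rfl }
      refine (map_sum entry _ _).trans (Eq.trans (Finset.sum_congr rfl fun j _ => ?_)
        (hM a b))
      exact Fin.sum_univ_one fun _ : Fin 1 =>
        (𝟙 M : Mat_.Hom M M) a j ≫ (𝟙 M : Mat_.Hom M M) j b

variable {C}

theorem freeMap_map_incl_map {D : Type u} [Category.{u} D] (F : C ⥤ D) {X Y : C} (f : X ⟶ Y) :
    (freeMap k F).obj.map ((incl k C).map f) = (incl k D).map (F.map f) :=
  InducedCategory.hom_ext (Mat_.hom_ext _ _ fun _ _ =>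
    (Free.lift_map_single k (F ⋙ Free.embedding k D) f 1).trans (one_smul _ _))

variable {k}

/-- A direct sum with a single summand. -/
def biproductFinOne {E : Type u} [Category.{u} E] [Preadditive E] [HasFiniteBiproducts E] (X : E) :
    (⨁ fun _ : Fin 1 => X) ≅ X where
  hom := biproduct.π _ 0
  inv := biproduct.ι (fun _ : Fin 1 => X) 0
  hom_inv_id := by
    refine biproduct.hom_ext' _ _ fun i => ?_
    obtain rfl : i = 0 := Subsingleton.elim _ _
    simp
  inv_hom_id := by simp

theorem biproduct_matrix_comp_biproductFinOne_hom {E : Type u} [Category.{u} E] [Preadditive E]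
    [HasFiniteBiproducts E] {X Y : E} (g : X ⟶ Y) :
    biproduct.matrix (fun _ _ : Fin 1 => g) ≫ (biproductFinOne Y).hom =
      (biproductFinOne X).hom ≫ g := by
  refine biproduct.hom_ext' _ _ fun i => ?_
  obtain rfl : i = 0 := Subsingleton.elim _ _
  simp [biproductFinOne]

/-- Linearize `K` and extend it to matrices. An object of `C` goes to a biproduct with one summand,
so the restriction is only isomorphic to `K`. -/
theorem exists_lift {E : LinAddCat k} (K : C ⥤ E) :
    ∃ H : Fun (free k C) E, Nonempty (incl k C ⋙ H.obj ≅ K) := by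
  let L := Mat_.lift (Free.lift k K)
  let I := inducedFunctor fun X : Σ n : ℕ, Fin n → CategoryTheory.Free k C => Mat_.mk (Fin X.1) X.2
  have hL {M N : Mat_ (CategoryTheory.Free k C)} (f g : M ⟶ N) : L.map (f + g) = L.map f + L.map g :=
    L.map_add
  refine ⟨⟨I ⋙ L, ⟨⟨fun {X Y f g} => hL f.hom g.hom⟩, ⟨fun {X Y} f r => ?_⟩⟩⟩,
    ⟨NatIso.ofComponents (fun X => biproductFinOne (K.obj X)) fun {X Y} f => ?_⟩⟩
  · refine biproduct.hom_ext _ _ fun j => biproduct.hom_ext' _ _ fun i => ?_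
    change biproduct.ι _ i ≫ biproduct.matrix (fun i j => (Free.lift k K).map ((r • f).hom i j)) ≫
      biproduct.π _ j = biproduct.ι _ i ≫ (r • biproduct.matrix fun i j =>
        (Free.lift k K).map (f.hom i j)) ≫ biproduct.π _ j
    rw [Linear.smul_comp, Linear.comp_smul]
    simp only [biproduct.matrix_π, biproduct.ι_desc]
    exact (Free.lift k K).map_smul r (f.hom i j)
  · refine Eq.trans ?_ (biproduct_matrix_comp_biproductFinOne_hom (E := E) (K.map f))
    have h : (Free.lift k K).map ((Free.embedding k C).map f) = K.map f :=
      (Free.lift_map_single k K f 1).trans (one_smul _ _)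
    exact congrArg (fun g : K.obj X ⟶ K.obj Y => biproduct.matrix (fun _ _ : Fin 1 => g) ≫
      (biproductFinOne (K.obj Y)).hom) h

end

end LinAddCat

/-! ## Functors on the category of paths in a thread quiver -/

namespace ThreadOrder

variable (T : Type u) [LinearOrder T]

/-- The order of a thread, with its extremal elements singled out. -/
inductive Segment : Type u
  | bot
  | inner (a : Inner T)
  | top

variable {T}

/-- The element of the order. -/
def Segment.val : Segment T → ThreadOrder T
  | bot => ThreadOrder.bot T
  | inner a => a.1
  | top => ThreadOrder.top T

/-- With the three constructors, functors on a thread can be defined by matching, instead of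
deciding whether an element is extremal; `inclInv` leads back from the actual order. -/
instance : Preorder (Segment T) := Preorder.lift Segment.val

theorem Segment.val_surjective : Function.Surjective (Segment.val (T := T)) := fun a => by
  by_cases h : a = ThreadOrder.bot T
  · exact ⟨bot, h.symm⟩
  by_cases h' : a = ThreadOrder.top T
  · exact ⟨top, h'.symm⟩
  · exact ⟨inner ⟨a, h, h'⟩, rfl⟩

/-- The element of the segment that corresponds to an element of the order. -/
def Segment.ofVal (a : ThreadOrder T) : Segment T := (val_surjective a).choose

theorem Segment.val_ofVal (a : ThreadOrder T) : val (ofVal a) = a := (val_surjective a).choose_spec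

variable (T) in
/-- The inclusion functor. -/
def Segment.incl : Segment T ⥤ ThreadOrder T :=
  Monotone.functor (f := Segment.val) fun _ _ h => h

variable (T) in
/-- The inverse of the inclusion functor. -/
def Segment.inclInv : ThreadOrder T ⥤ Segment T :=
  Monotone.functor (f := Segment.ofVal (T := T)) fun a b h =>
    (val_ofVal a).trans_le (h.trans (val_ofVal b).ge)

/-- Elements that determine each other are isomorphic. -/
def Segment.isoVal (a : Segment T) : ofVal (val a) ≅ a where
  hom := homOfLE (val_ofVal (val a)).le
  inv := homOfLE (val_ofVal (val a)).ge
  hom_inv_id := Subsingleton.elim _ _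
  inv_hom_id := Subsingleton.elim _ _

theorem Segment.bot_le_top : (bot : Segment T) ≤ top := ThreadOrder.bot_le T _

theorem Segment.bot_le_inner (a : Inner T) : bot ≤ inner a := ThreadOrder.bot_le T _

theorem Segment.inner_le_top (a : Inner T) : inner a ≤ top := ThreadOrder.le_top T _

theorem Segment.not_inner_le_bot (a : Inner T) : ¬ inner a ≤ bot := fun h =>
  a.2.1 (le_antisymm h (ThreadOrder.bot_le T _))

theorem Segment.not_top_le_inner (a : Inner T) : ¬ top ≤ inner a := fun h =>
  a.2.2 (le_antisymm (ThreadOrder.le_top T _) h)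

theorem Segment.not_top_le_bot : ¬ (top : Segment T) ≤ bot := fun h =>
  absurd (le_antisymm h (ThreadOrder.bot_le T (ThreadOrder.top T))) Sum.inr_ne_inl

end ThreadOrder

namespace ThreadQuiver

open Quiver ThreadOrder

variable (Q : ThreadQuiver.{u})

/-- The order of a thread, with its extremal elements singled out. -/
abbrev Segment (t : Q.Thread) : Type u := ThreadOrder.Segment (Q.label t.2.2)

namespace Point

variable {Q} in
/-- The morphism between vertices given by a path in `Q_r`. -/
def vertexHom {x y : Q.Underlying} (p : Path x y) : vertex x ⟶ vertex y :=
  Hom.path (X := vertex x) (Y := vertex y) p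

/-- The functor from the path category of `Q_r`. -/
def ofPaths : Paths Q.Underlying ⥤ Q.Point where
  obj x := vertex x
  map p := vertexHom p

variable {Q}

/-- The points of a thread. -/
def ofSegment (t : Q.Thread) : Q.Segment t → Q.Point
  | .bot => vertex t.1
  | .inner a => inner t a
  | .top => vertex t.2.1

/-- The morphisms within a thread. -/
def ofSegmentHom (t : Q.Thread) : ∀ {a b : Q.Segment t}, a ≤ b → Hom (ofSegment t a) (ofSegment t b)
  | .bot, .bot, _ => .path (X := vertex t.1) (Y := vertex t.1) .nil
  | .bot, .inner a, _ => source t a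
  | .bot, .top, _ => .path (X := vertex t.1) (Y := vertex t.2.1) (arrow t).toPath
  | .inner _, .inner _, h => .le h
  | .inner a, .top, _ => target t a
  | .top, .top, _ => .path (X := vertex t.2.1) (Y := vertex t.2.1) .nil
  | .inner a, .bot, h => (Segment.not_inner_le_bot a h).elim
  | .top, .inner a, h => (Segment.not_top_le_inner a h).elim
  | .top, .bot, h => (Segment.not_top_le_bot h).elim

theorem ofSegmentHom_comp (t : Q.Thread) : ∀ {a b c : Q.Segment t} (h : a ≤ b) (h' : b ≤ c),
    (ofSegmentHom t h).comp (ofSegmentHom t h') = ofSegmentHom t (h.trans h') := by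
  intro a b c h h'
  rcases a with _ | a | _ <;> rcases b with _ | b | _ <;> rcases c with _ | c | _ <;>
    first
    | exact (Segment.not_inner_le_bot _ ‹_›).elim
    | exact (Segment.not_top_le_inner _ ‹_›).elim
    | exact (Segment.not_top_le_bot ‹_›).elim
    | rfl

/-- The functor from the order of a thread. -/
def segment (t : Q.Thread) : Q.Segment t ⥤ Q.Point where
  obj := ofSegment t
  map h := ofSegmentHom t h.le
  map_id a := by rcases a with _ | a | _ <;> rfl
  map_comp h h' := (ofSegmentHom_comp t h.le h'.le).symm

/-! ### Glueing -/

section Glue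

variable {E : Type u} [Category.{u} E]

/-- The morphism from a point to its exit. -/
def toExit : ∀ X : Q.Point, X ⟶ vertex (exit X)
  | vertex x => 𝟙 (vertex x)
  | inner t a => target t a

/-- The morphism to a point from its entry. -/
def fromEntry : ∀ X : Q.Point, vertex (entry X) ⟶ X
  | vertex x => 𝟙 (vertex x)
  | inner t a => source t a

/-- Naturality along a path thereby reduces to naturality between vertices and along the two
half-threads at its ends. -/
theorem path_eq {X Y : Q.Point} (p : Path (exit X) (entry Y)) :
    (Hom.path p : X ⟶ Y) = toExit X ≫ vertexHom p ≫ fromEntry Y := by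
  rcases X with x | ⟨t, a⟩ <;> rcases Y with y | ⟨t', b⟩ <;>
    exact congrArg Hom.path (Path.nil_comp p).symm

theorem exists_natTrans {G G' : Q.Point ⥤ E} (φ : ofPaths Q ⋙ G ⟶ ofPaths Q ⋙ G')
    (ψ : ∀ t, segment t ⋙ G ⟶ segment t ⋙ G') (hbot : ∀ t, (ψ t).app .bot = φ.app t.1)
    (htop : ∀ t, (ψ t).app .top = φ.app t.2.1) :
    ∃ γ : G ⟶ G', (∀ x, γ.app (vertex x) = φ.app x) ∧
      ∀ t a, γ.app (ofSegment t a) = (ψ t).app a := by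
  let γ : ∀ X : Q.Point, G.obj X ⟶ G'.obj X
    | vertex x => φ.app x
    | inner t a => (ψ t).app (.inner a)
  have h₁ (X : Q.Point) : G.map (toExit X) ≫ γ (vertex (exit X)) = γ X ≫ G'.map (toExit X) := by
    rcases X with x | ⟨t, a⟩
    · simp [toExit, exit]
    · refine Eq.trans ?_ ((ψ t).naturality (homOfLE (Segment.inner_le_top a)))
      rw [htop]
      rfl
  have h₂ (X : Q.Point) : G.map (fromEntry X) ≫ γ X =
      γ (vertex (entry X)) ≫ G'.map (fromEntry X) := by
    rcases X with x | ⟨t, a⟩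
    · simp [fromEntry, entry]
    · refine ((ψ t).naturality (homOfLE (Segment.bot_le_inner a))).trans ?_
      rw [hbot]
      rfl
  refine ⟨⟨γ, fun X Y f => ?_⟩, fun _ => rfl, fun t a => ?_⟩
  swap
  · rcases a with _ | a | _
    exacts [(hbot t).symm, rfl, (htop t).symm]
  change Hom X Y at f
  cases f with
  | path p =>
    have h₃ : G.map (vertexHom p) ≫ γ (vertex (entry Y)) =
      γ (vertex (exit X)) ≫ G'.map (vertexHom p) := φ.naturality p
    rw [path_eq, G.map_comp, G.map_comp, G'.map_comp, G'.map_comp, Category.assoc, Category.assoc,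
      h₂, reassoc_of% h₃, reassoc_of% h₁]
  | le h => exact (ψ _).naturality (homOfLE h : Segment.inner _ ⟶ Segment.inner _)

variable (K₁ : Paths Q.Underlying ⥤ E) (K₂ : ∀ t, Q.Segment t ⥤ E)
  (α : ∀ t : Q.Thread, K₁.obj t.1 ≅ (K₂ t).obj .bot)
  (β : ∀ t : Q.Thread, K₁.obj t.2.1 ≅ (K₂ t).obj .top)

/-- The objects of a glued functor. -/
def glueObj : Q.Point → E
  | vertex x => K₁.obj x
  | inner t a => (K₂ t).obj (.inner a)

/-- The morphism from a point to its exit in a glued functor. -/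
def glueToExit : ∀ X : Q.Point, glueObj K₁ K₂ X ⟶ K₁.obj (exit X)
  | vertex x => 𝟙 (K₁.obj x)
  | inner t a => (K₂ t).map (homOfLE (Segment.inner_le_top a)) ≫ (β t).inv

/-- The morphism to a point from its entry in a glued functor. -/
def glueFromEntry : ∀ X : Q.Point, K₁.obj (entry X) ⟶ glueObj K₁ K₂ X
  | vertex x => 𝟙 (K₁.obj x)
  | inner t a => (α t).hom ≫ (K₂ t).map (homOfLE (Segment.bot_le_inner a))

/-- The morphisms of a glued functor. -/
def glueMap : ∀ {X Y : Q.Point}, Hom X Y → (glueObj K₁ K₂ X ⟶ glueObj K₁ K₂ Y)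
  | X, Y, .path p => glueToExit K₁ K₂ β X ≫ K₁.map p ≫ glueFromEntry K₁ K₂ α Y
  | _, _, .le h => (K₂ _).map (homOfLE (show Segment.inner _ ≤ Segment.inner _ from h))

variable {K₁ K₂ α β}
variable (h : ∀ t : Q.Thread, K₁.map (arrow t).toPath ≫ (β t).hom =
  (α t).hom ≫ (K₂ t).map (homOfLE Segment.bot_le_top))

include h in
-- This is where the compatibility `h` on thread arrows enters: crossing a thread through an inner
-- point must agree with `K₁` on the arrow.
theorem glueFromEntry_comp_glueToExit (X : Q.Point) :
    glueFromEntry K₁ K₂ α X ≫ glueToExit K₁ K₂ β X = K₁.map (passage X) := by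
  rcases X with x | ⟨t, a⟩
  · exact (Category.id_comp _).trans (K₁.map_id x).symm
  · change ((α t).hom ≫ (K₂ t).map _) ≫ (K₂ t).map _ ≫ (β t).inv = K₁.map (arrow t).toPath
    rw [← cancel_mono (β t).hom, h]
    simp only [Category.assoc, Iso.inv_hom_id, Category.comp_id, ← Functor.map_comp]
    rfl

/-- The functor that is glued from functors on the path category and on the threads. -/
def glue : Q.Point ⥤ E where
  obj := glueObj K₁ K₂
  map f := glueMap K₁ K₂ α β f
  map_id X := by
    rcases X with x | ⟨t, a⟩
    · refine (Category.id_comp _).trans ((Category.comp_id _).trans (K₁.map_id x))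
    · exact (K₂ t).map_id _
  map_comp {X Y Z} f g := by
    change Hom X Y at f
    change Hom Y Z at g
    cases f with
    | path p => cases g with
      | path q =>
        change glueToExit K₁ K₂ β X ≫ K₁.map ((p.comp (passage Y)).comp q) ≫
          glueFromEntry K₁ K₂ α Z = (glueToExit K₁ K₂ β X ≫ K₁.map p ≫ glueFromEntry K₁ K₂ α Y) ≫
            glueToExit K₁ K₂ β Y ≫ K₁.map q ≫ glueFromEntry K₁ K₂ α Z
        have e : K₁.map ((p.comp (passage Y)).comp q) = K₁.map p ≫ (glueFromEntry K₁ K₂ α Y ≫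
            glueToExit K₁ K₂ β Y) ≫ K₁.map q := by
          rw [glueFromEntry_comp_glueToExit h]
          exact (K₁.map_comp _ _).trans ((congrArg (· ≫ K₁.map q) (K₁.map_comp _ _)).trans
            (Category.assoc _ _ _))
        rw [e]
        simp only [Category.assoc]
      | @le t a b h' =>
        have e : glueFromEntry K₁ K₂ α (inner t a) ≫ glueMap K₁ K₂ α β (.le h') =
            glueFromEntry K₁ K₂ α (inner t b) :=
          (Category.assoc _ _ _).trans (congrArg ((α t).hom ≫ ·) ((K₂ t).map_comp _ _).symm)
        change glueToExit K₁ K₂ β X ≫ K₁.map p ≫ glueFromEntry K₁ K₂ α (inner t b) =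
          (glueToExit K₁ K₂ β X ≫ K₁.map p ≫ glueFromEntry K₁ K₂ α (inner t a)) ≫
            glueMap K₁ K₂ α β (.le h')
        rw [Category.assoc, Category.assoc, e]
    | @le t a b h' => cases g with
      | path q =>
        have e : glueMap K₁ K₂ α β (.le h') ≫ glueToExit K₁ K₂ β (inner t b) =
            glueToExit K₁ K₂ β (inner t a) :=
          (Category.assoc _ _ _).symm.trans (congrArg (· ≫ (β t).inv) ((K₂ t).map_comp _ _).symm)
        change glueToExit K₁ K₂ β (inner t a) ≫ K₁.map q ≫ glueFromEntry K₁ K₂ α Z =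
          glueMap K₁ K₂ α β (.le h') ≫ glueToExit K₁ K₂ β (inner t b) ≫ K₁.map q ≫
            glueFromEntry K₁ K₂ α Z
        rw [reassoc_of% e]
        rfl
      | @le _ _ c h'' =>
        exact (K₂ t).map_comp (X := Segment.inner a) (Y := Segment.inner b)
          (Z := Segment.inner c) (homOfLE h') (homOfLE h'')

/-- The restriction of a glued functor to the path category. -/
def ofPathsGlue : ofPaths Q ⋙ glue h ≅ K₁ :=
  NatIso.ofComponents (fun x => Iso.refl (K₁.obj x)) fun f => by
    change (𝟙 _ ≫ K₁.map f ≫ 𝟙 _) ≫ 𝟙 _ = 𝟙 _ ≫ K₁.map f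
    simp

/-- The restriction of a glued functor to a thread. -/
def segmentGlue (t : Q.Thread) : segment t ⋙ glue h ≅ K₂ t :=
  NatIso.ofComponents (fun
    | .bot => α t
    | .inner a => Iso.refl ((K₂ t).obj (.inner a))
    | .top => β t) fun {a b} f => by
    have hf := f.le
    obtain rfl : f = homOfLE hf := rfl
    rcases a with _ | a | _ <;> rcases b with _ | b | _
    · change (𝟙 _ ≫ K₁.map (𝟙 _) ≫ 𝟙 _) ≫ (α t).hom = (α t).hom ≫ (K₂ t).map (𝟙 _)
      erw [K₁.map_id]
      simp
    · change (𝟙 _ ≫ K₁.map (𝟙 _) ≫ (α t).hom ≫ (K₂ t).map (homOfLE hf)) ≫ 𝟙 _ = _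
      erw [K₁.map_id]
      simp
      rfl
    · change (𝟙 _ ≫ K₁.map (arrow t).toPath ≫ 𝟙 _) ≫ (β t).hom = _
      rw [Category.id_comp, Category.comp_id]
      exact h t
    · exact (Segment.not_inner_le_bot _ hf).elim
    · exact (Category.comp_id _).trans (Category.id_comp _).symm
    · change (((K₂ t).map (homOfLE hf) ≫ (β t).inv) ≫ K₁.map (𝟙 _) ≫ 𝟙 _) ≫ (β t).hom = 𝟙 _ ≫ _
      erw [K₁.map_id]
      simp
    · exact (Segment.not_top_le_bot hf).elim
    · exact (Segment.not_top_le_inner _ hf).elim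
    · change (𝟙 _ ≫ K₁.map (𝟙 _) ≫ 𝟙 _) ≫ (β t).hom = (β t).hom ≫ (K₂ t).map (𝟙 _)
      erw [K₁.map_id]
      simp

end Glue

end Point

end ThreadQuiver

/-! ## The 2-pushout -/

namespace ThreadOrder

variable (T : Type u) [LinearOrder T]

instance : (Segment.inclInv T).Faithful where
  map_injective _ := Subsingleton.elim _ _

instance : (Segment.inclInv T).Full where
  map_surjective {a b} f :=
    ⟨homOfLE ((Segment.val_ofVal a).ge.trans ((show Segment.val _ ≤ Segment.val _ from f.le).trans
      (Segment.val_ofVal b).le)), Subsingleton.elim _ _⟩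

instance : (Segment.inclInv T).EssSurj where
  mem_essImage a := ⟨Segment.val a, ⟨Segment.isoVal a⟩⟩

instance : (Segment.inclInv T).IsEquivalence where

end ThreadOrder

namespace LinAddCat

variable (k : Type u) [Field k]

/-- The restriction of `F ⋙ H` along the inclusion, for a functor `F` between categories. -/
def inclFreeMapIso {C D : Type u} [Category.{u} C] [Category.{u} D] (F : C ⥤ D) {E : LinAddCat k}
    (H : Fun (free k D) E) :
    incl k C ⋙ ((freeMap k F).comp H).obj ≅ F ⋙ incl k D ⋙ H.obj :=
  NatIso.ofComponents (fun X => Iso.refl (H.obj.obj ((incl k D).obj (F.obj X)))) fun f =>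
    (Category.comp_id _).trans ((congrArg H.obj.map (freeMap_map_incl_map k F f)).trans
      (Category.id_comp _).symm)

theorem freeMap_map_freeMap_map_incl_map {A B D : Type u} [Category.{u} A] [Category.{u} B]
    [Category.{u} D] (f : A ⥤ B) (p : B ⥤ D) {X Y : A} (φ : X ⟶ Y) :
    (freeMap k p).obj.map ((freeMap k f).obj.map ((incl k A).map φ)) =
      (incl k D).map ((f ⋙ p).map φ) :=
  (congrArg (freeMap k p).obj.map (freeMap_map_incl_map k f φ)).trans
    (freeMap_map_incl_map k p (f.map φ))

/-- The square of categories commutes up to `θ`, and an isomorphism on the objects of `A` extends to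
all of `kA`. -/
theorem exists_iso_freeMap {A B C D : Type u} [Category.{u} A] [Category.{u} B] [Category.{u} C]
    [Category.{u} D] {f : A ⥤ B} {g : A ⥤ C} {p : B ⥤ D} {r : C ⥤ D} (θ : f ⋙ p ≅ g ⋙ r) :
    ∃ e : (precomp (freeMap k f) (free k D)).obj (freeMap k p) ≅
      (precomp (freeMap k g) (free k D)).obj (freeMap k r),
      ∀ X, e.hom.hom.app ((incl k A).obj X) = (incl k D).map (θ.hom.app X) := by
  obtain ⟨_, _⟩ := ((precomp (freeMap k f) (free k D)).obj (freeMap k p)).property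
  obtain ⟨_, _⟩ := ((precomp (freeMap k g) (free k D)).obj (freeMap k r)).property
  obtain ⟨α, hα⟩ := (isFreeOn_incl k A).exists_natIso
    (G := ((precomp (freeMap k f) (free k D)).obj (freeMap k p)).obj)
    (H := ((precomp (freeMap k g) (free k D)).obj (freeMap k r)).obj)
    (NatIso.ofComponents (fun X => (incl k D).mapIso (θ.app X)) fun {X Y} φ => by
      change (freeMap k p).obj.map ((freeMap k f).obj.map ((incl k A).map φ)) ≫
          (incl k D).map (θ.hom.app Y) = (incl k D).map (θ.hom.app X) ≫
        (freeMap k r).obj.map ((freeMap k g).obj.map ((incl k A).map φ))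
      rw [freeMap_map_freeMap_map_incl_map, freeMap_map_freeMap_map_incl_map]
      refine ((incl k D).map_comp _ _).symm.trans (Eq.trans ?_ ((incl k D).map_comp _ _))
      exact congrArg (incl k D).map (θ.hom.naturality φ))
  exact ⟨ObjectProperty.isoMk _ α, hα⟩

end LinAddCat

namespace ThreadQuiver

open Quiver ThreadOrder LinAddCat

variable (Q : ThreadQuiver.{u})

namespace Point

/-- The functor from the orders of the threads. -/
def ofOrders : (Σ t : Q.Thread, Q.order t) ⥤ Q.Point :=
  Sigma.desc fun t => Segment.inclInv _ ⋙ segment t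

/-- The arrow of a thread is identified with the morphism between the ends of its order. -/
def arrowIso : Sigma.desc Q.arrowFunctor ⋙ ofPaths Q ≅
    Sigma.desc (fun t => Q.endsFunctor t ⋙ Sigma.incl t) ⋙ ofOrders Q :=
  Sigma.natIso fun t =>
    ComposableArrows.isoMk₁
      (F := Sigma.incl (C := fun _ : Q.Thread => Fin 2) t ⋙ Sigma.desc Q.arrowFunctor ⋙ ofPaths Q)
      (G := Sigma.incl (C := fun _ : Q.Thread => Fin 2) t ⋙
        Sigma.desc (fun t => Q.endsFunctor t ⋙ Sigma.incl t) ⋙ ofOrders Q)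
      ((segment t).mapIso (Segment.isoVal .bot).symm)
      ((segment t).mapIso (Segment.isoVal .top).symm)
      (((segment t).map_comp (homOfLE Segment.bot_le_top) (Segment.isoVal .top).inv).symm.trans
        ((segment t).map_comp (Segment.isoVal .bot).inv ((Segment.inclInv _).map
          (homOfLE (ThreadOrder.bot_le _ _)))))

variable (k : Type u) [Field k]

/-- The cocone with vertex the free category on the category of paths in a thread quiver. -/
def cocone : Cocone (Q.arrowMap k) (Q.endsMap k) (free k Q.Point) where
  fst := freeMap k (ofPaths Q)
  snd := freeMap k (ofOrders Q)
  iso := (exists_iso_freeMap k (arrowIso Q)).choose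

variable {k} {E : LinAddCat k}

theorem restrict_iso_hom_app (H : Fun (free k Q.Point) E) (X : Σ _ : Q.Thread, Fin 2) :
    (((cocone Q k).restrict E).obj H).iso.hom.hom.app ((incl k _).obj X) =
      H.obj.map ((incl k _).map ((arrowIso Q).hom.app X)) := by
  rw [← (exists_iso_freeMap k (arrowIso Q)).choose_spec X]
  exact (Category.id_comp _).trans (Category.comp_id _)

variable {Q}

/-- Every point is a vertex or isomorphic to a point coming from a thread order, so the two
restrictions determine a transformation. -/
theorem restrict_faithful : ((cocone Q k).restrict E).Faithful where
  map_injective {H H'} β β' h := by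
    obtain ⟨_, _⟩ := H.property
    refine ObjectProperty.hom_ext _ ((isFreeOn_incl k Q.Point).natTrans_ext fun X => ?_)
    rcases X with x | ⟨t, a⟩
    · exact congrArg (fun m => m.fst.hom.app ((incl k _).obj x)) h
    · have h' : β.hom.app ((incl k _).obj ((ofOrders Q).obj ⟨t, a.1⟩)) =
          β'.hom.app ((incl k _).obj ((ofOrders Q).obj ⟨t, a.1⟩)) :=
        congrArg (fun m => m.snd.hom.app ((incl k _).obj ⟨t, a.1⟩)) h
      let e : (incl k _).obj ((ofOrders Q).obj ⟨t, a.1⟩) ≅ (incl k Q.Point).obj (inner t a) :=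
        (incl k _).mapIso ((segment t).mapIso (Segment.isoVal (.inner a)))
      rw [← cancel_epi (H.obj.map e.hom), β.hom.naturality, β'.hom.naturality, h']

end Point

end ThreadQuiver

/-! ### Fullness and essential surjectivity of the restriction functor. -/

namespace ThreadQuiver

open Quiver ThreadOrder LinAddCat

variable {Q : ThreadQuiver.{u}}

namespace Point

variable {k : Type u} [Field k] {E : LinAddCat k}

theorem restrict_full : ((cocone Q k).restrict E).Full where
  map_surjective {H H'} m := by
    obtain ⟨_, _⟩ := H.property
    obtain ⟨_, _⟩ := H'.property
    let φ : ofPaths Q ⋙ incl k Q.Point ⋙ H.obj ⟶ ofPaths Q ⋙ incl k Q.Point ⋙ H'.obj :=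
      (inclFreeMapIso k (ofPaths Q) H).inv ≫ Functor.whiskerLeft (incl k _) m.fst.hom ≫
        (inclFreeMapIso k (ofPaths Q) H').hom
    have hφ (x) : φ.app x = m.fst.hom.app ((incl k _).obj x) :=
      (Category.id_comp _).trans (Category.comp_id _)
    let τ : ofOrders Q ⋙ incl k Q.Point ⋙ H.obj ⟶ ofOrders Q ⋙ incl k Q.Point ⋙ H'.obj :=
      (inclFreeMapIso k (ofOrders Q) H).inv ≫ Functor.whiskerLeft (incl k _) m.snd.hom ≫
        (inclFreeMapIso k (ofOrders Q) H').hom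
    have hτ (X) : τ.app X = m.snd.hom.app ((incl k _).obj X) :=
      (Category.id_comp _).trans (Category.comp_id _)
    -- Restriction along the equivalence `Segment.inclInv` is full, so transformations on the order
    -- come from transformations on the segment.
    have hψ (t : Q.Thread) : ∃ ψ : segment t ⋙ incl k Q.Point ⋙ H.obj ⟶
        segment t ⋙ incl k Q.Point ⋙ H'.obj, ∀ a, ψ.app (Segment.ofVal a) = τ.app ⟨t, a⟩ := by
      obtain ⟨ψ, hψ⟩ := ((Functor.whiskeringLeft _ _ E).obj (Segment.inclInv _)).map_surjective
        (X := segment t ⋙ incl k Q.Point ⋙ H.obj) (Y := segment t ⋙ incl k Q.Point ⋙ H'.obj)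
        (Functor.whiskerLeft (Sigma.incl t) τ)
      exact ⟨ψ, fun a => NatTrans.congr_app hψ a⟩
    choose ψ hψ using hψ
    -- The compatibility of `m` with the structure isomorphisms; at the two ends of a thread it says
    -- that `φ` and `ψ t` agree there.
    have hm (X : Σ _ : Q.Thread, Fin 2) :
        m.fst.hom.app (((Q.arrowMap k).obj.obj ((incl k _).obj X))) ≫
          H'.obj.map ((incl k _).map ((arrowIso Q).hom.app X)) =
        H.obj.map ((incl k _).map ((arrowIso Q).hom.app X)) ≫
          m.snd.hom.app ((Q.endsMap k).obj.obj ((incl k _).obj X)) := by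
      have := congrArg (fun n => n.hom.app ((incl k _).obj X)) m.w
      exact (congrArg (_ ≫ ·) (restrict_iso_hom_app Q H' X).symm).trans
        (this.trans (congrArg (· ≫ _) (restrict_iso_hom_app Q H X)))
    have hend (t : Q.Thread) (a : Q.Segment t)
        (f : (segment t ⋙ incl k Q.Point ⋙ H.obj).obj a ⟶
          (segment t ⋙ incl k Q.Point ⋙ H'.obj).obj a)
        (h : f ≫ (segment t ⋙ incl k Q.Point ⋙ H'.obj).map (Segment.isoVal a).inv =
          (segment t ⋙ incl k Q.Point ⋙ H.obj).map (Segment.isoVal a).inv ≫ τ.app ⟨t, a.val⟩) :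
        (ψ t).app a = f := by
      refine (cancel_mono ((segment t ⋙ incl k Q.Point ⋙ H'.obj).map
        (Segment.isoVal a).inv)).1 (Eq.symm ?_)
      exact h.trans ((congrArg (_ ≫ ·) (hψ t _).symm).trans ((ψ t).naturality _))
    obtain ⟨_, _⟩ := (((cocone Q k).restrict E).obj H).fst.property
    obtain ⟨_, _⟩ := (((cocone Q k).restrict E).obj H).snd.property
    have hbot (t : Q.Thread) : (ψ t).app .bot = φ.app t.1 := hend t .bot _
      (((congrArg (· ≫ _) (hφ t.1)).trans (hm ⟨t, 0⟩)).trans (congrArg (_ ≫ ·) (hτ ⟨t, Segment.bot.val⟩).symm))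
    have htop (t : Q.Thread) : (ψ t).app .top = φ.app t.2.1 := hend t .top _
      (((congrArg (· ≫ _) (hφ t.2.1)).trans (hm ⟨t, 1⟩)).trans (congrArg (_ ≫ ·) (hτ ⟨t, Segment.top.val⟩).symm))
    obtain ⟨γ, hγ₁, hγ₂⟩ := exists_natTrans φ ψ hbot htop
    obtain ⟨β, hβ⟩ := (isFreeOn_incl k Q.Point).exists_natTrans γ
    refine ⟨ObjectProperty.homMk β, CategoricalPullback.hom_ext ?_ ?_⟩
    · refine ObjectProperty.hom_ext _ ((isFreeOn_incl k _).natTrans_ext fun x => ?_)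
      exact (hβ _).trans ((hγ₁ x).trans (hφ x))
    · refine ObjectProperty.hom_ext _ ((isFreeOn_incl k _).natTrans_ext fun X => ?_)
      exact (hβ _).trans ((hγ₂ X.1 _).trans ((hψ X.1 X.2).trans (hτ X)))

/-- The cocone restricts to functors on the path category and on the threads with isomorphisms at
the ends, and these are glued. What remains is to check the compatibility of the two resulting
isomorphisms, at the two objects of each `• → •`. -/
theorem restrict_essSurj : ((cocone Q k).restrict E).EssSurj where
  mem_essImage c := by
    let K₁ : Paths Q.Underlying ⥤ E := incl k _ ⋙ c.fst.obj
    let K₂ (t : Q.Thread) : Q.Segment t ⥤ E :=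
      Segment.incl _ ⋙ Sigma.incl (C := fun t => Q.order t) t ⋙ incl k _ ⋙ c.snd.obj
    let e := (isLinearFunctor _ _).ι.mapIso c.iso
    let α (t : Q.Thread) : K₁.obj t.1 ≅ (K₂ t).obj .bot := e.app ((incl k _).obj ⟨t, 0⟩)
    let β (t : Q.Thread) : K₁.obj t.2.1 ≅ (K₂ t).obj .top := e.app ((incl k _).obj ⟨t, 1⟩)
    have h (t : Q.Thread) : K₁.map (arrow t).toPath ≫ (β t).hom =
        (α t).hom ≫ (K₂ t).map (homOfLE Segment.bot_le_top) := by
      let f : (⟨t, 0⟩ : Σ _ : Q.Thread, Fin 2) ⟶ ⟨t, 1⟩ :=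
        (Sigma.incl (C := fun _ : Q.Thread => Fin 2) t).map (homOfLE zero_le_one)
      have h₁ := freeMap_map_incl_map k (Sigma.desc Q.arrowFunctor) f
      have h₂ := freeMap_map_incl_map k (Sigma.desc fun t => Q.endsFunctor t ⋙ Sigma.incl t) f
      have h₃ := e.hom.naturality ((incl k _).map f)
      exact (congrArg (fun g => c.fst.obj.map g ≫ (β t).hom) h₁).symm.trans
        (h₃.trans (congrArg (fun g => (α t).hom ≫ c.snd.obj.map g) h₂))
    obtain ⟨H, ⟨η⟩⟩ := exists_lift (E := E) (glue h)
    obtain ⟨_, _⟩ := (((cocone Q k).restrict E).obj H).fst.property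
    obtain ⟨_, _⟩ := (((cocone Q k).restrict E).obj H).snd.property
    obtain ⟨_, _⟩ := c.fst.property
    obtain ⟨_, _⟩ := c.snd.property
    obtain ⟨γ₁, hγ₁⟩ := (isFreeOn_incl k _).exists_natIso
      (G := (((cocone Q k).restrict E).obj H).fst.obj) (H := c.fst.obj)
      (inclFreeMapIso k (ofPaths Q) H ≪≫ Functor.isoWhiskerLeft (ofPaths Q) η ≪≫ ofPathsGlue h)
    let A (t : Q.Thread) := Sigma.incl (C := fun t => Q.order t) t ⋙ incl k _ ⋙ c.snd.obj
    obtain ⟨γ₂, hγ₂⟩ := (isFreeOn_incl k _).exists_natIso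
      (G := (((cocone Q k).restrict E).obj H).snd.obj) (H := c.snd.obj)
      (inclFreeMapIso k (ofOrders Q) H ≪≫ Functor.isoWhiskerLeft (ofOrders Q) η ≪≫
        Sigma.natIso fun t => (Functor.isoWhiskerLeft (Segment.inclInv _) (segmentGlue h t) ≪≫
          NatIso.ofComponents (fun a => (A t).mapIso (eqToIso (Segment.val_ofVal a)))
            fun f => ((A t).map_comp _ _).symm.trans ((congrArg (A t).map
              (Subsingleton.elim _ _)).trans ((A t).map_comp _ _))))
    have h₁ (x) : γ₁.hom.app ((incl k _).obj x) = η.hom.app (vertex x) :=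
      (hγ₁ x).trans ((Category.id_comp _).trans (Category.comp_id _))
    have h₂ (t : Q.Thread) (a : Q.order t) : γ₂.hom.app ((incl k _).obj ⟨t, a⟩) =
        η.hom.app ((segment t).obj (Segment.ofVal a)) ≫
          (segmentGlue h t).hom.app (Segment.ofVal a) ≫
            (A t).map (eqToHom (Segment.val_ofVal a)) :=
      (hγ₂ ⟨t, a⟩).trans (Category.id_comp _)
    -- Transport along `isoVal` cancels the choice made in `ofVal`, so that the value at an end of
    -- the thread is given by `segmentGlue` itself.
    have h₃ (t : Q.Thread) (a : Q.Segment t) :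
        (incl k _ ⋙ H.obj).map ((segment t).map (Segment.isoVal a).inv) ≫
            γ₂.hom.app ((incl k _).obj ⟨t, a.val⟩) =
          η.hom.app ((segment t).obj a) ≫ (segmentGlue h t).hom.app a := by
      have h₄ : (K₂ t).map (Segment.isoVal a).inv ≫
          (A t).map (eqToHom (Segment.val_ofVal a.val)) = 𝟙 _ :=
        ((A t).map_comp _ _).symm.trans ((congrArg (A t).map (Subsingleton.elim _ _)).trans
          ((A t).map_id _))
      have h₅ := (segmentGlue h t).hom.naturality (Segment.isoVal a).inv
      rw [h₂]
      refine (η.hom.naturality_assoc ((segment t).map (Segment.isoVal a).inv) _).trans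
        (congrArg (η.hom.app _ ≫ ·) ?_)
      refine (Category.assoc _ _ _).symm.trans ((congrArg (· ≫ _) h₅).trans
        ((Category.assoc _ _ _).trans ?_))
      exact (congrArg ((segmentGlue h t).hom.app a ≫ ·) h₄).trans (Category.comp_id _)
    refine ⟨H, ⟨CategoricalPullback.mkIso (ObjectProperty.isoMk _ γ₁)
      (ObjectProperty.isoMk _ γ₂) (ObjectProperty.hom_ext _ ?_)⟩⟩
    obtain ⟨_, _⟩ := ((precomp (Q.arrowMap k) E).obj (((cocone Q k).restrict E).obj H).fst).property
    refine (isFreeOn_incl k _).natTrans_ext fun ⟨t, i⟩ => ?_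
    change γ₁.hom.app _ ≫ e.hom.app _ =
      (((cocone Q k).restrict E).obj H).iso.hom.hom.app _ ≫ γ₂.hom.app _
    rw [restrict_iso_hom_app]
    obtain rfl | rfl : i = 0 ∨ i = 1 := by omega
    · exact (congrArg (· ≫ (α t).hom) (h₁ t.1)).trans (h₃ t .bot).symm
    · exact (congrArg (· ≫ (β t).hom) (h₁ t.2.1)).trans (h₃ t .top).symm

end Point

end ThreadQuiver

/-! ### Uniqueness of 2-pushouts -/

namespace LinAddCat

variable {k : Type u} [Field k] {A B C : LinAddCat k} {f : Fun A B} {g : Fun A C}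

/-- The identity functor. -/
def Fun.id (A : LinAddCat k) : Fun A A where
  obj := 𝟭 A
  property := ⟨inferInstance, inferInstance⟩

theorem Cocone.nonempty_restrict_iso {P E : LinAddCat k} {σ σ' : Cocone f g P} (e : σ ≅ σ')
    (V : Fun P E) : Nonempty ((σ.restrict E).obj V ≅ (σ'.restrict E).obj V) := by
  let e₁ := (isLinearFunctor _ _).ι.mapIso ((CategoricalPullback.π₁ _ _).mapIso e)
  let e₂ := (isLinearFunctor _ _).ι.mapIso ((CategoricalPullback.π₂ _ _).mapIso e)
  refine ⟨CategoricalPullback.mkIso (ObjectProperty.isoMk _ (Functor.isoWhiskerRight e₁ V.obj))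
    (ObjectProperty.isoMk _ (Functor.isoWhiskerRight e₂ V.obj)) (ObjectProperty.hom_ext _ ?_)⟩
  ext X
  have h : e.hom.fst.hom.app (f.obj.obj X) ≫ σ'.iso.hom.hom.app X =
      σ.iso.hom.hom.app X ≫ e.hom.snd.hom.app (g.obj.obj X) :=
    congrArg (fun m => m.hom.app X) e.hom.w
  have h' := (V.obj.map_comp _ _).symm.trans ((congrArg V.obj.map h).trans (V.obj.map_comp _ _))
  exact (congrArg (_ ≫ ·) ((Category.id_comp _).trans (Category.comp_id _))).trans
    (h'.trans (congrArg (· ≫ _) ((Category.id_comp _).trans (Category.comp_id _)).symm))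

/-- The restriction of a composition of functors. -/
def Cocone.restrictComp {P P' E : LinAddCat k} (σ : Cocone f g P) (U : Fun P P') (V : Fun P' E) :
    (σ.restrict E).obj (U.comp V) ≅ (((σ.restrict P').obj U).restrict E).obj V :=
  CategoricalPullback.mkIso (Iso.refl _) (Iso.refl _) (ObjectProperty.hom_ext _ (by
    ext X
    change 𝟙 _ ≫ 𝟙 _ ≫ V.obj.map (𝟙 _ ≫ U.obj.map (σ.iso.hom.hom.app X) ≫ 𝟙 _) ≫ 𝟙 _ =
      (𝟙 _ ≫ V.obj.map (U.obj.map (σ.iso.hom.hom.app X)) ≫ 𝟙 _) ≫ 𝟙 _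
    simp))

/-- The restriction of the identity functor. -/
def Cocone.restrictId {P : LinAddCat k} (σ : Cocone f g P) : (σ.restrict P).obj (Fun.id P) ≅ σ :=
  CategoricalPullback.mkIso (Iso.refl _) (Iso.refl _) (ObjectProperty.hom_ext _ (by
    ext X
    change 𝟙 _ ≫ σ.iso.hom.hom.app X = (𝟙 _ ≫ σ.iso.hom.hom.app X ≫ 𝟙 _) ≫ 𝟙 _
    simp))

/-- The composite and the identity restrict to isomorphic cocones, and restriction is fully
faithful. -/
theorem TwoPushout.nonempty_comp_iso_id {X Y : TwoPushout f g} {U : Fun X.pt Y.pt}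
    {V : Fun Y.pt X.pt} (hU : (X.cocone.restrict Y.pt).obj U ≅ Y.cocone)
    (hV : (Y.cocone.restrict X.pt).obj V ≅ X.cocone) : Nonempty (U.obj ⋙ V.obj ≅ 𝟭 X.pt) := by
  have := X.isEquivalence X.pt
  obtain ⟨e⟩ := Cocone.nonempty_restrict_iso hU V
  exact ⟨(isLinearFunctor _ _).ι.mapIso ((X.cocone.restrict X.pt).preimageIso
    (X.cocone.restrictComp U V ≪≫ e ≪≫ hV ≪≫ X.cocone.restrictId.symm))⟩

theorem TwoPushout.exists_isEquivalence (X Y : TwoPushout f g) :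
    ∃ U : Fun X.pt Y.pt, U.obj.IsEquivalence := by
  have := X.isEquivalence Y.pt
  have := Y.isEquivalence X.pt
  let U := (X.cocone.restrict Y.pt).objPreimage Y.cocone
  let V := (Y.cocone.restrict X.pt).objPreimage X.cocone
  have hU : (X.cocone.restrict Y.pt).obj U ≅ Y.cocone := Functor.objObjPreimageIso _ _
  have hV : (Y.cocone.restrict X.pt).obj V ≅ X.cocone := Functor.objObjPreimageIso _ _
  obtain ⟨e⟩ := TwoPushout.nonempty_comp_iso_id hU hV
  obtain ⟨e'⟩ := TwoPushout.nonempty_comp_iso_id hV hU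
  exact ⟨U, (CategoryTheory.Equivalence.mk U.obj V.obj e.symm e').isEquivalence_functor⟩

end LinAddCat

/-! ### The conclusion: the explicit 2-pushout, and the transfer to all others. -/

namespace ThreadQuiver

variable (Q : ThreadQuiver.{u}) (k : Type u) [Field k]

/-- The 2-pushout `kQ`, as the free category on the category of paths in the thread quiver. -/
def pathVariety : Q.PathVariety k where
  pt := LinAddCat.free k Q.Point
  cocone := Point.cocone Q k
  isEquivalence _ :=
    { faithful := Point.restrict_faithful
      full := Point.restrict_full
      essSurj := Point.restrict_essSurj }

variable {Q k}

theorem isSemiHereditary_and_isDualizing (hQ : Q.IsStronglyLocallyFinite) (kQ : Q.PathVariety k) :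
    IsSemiHereditary k kQ.pt ∧ IsDualizing k kQ.pt := by
  obtain ⟨U, _⟩ : ∃ U : LinAddCat.Fun (LinAddCat.free k Q.Point) kQ.pt, U.obj.IsEquivalence :=
    (Q.pathVariety k).exists_isEquivalence kQ
  obtain ⟨_, _⟩ := U.property
  have (X Y : Q.Point) : Finite (X ⟶ Y) :=
    Point.finite_hom hQ.wellFounded hQ.finite_in X Y
  exact ((LinAddCat.isFreeOn_incl k Q.Point).comp_equivalence U.obj).isSemiHereditary_and_isDualizing
    (Point.isEquidivisible hQ.wellFounded) hQ.hasDualFiltration hQ.hasDualFiltration_op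

end ThreadQuiver

end

end ThreadQuivers

theorem mainTheorem2 (k : Type u) [Field k] [IsAlgClosed k]
    (Q : ThreadQuivers.ThreadQuiver.{u}) (hQ : Q.IsStronglyLocallyFinite) :
    Nonempty (Q.PathVariety k) ∧
      ∀ kQ : Q.PathVariety k,
        ThreadQuivers.IsSemiHereditary k kQ.pt ∧ ThreadQuivers.IsDualizing k kQ.pt :=
  ⟨⟨Q.pathVariety k⟩, fun kQ => ThreadQuivers.ThreadQuiver.isSemiHereditary_and_isDualizing hQ kQ⟩
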